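/- Let $r\ge 0$, let $\mathfrak{gl}_r$ be the Lie algebra of complex $r\times r$ matrices with matrix units $E_{ij}$, acting on $V_r=\mathbb C^r$ with basis $u_1,\dots,u_r$, and let $\xi=(\xi_1\ge\dots\ge\xi_r\ge 0)$ be a partition, $n=|\xi|=\sum_i\xi_i$, $\xi^t_i=\#\{j:\xi_j\ge i\}$. **The module $V(\xi)$.** Let $\mathbb C\langle\mathcal X,\mathcal Y\rangle$ be the associative algebra with the relation $\mathcal Y\mathcal X-\mathcal X\mathcal Y=\mathcal X$, filtered by $F^d=\operatorname{span}\{\mathcal X^i\mathcal Y^j: j\le d\}$, and let $\mathcal G_r=\mathfrak{gl}_r\otimes\mathbb C\langle\mathcal X,\mathcal Y\rangle$ be the Lie algebra of matrices over it, with the commutator. Let $U^{\le m}\subset U(\mathcal G_r)$ be the span of all products $g_1\cdots g_k$ with $g_i\in\mathfrak{gl}_r\otimes F^{d_i}$ and $\sum_i d_i\le m$. For an integer $N$ the algebra $\mathcal G_r$ acts on $V_r^{(N)}=V_r\otimes\bigl(\mathbb C[x,x^{-1}]/x^N\mathbb C[x]\bigr)$ through $\mathcal X=x$, $\mathcal Y=x\,\partial/\partial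 x$, hence on its exterior powers. Put $u^i_j=u_j\otimes x^i$ and $$v_\xi^{(N)}=\bigwedge_{j=1}^r\bigwedge_{i=N-\xi_j}^{N-1}u^i_j\in\bigwedge\nolimits^{n}V_r^{(N)},\qquad \mathcal V(\xi,N)=U(\mathcal G_r)\,v_\xi^{(N)},\qquad F^m\mathcal V(\xi,N)=U^{\le m}v_\xi^{(N)}.$$ Let $V(\xi)=\bigoplus_{m\ge 0}F^m\mathcal V(\xi,N)/F^{m-1}\mathcal V(\xi,N)$ (with $F^{-1}=0$), on which $\mathfrak{gl}_r$ acts by the constants $\mathfrak{gl}_r\otimes 1$. The statement holds for every integer $N$. For $\eta\in\mathbb Z^r$ let $V(\xi)^\eta$ be the subspace on which each $E_{ii}$ acts by $\eta_i$. **Parking functions.** Let $\rho=(\rho_1\ge\dots\ge\rho_k)$ be the partition in which each $j\ge1$ appears $\xi^t_j$ times (so $k=n$). Let $PF_n(\rho)$ be the set of functions $f:\{1,\dots,n\}\to\{1,\dots,n\}$ with $|f^{-1}(\{1,\dots,\rho_{k-s+1}\})|\ge s$ for $s=1,\dots,k$, and let $\mathbb C PF_n(\rho)$ be the permutation representation of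 the symmetric group $\Sigma_n$ on it, $\Sigma_n$ permuting the domain. Let $\mathrm{Sign}$ be the sign representation. **The Frobenius map.** For a partition $\lambda$ of $n$ let $\pi_\lambda$ be the corresponding irreducible representation of $\Sigma_n$ (the Specht module, trivial for $\lambda=(n)$) and, if $\lambda_{r+1}=0$, let $\pi^\lambda$ be the irreducible $\mathfrak{gl}_r$-module of highest weight $\lambda$. The Frobenius map $\mathcal F^r_n$ sends $\pi_\lambda$ to $\pi^\lambda$ if $\lambda_{r+1}=0$ and to $0$ otherwise, extended additively: if $M\cong\bigoplus_\lambda\pi_\lambda^{\oplus m_\lambda}$, then $\mathcal F^r_n(M)=\bigoplus_{\lambda_{r+1}=0}(\pi^\lambda)^{\oplus m_\lambda}$. **Statement.** 1. There is an isomorphism of $\mathfrak{gl}_r$-modules $V(\xi)\cong\bigl(V_r^{\otimes n}\otimes\mathbb C PF_n(\rho)\otimes\mathrm{Sign}\bigr)^{\Sigma_n}$, where on the right $\mathfrak{gl}_r$ acts on $V_r^{\otimes n}$ and $\Sigma_n$ acts diagonally, permuting the factors of $V_r^{\otimes n}$. 2. The representation $\mathbb C PF_n(\rho)\otimes\mathrm{Sign}$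 is a direct sum of modules $\pi_\lambda$, and $V(\xi)\cong\mathcal F^r_n\bigl(\mathbb C PF_n(\rho)\otimes\mathrm{Sign}\bigr)$ as $\mathfrak{gl}_r$-modules. 3. For every $\eta\in\mathbb Z^r$, $$\dim V(\xi)^\eta=\begin{cases}\dim\bigl(\mathbb C PF_n(\rho)\otimes\mathrm{Sign}\bigr)^{\Sigma_{\eta_1}\times\dots\times\Sigma_{\eta_r}} & \text{if } |\eta|=n \text{ and all } \eta_i\ge 0,\\ 0 & \text{otherwise,}\end{cases}$$ where $\Sigma_{\eta_1}\times\dots\times\Sigma_{\eta_r}\subset\Sigma_n$ is the Young subgroup preserving the consecutive blocks of sizes $\eta_1,\dots,\eta_r$. -/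

import Mathlib

open scoped TensorProduct DirectSum

attribute [local instance 100] LieRing.ofAssociativeRing

noncomputable section

namespace DeformedWeyl

/-! ## Representations of Lie algebras, written as Lie algebra homomorphisms to `End V` -/

section LieRep

variable {L : Type*} [LieRing L] [LieAlgebra ℂ L]

/-- A representation of the Lie algebra `L` on the complex vector space `V`. -/
abbrev LieRep (L : Type*) [LieRing L] [LieAlgebra ℂ L]
    (V : Type*) [AddCommGroup V] [Module ℂ V] :=
  L →ₗ⁅ℂ⁆ Module.End ℂ V

variable {V : Type*} [AddCommGroup V] [Module ℂ V]

/-- Isomorphism of representations of `L`. -/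
def LieRep.Iso {W : Type*} [AddCommGroup W] [Module ℂ W]
    (ρ : LieRep L V) (σ : LieRep L W) : Prop :=
  ∃ e : V ≃ₗ[ℂ] W, ∀ (x : L) (v : V), e (ρ x v) = σ x (e v)

/-- The restriction of a representation to an invariant subspace. -/
def LieRep.sub (ρ : LieRep L V) (S : Submodule ℂ V) (h : ∀ x : L, ∀ v ∈ S, ρ x v ∈ S) :
    LieRep L S where
  toFun x := (ρ x).restrict (h x)
  map_add' x y := by ext; simp
  map_smul' c x := by ext; simp
  map_lie' := by intro x y; ext; simp [Ring.lie_def]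

/-- The representation on the quotient by an invariant subspace. -/
def LieRep.quot (ρ : LieRep L V) (S : Submodule ℂ V) (h : ∀ x : L, ∀ v ∈ S, ρ x v ∈ S) :
    LieRep L (V ⧸ S) where
  toFun x := S.mapQ S (ρ x) (h x)
  map_add' x y := by ext; simp
  map_smul' c x := by ext; simp
  map_lie' := by intro x y; ext; simp [Ring.lie_def]

/-- The direct sum of a family of representations. -/
def LieRep.directSum {ι : Type*} {M : ι → Type*} [∀ i, AddCommGroup (M i)]
    [∀ i, Module ℂ (M i)] (ρ : ∀ i, LieRep L (M i)) : LieRep L (⨁ i, M i) where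
  toFun x := DirectSum.lmap fun i => ρ i x
  map_add' x y := by ext; simp
  map_smul' c x := by
    ext v i
    rw [RingHom.id_apply, LinearMap.smul_apply, DirectSum.smul_apply, DirectSum.lmap_apply,
      DirectSum.lmap_apply, map_smul, LinearMap.smul_apply]
  map_lie' := by intro x y; ext; simp [Ring.lie_def]

/-- `S · v` for a subspace `S` of the universal enveloping algebra. -/
def LieRep.orbit (ρ : LieRep L V) (S : Submodule ℂ (UniversalEnvelopingAlgebra ℂ L)) (v : V) :
    Submodule ℂ V :=
  S.map ((LinearMap.applyₗ v).comp (UniversalEnvelopingAlgebra.lift ℂ ρ).toLinearMap)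

theorem LieRep.orbit_stable (ρ : LieRep L V)
    (S : Submodule ℂ (UniversalEnvelopingAlgebra ℂ L)) (v : V) (x : L)
    (h : ∀ u ∈ S, UniversalEnvelopingAlgebra.ι ℂ x * u ∈ S) :
    ∀ w ∈ ρ.orbit S v, ρ x w ∈ ρ.orbit S v := by
  rintro _ ⟨u, hu, rfl⟩
  exact ⟨_, h u hu, by simp⟩

/-- The submodule `U(L) · v` generated by a vector, as a representation of `L`. -/
def LieRep.cyclic (ρ : LieRep L V) (v : V) : LieRep L (ρ.orbit ⊤ v) :=
  ρ.sub _ fun x => ρ.orbit_stable ⊤ v x fun _ _ => Submodule.mem_top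

end LieRep

/-- The Lie algebra `gl_r`: all `r × r` matrices with the commutator. -/
abbrev gl (r : ℕ) := Matrix (Fin r) (Fin r) ℂ

/-- The weight space on which each `E_ii` acts by `η i`. -/
def weightSpace {r : ℕ} {V : Type*} [AddCommGroup V] [Module ℂ V] (ρ : LieRep (gl r) V)
    (η : Fin r → ℤ) : Submodule ℂ V where
  carrier := {v | ∀ i, ρ (Matrix.single i i 1) v = (η i : ℂ) • v}
  add_mem' := by intro a b ha hb i; rw [map_add, ha i, hb i, smul_add]
  zero_mem' := by intro i; simp
  smul_mem' := by intro c a ha i; rw [map_smul, ha i, smul_comm]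

/-! ## The algebra `ℂ⟨X, Y⟩` and its action on truncated Laurent polynomials -/

/-- The relation `Y X = X Y + X`; `X` and `Y` are the generators `0` and `1`. -/
inductive XYRel : FreeAlgebra ℂ (Fin 2) → FreeAlgebra ℂ (Fin 2) → Prop
  | rel : XYRel (FreeAlgebra.ι ℂ 1 * FreeAlgebra.ι ℂ 0)
      (FreeAlgebra.ι ℂ 0 * FreeAlgebra.ι ℂ 1 + FreeAlgebra.ι ℂ 0)

/-- The associative algebra `ℂ⟨X, Y⟩` with `Y X - X Y = X`. -/
abbrev XYAlg := RingQuot XYRel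

/-- The generator `X`. -/
def XYAlg.X : XYAlg := RingQuot.mkAlgHom ℂ XYRel (FreeAlgebra.ι ℂ 0)

/-- The generator `Y`. -/
def XYAlg.Y : XYAlg := RingQuot.mkAlgHom ℂ XYRel (FreeAlgebra.ι ℂ 1)

/-- The degree filtration: `F^d` is spanned by `X^i Y^j` with `j ≤ d`. -/
def XYAlg.filt (d : ℕ) : Submodule ℂ XYAlg :=
  Submodule.span ℂ {a | ∃ i j : ℕ, j ≤ d ∧ a = XYAlg.X ^ i * XYAlg.Y ^ j}

/-- The subspace `x^N ℂ[x]` of `ℂ[x, x⁻¹]`. -/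
def tailSub (N : ℤ) : Submodule ℂ (LaurentPolynomial ℂ) :=
  Submodule.span ℂ {p | ∃ i : ℤ, N ≤ i ∧ p = LaurentPolynomial.T i}

/-- Multiplication by `x` on `ℂ[x, x⁻¹]`. -/
def mulX : LaurentPolynomial ℂ →ₗ[ℂ] LaurentPolynomial ℂ :=
  LinearMap.mulLeft ℂ (LaurentPolynomial.T 1)

/-- The Euler operator `x ∂/∂x` on `ℂ[x, x⁻¹]`. -/
def euler : LaurentPolynomial ℂ →ₗ[ℂ] LaurentPolynomial ℂ :=
  (Finsupp.lsum ℂ fun i : ℤ =>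
      LinearMap.toSpanSingleton ℂ (LaurentPolynomial ℂ) ((i : ℂ) • LaurentPolynomial.T i)).comp
    (AddMonoidAlgebra.coeffLinearEquiv ℂ).toLinearMap

theorem mulX_T (i : ℤ) : mulX (LaurentPolynomial.T i) = LaurentPolynomial.T (i + 1) := by
  change LaurentPolynomial.T 1 * LaurentPolynomial.T i = _
  rw [← LaurentPolynomial.T_add, add_comm]

theorem euler_T (i : ℤ) :
    euler (LaurentPolynomial.T i) = (i : ℂ) • LaurentPolynomial.T i := by
  have h : (LaurentPolynomial.T i : LaurentPolynomial ℂ).coeff = Finsupp.single i 1 := rfl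
  rw [euler, LinearMap.comp_apply]
  change Finsupp.lsum ℂ _ (LaurentPolynomial.T i : LaurentPolynomial ℂ).coeff = _
  rw [h, Finsupp.lsum_single, LinearMap.toSpanSingleton_apply, one_smul]

theorem euler_mulX (p : LaurentPolynomial ℂ) :
    euler (mulX p) = mulX (euler p) + mulX p := by
  have h : euler ∘ₗ mulX = mulX ∘ₗ euler + mulX := by
    refine AddMonoidAlgebra.lhom_ext' fun i => LinearMap.ext_ring ?_
    change euler (mulX (LaurentPolynomial.T i)) =
      mulX (euler (LaurentPolynomial.T i)) + mulX (LaurentPolynomial.T i)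
    rw [euler_T, map_smul, mulX_T, euler_T]
    push_cast
    rw [add_smul, one_smul]
  exact LinearMap.congr_fun h p

theorem mulX_tailSub (N : ℤ) : tailSub N ≤ (tailSub N).comap mulX := by
  rw [tailSub, Submodule.span_le]
  rintro _ ⟨i, hi, rfl⟩
  exact Submodule.subset_span ⟨i + 1, by omega, mulX_T i⟩

theorem euler_tailSub (N : ℤ) : tailSub N ≤ (tailSub N).comap euler := by
  rw [tailSub, Submodule.span_le]
  rintro _ ⟨i, hi, rfl⟩
  rw [SetLike.mem_coe, Submodule.mem_comap, euler_T]
  exact Submodule.smul_mem _ _ (Submodule.subset_span ⟨i, hi, rfl⟩)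

/-- The space `ℂ[x, x⁻¹] / x^N ℂ[x]`. -/
abbrev Trunc (N : ℤ) := LaurentPolynomial ℂ ⧸ tailSub N

/-- The action of `ℂ⟨X, Y⟩` on `ℂ[x, x⁻¹] / x^N ℂ[x]`, with `X = x` and `Y = x ∂/∂x`. -/
def xyAct (N : ℤ) : XYAlg →ₐ[ℂ] Module.End ℂ (Trunc N) :=
  RingQuot.liftAlgHom ℂ
    ⟨FreeAlgebra.lift ℂ
      ![(tailSub N).mapQ (tailSub N) mulX (mulX_tailSub N),
        (tailSub N).mapQ (tailSub N) euler (euler_tailSub N)], by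
      rintro _ _ ⟨⟩
      apply Submodule.linearMap_qext
      apply LinearMap.ext
      intro p
      simp [euler_mulX]⟩

/-! ## The Lie algebra `gl_r ⊗ ℂ⟨X, Y⟩` and the deformed Weyl modules -/

/-- The Lie algebra of `r × r` matrices over `ℂ⟨X, Y⟩`, with the commutator. -/
abbrev GXY (r : ℕ) := Matrix (Fin r) (Fin r) XYAlg

/-- The embedding of constants `gl_r = gl_r ⊗ 1 → gl_r ⊗ ℂ⟨X, Y⟩`. -/
def glConst (r : ℕ) : gl r →ₗ⁅ℂ⁆ GXY r :=
  (AlgHom.mapMatrix (Algebra.ofId ℂ XYAlg)).toLieHom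

/-- `g ∈ F^d (gl_r ⊗ ℂ⟨X, Y⟩)`. -/
def GXY.InFilt {r : ℕ} (d : ℕ) (g : GXY r) : Prop := ∀ i j, g i j ∈ XYAlg.filt d

/-- The induced filtration on the enveloping algebra: `U^{≤ m}` is spanned by the products
`g₁ ⋯ g_k` (any `k ≥ 0`) with `g_i ∈ F^{d_i}` and `d₁ + ⋯ + d_k ≤ m`. -/
def envFilt (r m : ℕ) : Submodule ℂ (UniversalEnvelopingAlgebra ℂ (GXY r)) :=
  Submodule.span ℂ {u | ∃ l : List (ℕ × GXY r), (∀ p ∈ l, GXY.InFilt p.1 p.2) ∧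
    (l.map Prod.fst).sum ≤ m ∧
    u = (l.map fun p => UniversalEnvelopingAlgebra.ι ℂ p.2).prod}

theorem glConst_inFilt {r : ℕ} (A : gl r) : GXY.InFilt 0 (glConst r A) := by
  intro i j
  have h : (glConst r A) i j = A i j • (XYAlg.X ^ 0 * XYAlg.Y ^ 0) := by
    simp [glConst, Algebra.ofId_apply, Algebra.algebraMap_eq_smul_one]
  rw [h]
  exact Submodule.smul_mem _ _ (Submodule.subset_span ⟨0, 0, le_rfl, rfl⟩)

theorem glConst_mul_envFilt {r m : ℕ} (A : gl r) :
    ∀ u ∈ envFilt r m, UniversalEnvelopingAlgebra.ι ℂ (glConst r A) * u ∈ envFilt r m := by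
  intro u hu
  induction hu using Submodule.span_induction with
  | mem u hu =>
    obtain ⟨l, h1, h2, rfl⟩ := hu
    refine Submodule.subset_span ⟨(0, glConst r A) :: l, ?_, by simpa using h2, by simp⟩
    intro p hp
    rcases List.mem_cons.1 hp with rfl | hp
    · exact glConst_inFilt A
    · exact h1 p hp
  | zero => simp
  | add x y _ _ hx hy => rw [mul_add]; exact Submodule.add_mem _ hx hy
  | smul c x _ hx => rw [mul_smul_comm]; exact Submodule.smul_mem _ _ hx

/-- `V_r^{(N)} = V_r ⊗ (ℂ[x, x⁻¹] / x^N ℂ[x])`, as column vectors over the second factor. -/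
abbrev VrN (r : ℕ) (N : ℤ) := Fin r → Trunc N

/-- The action of `gl_r ⊗ ℂ⟨X, Y⟩` on `V_r^{(N)}`: `(g w)_i = ∑ j, g_ij · w_j`. -/
def vrnRep (r : ℕ) (N : ℤ) : LieRep (GXY r) (VrN r N) :=
  ((endVecAlgEquivMatrixEnd (Fin r) ℂ ℂ (Trunc N)).symm.toAlgHom.comp
    (AlgHom.mapMatrix (xyAct N))).toLieHom

section Exterior

variable {V : Type*} [AddCommGroup V] [Module ℂ V]

/-- The algebra homomorphism `a ↦ a + ε D_f(a)`, `D_f` being the derivation of the exterior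
algebra with `D_f (m) = f m` for `m ∈ V`. -/
def extDual (f : Module.End ℂ V) :
    ExteriorAlgebra ℂ V →ₐ[ℂ] DualNumber (ExteriorAlgebra ℂ V) :=
  ExteriorAlgebra.lift ℂ
    ⟨(TrivSqZeroExt.inlAlgHom ℂ (ExteriorAlgebra ℂ V) (ExteriorAlgebra ℂ V)).toLinearMap ∘ₗ
        ExteriorAlgebra.ι ℂ +
      (TrivSqZeroExt.inrHom (ExteriorAlgebra ℂ V) (ExteriorAlgebra ℂ V)).restrictScalars ℂ ∘ₗ
        ExteriorAlgebra.ι ℂ ∘ₗ f, by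
      intro m
      ext
      · simp
      · simp⟩

theorem extDual_fst (f : Module.End ℂ V) (a : ExteriorAlgebra ℂ V) :
    (extDual f a).fst = a := by
  have h : (TrivSqZeroExt.fstHom ℂ (ExteriorAlgebra ℂ V) (ExteriorAlgebra ℂ V)).comp
      (extDual f) = AlgHom.id ℂ _ := by
    ext m
    simp [extDual]
  exact DFunLike.congr_fun h a

/-- The derivation of the exterior algebra that extends `f`, that is, the natural action
`w₁ ∧ ⋯ ∧ w_n ↦ ∑ k, w₁ ∧ ⋯ ∧ f w_k ∧ ⋯ ∧ w_n` on every exterior power. -/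
def extDer (f : Module.End ℂ V) : Module.End ℂ (ExteriorAlgebra ℂ V) :=
  (TrivSqZeroExt.sndHom (ExteriorAlgebra ℂ V) (ExteriorAlgebra ℂ V)).restrictScalars ℂ ∘ₗ
    (extDual f).toLinearMap

theorem extDer_ι (f : Module.End ℂ V) (m : V) :
    extDer f (ExteriorAlgebra.ι ℂ m) = ExteriorAlgebra.ι ℂ (f m) := by
  simp [extDer, extDual]

theorem extDer_mul (f : Module.End ℂ V) (a b : ExteriorAlgebra ℂ V) :
    extDer f (a * b) = a * extDer f b + extDer f a * b := by
  simp [extDer, extDual_fst]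

theorem extDer_algebraMap (f : Module.End ℂ V) (c : ℂ) :
    extDer f (algebraMap ℂ _ c) = 0 := by
  simp only [extDer, LinearMap.comp_apply, AlgHom.toLinearMap_apply, AlgHom.commutes]
  simp [TrivSqZeroExt.algebraMap_eq_inl']

/-- The natural action of `End V` (with the commutator) on the exterior algebra of `V`. -/
def extRep : LieRep (Module.End ℂ V) (ExteriorAlgebra ℂ V) where
  toFun := extDer
  map_add' f g := by
    refine LinearMap.ext fun a => ?_
    induction a using ExteriorAlgebra.induction with
    | algebraMap c => simp [extDer_algebraMap]
    | ι m => simp [extDer_ι]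
    | mul a b ha hb =>
      simp only [extDer_mul, LinearMap.add_apply] at *
      rw [ha, hb]; noncomm_ring
    | add a b ha hb => simp only [map_add, ha, hb]
  map_smul' c f := by
    refine LinearMap.ext fun a => ?_
    induction a using ExteriorAlgebra.induction with
    | algebraMap c => simp [extDer_algebraMap]
    | ι m => simp [extDer_ι]
    | mul a b ha hb =>
      simp only [extDer_mul, LinearMap.smul_apply, RingHom.id_apply] at *
      rw [ha, hb]; simp
    | add a b ha hb => simp only [map_add, ha, hb]
  map_lie' := by
    intro f g
    refine LinearMap.ext fun a => ?_
    induction a using ExteriorAlgebra.induction with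
    | algebraMap c => simp [extDer_algebraMap, Ring.lie_def]
    | ι m => simp [extDer_ι, Ring.lie_def]
    | mul a b ha hb =>
      simp only [Ring.lie_def, extDer_mul, LinearMap.sub_apply, Module.End.mul_apply,
        map_add] at *
      rw [ha, hb]; noncomm_ring
    | add a b ha hb => simp only [map_add, ha, hb]

end Exterior

/-- The action of `gl_r ⊗ ℂ⟨X, Y⟩` on the exterior powers of `V_r^{(N)}`, put together. -/
def extVrnRep (r : ℕ) (N : ℤ) : LieRep (GXY r) (ExteriorAlgebra ℂ (VrN r N)) :=
  extRep.comp (vrnRep r N)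

/-- The basis vector `u_j^i = u_j ⊗ x^i` of `V_r^{(N)}`. -/
def uVec {r : ℕ} (N : ℤ) (j : Fin r) (i : ℤ) : VrN r N :=
  Pi.single j ((tailSub N).mkQ (LaurentPolynomial.T i))

/-- The vector `v_ξ^{(N)}`: the wedge product of the `u_j^i` over `j = 1, …, r` and
`i = N - ξ_j, …, N - 1`, an element of the `|ξ|`-th exterior power. -/
def vXi {r : ℕ} (ξ : Fin r → ℕ) (N : ℤ) : ExteriorAlgebra ℂ (VrN r N) :=
  ((List.finRange r).flatMap fun j =>
    (List.range (ξ j)).map fun t => ExteriorAlgebra.ι ℂ (uVec N j (N - ξ j + t))).prod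

/-- The deformed Weyl module `𝓥(ξ, N) = U(gl_r ⊗ ℂ⟨X, Y⟩) · v_ξ^{(N)}`. -/
def deformedWeyl {r : ℕ} (ξ : Fin r → ℕ) (N : ℤ) :
    Submodule ℂ (ExteriorAlgebra ℂ (VrN r N)) :=
  (extVrnRep r N).orbit ⊤ (vXi ξ N)

/-- The filtration `F^i 𝓥(ξ, N) = U^{≤ i} · v_ξ^{(N)}`. -/
def weylFilt {r : ℕ} (ξ : Fin r → ℕ) (N : ℤ) (i : ℕ) :
    Submodule ℂ (ExteriorAlgebra ℂ (VrN r N)) :=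
  (extVrnRep r N).orbit (envFilt r i) (vXi ξ N)

theorem weylFilt_le {r : ℕ} (ξ : Fin r → ℕ) (N : ℤ) (i : ℕ) :
    weylFilt ξ N i ≤ deformedWeyl ξ N :=
  Submodule.map_mono le_top

/-- `F^{i-1} 𝓥(ξ, N)`, with `F^{-1} = 0`. -/
def weylFiltPrev {r : ℕ} (ξ : Fin r → ℕ) (N : ℤ) :
    ℕ → Submodule ℂ (ExteriorAlgebra ℂ (VrN r N))
  | 0 => ⊥
  | i + 1 => weylFilt ξ N i

/-- The `gl_r`-action on `Λ V_r^{(N)}` by constants. -/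
def extGlRep (r : ℕ) (N : ℤ) : LieRep (gl r) (ExteriorAlgebra ℂ (VrN r N)) :=
  (extVrnRep r N).comp (glConst r)

theorem weylFilt_stable {r : ℕ} (ξ : Fin r → ℕ) (N : ℤ) (i : ℕ) (A : gl r) :
    ∀ w ∈ weylFilt ξ N i, extGlRep r N A w ∈ weylFilt ξ N i :=
  (extVrnRep r N).orbit_stable _ _ _ (glConst_mul_envFilt A)

theorem weylFiltPrev_stable {r : ℕ} (ξ : Fin r → ℕ) (N : ℤ) (i : ℕ) (A : gl r) :
    ∀ w ∈ weylFiltPrev ξ N i, extGlRep r N A w ∈ weylFiltPrev ξ N i := by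
  cases i with
  | zero =>
    intro w hw
    rw [weylFiltPrev, Submodule.mem_bot] at *
    simp [hw]
  | succ i => exact weylFilt_stable ξ N i A

/-- The graded piece `F^i 𝓥(ξ, N) / F^{i-1} 𝓥(ξ, N)`. -/
abbrev WeylPiece {r : ℕ} (ξ : Fin r → ℕ) (N : ℤ) (i : ℕ) :=
  weylFilt ξ N i ⧸ (weylFiltPrev ξ N i).submoduleOf (weylFilt ξ N i)

/-- The action of the constants on a graded piece. -/
def weylPieceRep {r : ℕ} (ξ : Fin r → ℕ) (N : ℤ) (i : ℕ) :
    LieRep (gl r) (WeylPiece ξ N i) :=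
  ((extGlRep r N).sub (weylFilt ξ N i) (weylFilt_stable ξ N i)).quot _
    fun A w hw => weylFiltPrev_stable ξ N i A w hw

/-- The space `V(ξ) = gr 𝓥(ξ, N)`. -/
abbrev WeylGr {r : ℕ} (ξ : Fin r → ℕ) (N : ℤ) := ⨁ i : ℕ, WeylPiece ξ N i

/-- `V(ξ)` as a `gl_r`-module, `gl_r` acting as the constants `gl_r ⊗ 1`. -/
def weylGrRep {r : ℕ} (ξ : Fin r → ℕ) (N : ℤ) : LieRep (gl r) (WeylGr ξ N) :=
  LieRep.directSum (weylPieceRep ξ N)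

/-! ## Parking functions and representations of symmetric groups -/

/-- The transposed partition: `ξ^t_i` is the number of `j` with `ξ_j ≥ i`. -/
def conj {r : ℕ} (ξ : Fin r → ℕ) (i : ℕ) : ℕ := (Finset.univ.filter fun j => i ≤ ξ j).card

/-- The partition `(1^{ξ^t_1} 2^{ξ^t_2} ⋯)` as a nonincreasing list; every `j > |ξ|` has
multiplicity `ξ^t_j = 0`. -/
def rhoList {r : ℕ} (ξ : Fin r → ℕ) : List ℕ :=
  (List.range (∑ j, ξ j)).reverse.flatMap fun j => List.replicate (conj ξ (j + 1)) (j + 1)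

/-- For `ρ = (ρ_1 ≥ ⋯ ≥ ρ_k)`, the function `f` is a `ρ`-parking function if
`|f⁻¹ {1, …, ρ_{k-s+1}}| ≥ s` for `s = 1, …, k`. Positions in lists and elements of `Fin n` are
counted from zero. -/
def IsParking {n : ℕ} (ρ : List ℕ) (f : Fin n → Fin n) : Prop :=
  ∀ s : ℕ, ∀ _ : 1 ≤ s, ∀ _ : s ≤ ρ.length,
    s ≤ (Finset.univ.filter fun i => (f i : ℕ) + 1 ≤ ρ[ρ.length - s]).card

/-- The set `PF_n(ρ)`. -/
def PF (n : ℕ) (ρ : List ℕ) := {f : Fin n → Fin n // IsParking ρ f}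

theorem IsParking.comp {n : ℕ} {ρ : List ℕ} {f : Fin n → Fin n} (hf : IsParking ρ f)
    (σ : Equiv.Perm (Fin n)) : IsParking ρ (f ∘ σ) := by
  intro s h1 h2
  refine (hf s h1 h2).trans (le_of_eq ?_)
  refine Finset.card_equiv σ.symm ?_
  intro i
  simp

/-- `Σ_n` acts on `PF_n(ρ)` by permutation of the domain. -/
instance (n : ℕ) (ρ : List ℕ) : MulAction (Equiv.Perm (Fin n)) (PF n ρ) where
  smul σ f := ⟨f.1 ∘ ⇑σ⁻¹, f.2.comp σ⁻¹⟩
  one_smul f := rfl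
  mul_smul σ τ f := Subtype.ext (by
    change f.1 ∘ ⇑(σ * τ)⁻¹ = (f.1 ∘ ⇑τ⁻¹) ∘ ⇑σ⁻¹
    rw [mul_inv_rev]; rfl)

/-- The permutation representation `ℂPF_n(ρ)`. -/
def pfRep (n : ℕ) (ρ : List ℕ) :
    Representation ℂ (Equiv.Perm (Fin n)) (MonoidAlgebra ℂ (PF n ρ)) :=
  Representation.ofMulAction ℂ (Equiv.Perm (Fin n)) (PF n ρ)

/-- The sign representation. -/
def signRep (n : ℕ) : Representation ℂ (Equiv.Perm (Fin n)) ℂ where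
  toFun σ := ((Equiv.Perm.sign σ : ℤ) : ℂ) • LinearMap.id
  map_one' := by ext; simp
  map_mul' σ τ := by ext; simp [mul_comm]

/-- The representation `ℂPF_n(ρ) ⊗ Sign`. -/
def pfSignRep (n : ℕ) (ρ : List ℕ) :
    Representation ℂ (Equiv.Perm (Fin n)) (MonoidAlgebra ℂ (PF n ρ) ⊗[ℂ] ℂ) :=
  (pfRep n ρ).tprod (signRep n)

/-- The `k`-th of the consecutive blocks of sizes `η_1, …, η_r`. -/
def block {r : ℕ} (n : ℕ) (η : Fin r → ℕ) (k : Fin r) : Set (Fin n) :=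
  {i | ∑ j ∈ Finset.Iio k, η j ≤ (i : ℕ) ∧ (i : ℕ) < ∑ j ∈ Finset.Iic k, η j}

/-- The Young subgroup `Σ_{η_1} × ⋯ × Σ_{η_r}` of `Σ_n`, where `n = η_1 + ⋯ + η_r`. -/
def youngSubgroup {r : ℕ} (n : ℕ) (η : Fin r → ℕ) : Subgroup (Equiv.Perm (Fin n)) where
  carrier := {σ | ∀ k i, σ i ∈ block n η k ↔ i ∈ block n η k}
  mul_mem' := by
    intro σ τ hσ hτ k i
    rw [Equiv.Perm.mul_apply, hσ, hτ]
  one_mem' := by intro k i; rfl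
  inv_mem' := by
    intro σ hσ k i
    rw [← hσ k (σ⁻¹ i)]
    simp

/-! ## Tensor powers of `V_r` -/

section Tensor

variable {ι : Type} [DecidableEq ι] {V : Type*} [AddCommGroup V] [Module ℂ V]

/-- The tensor power of `V` over the index set `ι`. -/
abbrev TPow (ι : Type) (V : Type*) [AddCommGroup V] [Module ℂ V] := ⨂[ℂ] _ : ι, V

/-- `f` acting on the `k`-th factor of a tensor power. -/
def slot (k : ι) (f : Module.End ℂ V) : Module.End ℂ (TPow ι V) :=
  PiTensorProduct.map (Function.update (fun _ => (1 : Module.End ℂ V)) k f)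

theorem slot_mul (k : ι) (f g : Module.End ℂ V) : slot k (f * g) = slot k f * slot k g := by
  rw [slot, slot, slot, ← PiTensorProduct.map_mul]
  congr 1
  funext i
  by_cases h : i = k
  · subst h; simp
  · simp [h]

theorem slot_comm {k l : ι} (h : k ≠ l) (f g : Module.End ℂ V) :
    slot k f * slot l g = slot l g * slot k f := by
  rw [slot, slot, ← PiTensorProduct.map_mul, ← PiTensorProduct.map_mul]
  congr 1
  funext i
  by_cases h1 : i = k
  · subst h1; simp [h]
  · by_cases h2 : i = l
    · subst h2; simp [h1]
    · simp [h1, h2]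

theorem slot_add (k : ι) (f g : Module.End ℂ V) : slot k (f + g) = slot k f + slot k g :=
  PiTensorProduct.map_update_add _ _ _ _

theorem slot_smul (k : ι) (c : ℂ) (f : Module.End ℂ V) : slot k (c • f) = c • slot k f :=
  PiTensorProduct.map_update_smul _ _ _ _

theorem slot_lie (k : ι) (f g : Module.End ℂ V) : slot k ⁅f, g⁆ = ⁅slot k f, slot k g⁆ := by
  rw [Ring.lie_def, Ring.lie_def, ← slot_mul, ← slot_mul, eq_sub_iff_add_eq, ← slot_add,
    sub_add_cancel]

/-- The natural action of `End V` (with the commutator) on a tensor power of `V`. -/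
def tensorRep [Fintype ι] : LieRep (Module.End ℂ V) (TPow ι V) where
  toFun f := ∑ k, slot k f
  map_add' f g := by simp only [slot_add, Finset.sum_add_distrib]
  map_smul' c f := by simp only [slot_smul, Finset.smul_sum, RingHom.id_apply]
  map_lie' := by
    intro f g
    rw [Ring.lie_def (∑ k, slot k f), Finset.sum_mul_sum, Finset.sum_mul_sum,
      Finset.sum_comm (f := fun i j => slot i g * slot j f), ← Finset.sum_sub_distrib]
    refine Finset.sum_congr rfl fun k _ => ?_
    rw [← Finset.sum_sub_distrib, slot_lie, Ring.lie_def]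
    symm
    refine Finset.sum_eq_single (M := Module.End ℂ (TPow ι V))
      (f := fun l => slot k f * slot l g - slot l g * slot k f) k ?_ ?_
    · intro l _ hl
      change slot k f * slot l g - slot l g * slot k f = 0
      rw [slot_comm (Ne.symm hl), sub_self]
    · intro h
      exact absurd (Finset.mem_univ k) h

end Tensor

/-- The vector representation `V_r = ℂ^r`. -/
def Vr (r : ℕ) : Type := Fin r → ℂ

instance (r : ℕ) : AddCommGroup (Vr r) := inferInstanceAs (AddCommGroup (Fin r → ℂ))

instance (r : ℕ) : Module ℂ (Vr r) := inferInstanceAs (Module ℂ (Fin r → ℂ))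

/-- The action of `gl_r` on `V_r`: multiplication of column vectors by matrices. -/
def vrRep (r : ℕ) : LieRep (gl r) (Vr r) :=
  (Matrix.toLinAlgEquiv' (R := ℂ) (n := Fin r)).toAlgHom.toLieHom

/-- The tensor power of `V_r = ℂ^r` over an index set `ι`, as a `gl_r`-module. -/
def tensorGlRep (r : ℕ) (ι : Type) [Fintype ι] [DecidableEq ι] :
    LieRep (gl r) (TPow ι (Vr r)) :=
  tensorRep.comp (vrRep r)

/-- The permutation `σ` of the factors of a tensor power. -/
def permT {V : Type*} [AddCommGroup V] [Module ℂ V] {n : ℕ} (σ : Equiv.Perm (Fin n)) :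
    Module.End ℂ (TPow (Fin n) V) :=
  (PiTensorProduct.reindex ℂ (fun _ : Fin n => V) σ).toLinearMap

theorem permT_tprod {V : Type*} [AddCommGroup V] [Module ℂ V] {n : ℕ}
    (σ : Equiv.Perm (Fin n)) (w : Fin n → V) :
    permT σ (PiTensorProduct.tprod ℂ w) = PiTensorProduct.tprod ℂ fun i => w (σ.symm i) :=
  PiTensorProduct.reindex_tprod σ w

theorem slot_tprod {V : Type*} [AddCommGroup V] [Module ℂ V] {n : ℕ} (k : Fin n)
    (f : Module.End ℂ V) (w : Fin n → V) :
    slot k f (PiTensorProduct.tprod ℂ w) =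
      PiTensorProduct.tprod ℂ fun i => Function.update (fun _ => (1 : Module.End ℂ V)) k f i (w i) :=
  PiTensorProduct.map_tprod _ w

theorem slot_permT {V : Type*} [AddCommGroup V] [Module ℂ V] {n : ℕ} (σ : Equiv.Perm (Fin n))
    (k : Fin n) (f : Module.End ℂ V) :
    slot (σ k) f * permT σ = permT σ * slot k f := by
  apply PiTensorProduct.ext
  apply MultilinearMap.ext
  intro w
  simp only [LinearMap.compMultilinearMap_apply, Module.End.mul_apply, permT_tprod, slot_tprod]
  congr 1
  funext i
  by_cases h : i = σ k
  · subst h; simp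
  · have : σ.symm i ≠ k := fun h' => h (by rw [← h']; simp)
    simp [h, this]

/-- `Σ_n` permuting the factors of `V_r^{⊗ n}`. -/
def tensorPermRep (r n : ℕ) :
    Representation ℂ (Equiv.Perm (Fin n)) (TPow (Fin n) (Vr r)) where
  toFun σ := permT σ
  map_one' := by
    apply PiTensorProduct.ext
    apply MultilinearMap.ext
    intro w
    simp only [LinearMap.compMultilinearMap_apply, permT_tprod]
    rfl
  map_mul' σ τ := by
    apply PiTensorProduct.ext
    apply MultilinearMap.ext
    intro w
    simp only [LinearMap.compMultilinearMap_apply, Module.End.mul_apply, permT_tprod]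
    rfl

theorem tensorGl_comm (r n : ℕ) (A : gl r) (σ : Equiv.Perm (Fin n)) :
    tensorGlRep r (Fin n) A * tensorPermRep r n σ =
      tensorPermRep r n σ * tensorGlRep r (Fin n) A := by
  change (∑ k, slot k _) * _ = _ * (∑ k, slot k _)
  rw [Finset.sum_mul, Finset.mul_sum, ← Equiv.sum_comp σ]
  exact Finset.sum_congr rfl fun k _ => slot_permT σ k _

/-! ## The `gl_r`-module `(V_r^{⊗ n} ⊗ M)^{Σ_n}` -/

section SchurWeyl

variable {M : Type*} [AddCommGroup M] [Module ℂ M]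

/-- `gl_r` acting on the first factor of `V_r^{⊗ n} ⊗ M`. -/
def leftGlRep (r n : ℕ) (M : Type*) [AddCommGroup M] [Module ℂ M] :
    LieRep (gl r) ((TPow (Fin n) (Vr r)) ⊗[ℂ] M) where
  toFun A := (tensorGlRep r (Fin n) A).rTensor M
  map_add' A B := by rw [map_add, LinearMap.rTensor_add]
  map_smul' c A := by rw [map_smul, LinearMap.rTensor_smul]; rfl
  map_lie' := by
    intro A B
    rw [LieHom.map_lie, Ring.lie_def, Ring.lie_def, LinearMap.rTensor_sub,
      LinearMap.rTensor_mul, LinearMap.rTensor_mul]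

/-- `(V_r^{⊗ n} ⊗ M)^{Σ_n}`, the invariants of the diagonal action. -/
abbrev SWInv (r : ℕ) {n : ℕ} (μ : Representation ℂ (Equiv.Perm (Fin n)) M) :=
  ((tensorPermRep r n).tprod μ).invariants

theorem leftGl_stable (r : ℕ) {n : ℕ} (μ : Representation ℂ (Equiv.Perm (Fin n)) M)
    (A : gl r) : ∀ w ∈ SWInv r μ, leftGlRep r n M A w ∈ SWInv r μ := by
  intro w hw σ
  have h : ((tensorPermRep r n).tprod μ σ) * leftGlRep r n M A =
      leftGlRep r n M A * ((tensorPermRep r n).tprod μ σ) := by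
    change TensorProduct.map _ _ * TensorProduct.map _ _ =
      TensorProduct.map _ _ * TensorProduct.map _ _
    rw [← TensorProduct.map_mul, ← TensorProduct.map_mul, tensorGl_comm]
    rfl
  have h' := LinearMap.congr_fun h w
  rw [Module.End.mul_apply, Module.End.mul_apply, hw σ] at h'
  exact h'

/-- `(V_r^{⊗ n} ⊗ M)^{Σ_n}` as a `gl_r`-module. -/
def swInvRep (r : ℕ) {n : ℕ} (μ : Representation ℂ (Equiv.Perm (Fin n)) M) :
    LieRep (gl r) (SWInv r μ) :=
  (leftGlRep r n M).sub _ (leftGl_stable r μ)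

end SchurWeyl

/-! ## Irreducible representations and the Frobenius map -/

/-- Partitions of `n`, as Young diagrams; `λ_{i+1}` is the row length `rowLen i`. -/
abbrev Shape (n : ℕ) := {μ : YoungDiagram // μ.card = n}

/-- The cells of a diagram. -/
abbrev Cells (μ : YoungDiagram) : Type := {c : ℕ × ℕ // c ∈ μ.cells}

open Classical in
/-- The permutations of the cells of a diagram that preserve every column. -/
def colGroup (μ : YoungDiagram) : Finset (Equiv.Perm (Cells μ)) :=
  Finset.univ.filter fun σ => ∀ c, (σ c).1.2 = c.1.2

/-- Row tabloids: the function gives the row of each number. -/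
def Tabloid (n : ℕ) := Fin n → ℕ

/-- The tabloid with given rows. -/
def Tabloid.mk {n : ℕ} (t : Fin n → ℕ) : Tabloid n := t

/-- `Σ_n` acts on tabloids by permuting the numbers. -/
instance (n : ℕ) : MulAction (Equiv.Perm (Fin n)) (Tabloid n) where
  smul σ t := fun k => t (σ⁻¹ k)
  one_smul t := rfl
  mul_smul σ τ t := by
    funext k
    change t ((σ * τ)⁻¹ k) = t (τ⁻¹ (σ⁻¹ k))
    rw [mul_inv_rev]; rfl

/-- The permutation representation on tabloids. -/
def tabloidRep (n : ℕ) : Representation ℂ (Equiv.Perm (Fin n)) (MonoidAlgebra ℂ (Tabloid n)) :=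
  Representation.ofMulAction ℂ (Equiv.Perm (Fin n)) (Tabloid n)

/-- The polytabloid of a numbering `T` of the cells: the signed sum, over the column
permutations of `T`, of the corresponding row tabloids. -/
def polytabloid {n : ℕ} (μ : YoungDiagram) (T : Cells μ ≃ Fin n) :
    MonoidAlgebra ℂ (Tabloid n) :=
  ∑ σ ∈ colGroup μ, ((Equiv.Perm.sign σ : ℤ) : ℂ) •
    MonoidAlgebra.single (Tabloid.mk fun k => (σ (T.symm k)).1.1) (1 : ℂ)

theorem tabloidRep_polytabloid {n : ℕ} (μ : YoungDiagram) (T : Cells μ ≃ Fin n)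
    (τ : Equiv.Perm (Fin n)) :
    tabloidRep n τ (polytabloid μ T) = polytabloid μ (T.trans τ) := by
  rw [polytabloid, map_sum, polytabloid]
  refine Finset.sum_congr rfl fun σ _ => ?_
  rw [map_smul, tabloidRep, Representation.ofMulAction_single]
  rfl

/-- The Specht module `π_λ`, spanned by the polytabloids of shape `λ`: the irreducible
representation of `Σ_n` that corresponds to the partition `λ` (trivial for `λ = (n)`). -/
def specht {n : ℕ} (μ : Shape n) : Subrepresentation (tabloidRep n) where
  toSubmodule := Submodule.span ℂ (Set.range (polytabloid (n := n) μ.1))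
  apply_mem_toSubmodule τ := by
    intro v hv
    induction hv using Submodule.span_induction with
    | mem v hv =>
      obtain ⟨T, rfl⟩ := hv
      rw [tabloidRep_polytabloid]
      exact Submodule.subset_span ⟨_, rfl⟩
    | zero => simp
    | add x y _ _ hx hy => rw [map_add]; exact Submodule.add_mem _ hx hy
    | smul c x _ hx => rw [map_smul]; exact Submodule.smul_mem _ _ hx

/-- The `i`-th standard basis vector of `V_r`, counted from zero (zero if `i ≥ r`). -/
def stdVec (r i : ℕ) : Vr r := fun k => if (k : ℕ) = i then 1 else 0

/-- The highest weight vector of weight `λ` in `V_r^{⊗ n}`, the factors being indexed by the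
cells of `λ`: the tensor product over the columns, of lengths `c`, of the antisymmetrizations of
`u_1 ⊗ ⋯ ⊗ u_c`. -/
def hwVec (r : ℕ) (μ : YoungDiagram) : TPow (Cells μ) (Vr r) :=
  ∑ σ ∈ colGroup μ, ((Equiv.Perm.sign σ : ℤ) : ℂ) •
    PiTensorProduct.tprod ℂ fun c => stdVec r (σ c).1.1

/-- The irreducible `gl_r`-module `π^λ` of highest weight `λ` (for `λ` with at most `r` rows):
the submodule generated by the highest weight vector in the tensor power of `V_r`. -/
def glIrrep (r : ℕ) (μ : YoungDiagram) :
    LieRep (gl r) ((tensorGlRep r (Cells μ)).orbit ⊤ (hwVec r μ)) :=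
  (tensorGlRep r (Cells μ)).cyclic (hwVec r μ)

/-- The representation `⨁ π_λ^{m_λ}` of `Σ_n`. -/
def spechtSum {n : ℕ} (m : Shape n → ℕ) :
    Representation ℂ (Equiv.Perm (Fin n))
      (⨁ p : Σ μ : Shape n, Fin (m μ), (specht p.1).toSubmodule) :=
  Representation.directSum fun p => (specht p.1).toRepresentation

/-- The Frobenius map `𝓕_n^r` on the class `∑ m_λ [π_λ]`, given by `π_λ ↦ π^λ` if
`λ_{r+1} = 0` and `π_λ ↦ 0` otherwise: the `gl_r`-module `⨁ (π^λ)^{m_λ}` over the `λ` with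
`λ_{r+1} = 0`. -/
def frobeniusSum (r : ℕ) {n : ℕ} (m : Shape n → ℕ) :
    LieRep (gl r) (⨁ p : Σ μ : {μ : Shape n // μ.1.rowLen r = 0}, Fin (m μ.1),
      (tensorGlRep r (Cells p.1.1.1)).orbit ⊤ (hwVec r p.1.1.1)) :=
  LieRep.directSum fun p => glIrrep r p.1.1.1

/-- `W ≅ 𝓕_n^r(M)`: the class of `M` in the Grothendieck ring of `Σ_n` is a combination
`∑ m_λ [π_λ]`, and `W` is isomorphic to the image of that class, however it is written. -/
def IsFrobeniusImage (r : ℕ) {n : ℕ} {M : Type*} [AddCommGroup M] [Module ℂ M]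
    (μ : Representation ℂ (Equiv.Perm (Fin n)) M)
    {W : Type*} [AddCommGroup W] [Module ℂ W] (ρ : LieRep (gl r) W) : Prop :=
  (∃ m : Shape n → ℕ, Nonempty (μ.Equiv (spechtSum m))) ∧
    ∀ m : Shape n → ℕ, Nonempty (μ.Equiv (spechtSum m)) → ρ.Iso (frobeniusSum r m)

end DeformedWeyl

end

open scoped TensorProduct DirectSum

attribute [local instance 100] LieRing.ofAssociativeRing

noncomputable section

namespace DeformedWeyl

/-! ## Column antisymmetrizers -/

section ColumnSymmetrizer

variable {n : ℕ} {μ : YoungDiagram} {W W' : Type*} [AddCommGroup W] [Module ℂ W]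
  [AddCommGroup W'] [Module ℂ W']

/-! Say that `x^(N-1-l)` has level `l`. Then `X` lowers levels by one and kills level 0, while `Y`
acts on the levels with distinct eigenvalues. The vector `v_ξ` is the wedge of all `u_j` at levels
`l < ξ_j`, so it has `ξ^t_{l+1}` factors at level `l`. No element of `gl_r ⊗ ℂ⟨X, Y⟩` raises a
level; hence every wedge produced from `v_ξ` has, for each `L`, at least as many factors of level
below `L` as `v_ξ` has. If `f k` is the level of the `k`-th factor, this says that `f` is a
`ρ`-parking function with values counted from zero (`isParking_iff`, `countP_rhoList`,
`card_filter_level`). Conversely, Lagrange interpolation in `Y` isolates one level, so a single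
factor can be moved to any basis vector of no higher level while the others stay
(`exists_extVrnRep_wedge`), and an exchange argument (`exists_exchange`) then reaches every parking
wedge. So the filtration exhausts exactly the span of the parking wedges (`iSup_weylFilt`).

Sending a basis tensor and a parking function to the corresponding wedge is invariant under `Σ_n`,
since the sign of reordering a wedge cancels the factor `Sign`. A wedge coefficient of the image of
an invariant tensor is `n!` times a coefficient of the tensor, so the invariants map isomorphically
onto the span of the parking wedges (`swInvRep_iso_range_pfWedge`). Passing to the associated graded
space does not change the `gl_r`-module: `E_ab` and `E_ba` are adjoint for the Hermitian form in
which the basis tensors are orthonormal, so all modules involved are completely reducible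
(`LieRep.gr_iso`). This is part 1.

Part 2 reduces to two facts. Every representation of `Σ_n` is a sum of Specht modules: these are
irreducible and pairwise non-isomorphic by the antisymmetrizer argument of James, and there are at
least as many shapes as conjugacy classes, so their characters span the class functions. And
`(V_r^{⊗ n} ⊗ π_λ)^{Σ_n}` is `π^λ` or zero: pairing the second factor with a polytabloid embeds the
invariants in `V_r^{⊗ n}`, with image that of `spechtOp`; when `λ` has at most `r` rows this image
is the cyclic module of the highest weight vector, because the commutant of `Σ_n` is generated by
`gl_r` (`mem_adjoin_of_commute`).

For part 3, an invariant of weight `η` is determined by its coefficient at one basis tensor of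
content `η`. The stabilizer of that basis tensor is the Young subgroup, and every vector fixed by
the stabilizer occurs as such a coefficient. -/

theorem mem_colGroup {σ : Equiv.Perm (Cells μ)} :
    σ ∈ colGroup μ ↔ ∀ c, (σ c).1.2 = c.1.2 := by
  simp [colGroup]

theorem one_mem_colGroup : (1 : Equiv.Perm (Cells μ)) ∈ colGroup μ :=
  mem_colGroup.2 fun _ => rfl

theorem inv_mem_colGroup {σ : Equiv.Perm (Cells μ)} (h : σ ∈ colGroup μ) :
    σ⁻¹ ∈ colGroup μ :=
  mem_colGroup.2 fun c => by
    have := mem_colGroup.1 h (σ⁻¹ c)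
    rw [← Equiv.Perm.mul_apply, mul_inv_cancel] at this
    exact this.symm

theorem mul_mem_colGroup {σ τ : Equiv.Perm (Cells μ)} (h : σ ∈ colGroup μ)
    (h' : τ ∈ colGroup μ) : σ * τ ∈ colGroup μ :=
  mem_colGroup.2 fun c => by
    rw [Equiv.Perm.mul_apply, mem_colGroup.1 h, mem_colGroup.1 h']

theorem swap_mem_colGroup {c d : Cells μ} (h : c.1.2 = d.1.2) :
    Equiv.swap c d ∈ colGroup μ :=
  mem_colGroup.2 fun e => by
    rcases eq_or_ne e c with rfl | h1
    · simp [h]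
    rcases eq_or_ne e d with rfl | h2
    · simp [h]
    rw [Equiv.swap_apply_of_ne_of_ne h1 h2]

theorem sign_mul_self_complex {α : Type*} [DecidableEq α] [Fintype α] (σ : Equiv.Perm α) :
    ((Equiv.Perm.sign σ : ℤ) : ℂ) * ((Equiv.Perm.sign σ : ℤ) : ℂ) = 1 := by
  rcases Int.units_eq_one_or (Equiv.Perm.sign σ) with h | h <;> simp [h]

/-- The signed sum of the column permutations of a numbering. -/
def colSym (ρ : Representation ℂ (Equiv.Perm (Fin n)) W) (T : Cells μ ≃ Fin n) :
    Module.End ℂ W :=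
  ∑ σ ∈ colGroup μ, ((Equiv.Perm.sign σ : ℤ) : ℂ) • ρ (T.permCongr σ)

theorem colSym_apply (ρ : Representation ℂ (Equiv.Perm (Fin n)) W) (T : Cells μ ≃ Fin n)
    (x : W) : colSym ρ T x =
      ∑ σ ∈ colGroup μ, ((Equiv.Perm.sign σ : ℤ) : ℂ) • ρ (T.permCongr σ) x := by
  simp [colSym, LinearMap.sum_apply]

theorem permCongr_mul' {α β : Type*} (T : α ≃ β) (σ τ : Equiv.Perm α) :
    T.permCongr (σ * τ) = T.permCongr σ * T.permCongr τ := by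
  ext; simp

theorem permCongr_inv' {α β : Type*} (T : α ≃ β) (σ : Equiv.Perm α) :
    T.permCongr σ⁻¹ = (T.permCongr σ)⁻¹ := by
  rw [eq_inv_iff_mul_eq_one, ← permCongr_mul', inv_mul_cancel]
  ext; simp

theorem map_colSym (ρ : Representation ℂ (Equiv.Perm (Fin n)) W)
    (ρ' : Representation ℂ (Equiv.Perm (Fin n)) W') (T : Cells μ ≃ Fin n) (f : W →ₗ[ℂ] W')
    (hf : ∀ g x, f (ρ g x) = ρ' g (f x)) (x : W) : f (colSym ρ T x) = colSym ρ' T (f x) := by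
  simp [colSym_apply, map_sum, hf]

theorem colSym_mem (ρ : Representation ℂ (Equiv.Perm (Fin n)) W) (T : Cells μ ≃ Fin n)
    (S : Submodule ℂ W) (hS : ∀ g, ∀ x ∈ S, ρ g x ∈ S) {x : W} (hx : x ∈ S) :
    colSym ρ T x ∈ S := by
  rw [colSym_apply]
  exact Submodule.sum_mem _ fun σ _ => Submodule.smul_mem _ _ (hS _ _ hx)

theorem colSym_perm (ρ : Representation ℂ (Equiv.Perm (Fin n)) W) (T : Cells μ ≃ Fin n)
    {τ : Equiv.Perm (Cells μ)} (hτ : τ ∈ colGroup μ) (x : W) :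
    colSym ρ T (ρ (T.permCongr τ) x) = ((Equiv.Perm.sign τ : ℤ) : ℂ) • colSym ρ T x := by
  rw [colSym_apply, colSym_apply, Finset.smul_sum]
  refine Finset.sum_bij' (fun σ _ => σ * τ) (fun σ _ => σ * τ⁻¹)
    (fun σ h => mul_mem_colGroup h hτ) (fun σ h => mul_mem_colGroup h (inv_mem_colGroup hτ))
    (fun σ _ => by simp) (fun σ _ => by simp) fun σ _ => ?_
  rw [permCongr_mul', map_mul ρ, Module.End.mul_apply, smul_smul]
  congr 1
  rw [map_mul, Units.val_mul, Int.cast_mul, mul_comm, mul_assoc, sign_mul_self_complex, mul_one]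

theorem perm_colSym (ρ : Representation ℂ (Equiv.Perm (Fin n)) W) (T : Cells μ ≃ Fin n)
    {τ : Equiv.Perm (Cells μ)} (hτ : τ ∈ colGroup μ) (x : W) :
    ρ (T.permCongr τ) (colSym ρ T x) = ((Equiv.Perm.sign τ : ℤ) : ℂ) • colSym ρ T x := by
  rw [colSym_apply, map_sum, Finset.smul_sum]
  refine Finset.sum_bij' (fun σ _ => τ * σ) (fun σ _ => τ⁻¹ * σ)
    (fun σ h => mul_mem_colGroup hτ h) (fun σ h => mul_mem_colGroup (inv_mem_colGroup hτ) h)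
    (fun σ _ => by simp) (fun σ _ => by simp) fun σ _ => ?_
  rw [permCongr_mul', map_mul ρ, Module.End.mul_apply, smul_smul, map_smul]
  congr 1
  rw [map_mul, Units.val_mul, Int.cast_mul, ← mul_assoc, sign_mul_self_complex, one_mul]

/-- All terms of the signed sum coincide. Since the order of the column group is invertible, this
recovers an alternating vector from its antisymmetrization. -/
theorem colSym_of_alternating (ρ : Representation ℂ (Equiv.Perm (Fin n)) W)
    (T : Cells μ ≃ Fin n) (x : W)
    (h : ∀ τ ∈ colGroup μ, ρ (T.permCongr τ) x = ((Equiv.Perm.sign τ : ℤ) : ℂ) • x) :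
    colSym ρ T x = ((colGroup μ).card : ℂ) • x := by
  rw [colSym_apply, Finset.sum_congr rfl fun σ hσ => by
    rw [h σ hσ, smul_smul, sign_mul_self_complex, one_smul]]
  simp [Nat.cast_smul_eq_nsmul]

theorem card_colGroup_ne_zero : ((colGroup μ).card : ℂ) ≠ 0 :=
  Nat.cast_ne_zero.2 (Finset.card_ne_zero.2 ⟨1, one_mem_colGroup⟩)

theorem permCongr_swap' {α β : Type*} [DecidableEq α] [DecidableEq β] (T : α ≃ β) (c d : α) :
    T.permCongr (Equiv.swap c d) = Equiv.swap (T c) (T d) := by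
  ext x
  rw [Equiv.permCongr_apply, ← T.injective.swap_apply, Equiv.apply_symm_apply]

/-- The column transposition fixes `x` but changes the sign of its antisymmetrization. -/
theorem colSym_eq_zero_of_swap (ρ : Representation ℂ (Equiv.Perm (Fin n)) W)
    (T : Cells μ ≃ Fin n) (x : W) {c d : Cells μ} (hcd : c ≠ d) (hc : c.1.2 = d.1.2)
    (h : ρ (Equiv.swap (T c) (T d)) x = x) : colSym ρ T x = 0 := by
  have := colSym_perm ρ T (swap_mem_colGroup hc) x
  rw [permCongr_swap', h, Equiv.Perm.sign_swap hcd] at this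
  simp only [Units.val_neg, Units.val_one, Int.cast_neg, Int.cast_one, neg_smul, one_smul] at this
  have h2 : (2 : ℂ) • colSym ρ T x = 0 := by rw [two_smul]; nth_rewrite 1 [this]; simp
  exact (smul_eq_zero_iff_right two_ne_zero).1 h2

end ColumnSymmetrizer

/-! ## Specht modules -/

section Specht

variable {n : ℕ} {μ ν : YoungDiagram}

theorem tabloidRep_single (τ : Equiv.Perm (Fin n)) (s : Tabloid n) (a : ℂ) :
    tabloidRep n τ (MonoidAlgebra.single s a) =
      MonoidAlgebra.single (Tabloid.mk fun k => s (τ⁻¹ k)) a := by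
  rw [tabloidRep, Representation.ofMulAction_single]; rfl

/-- The row tabloid of a numbering. -/
def rowTabloid (T : Cells μ ≃ Fin n) : Tabloid n := Tabloid.mk fun k => (T.symm k).1.1

/-- The sum is reindexed by inverses: `polytabloid` reads the row of `σ c`, while a permutation acts
on tabloids through its inverse. -/
theorem polytabloid_eq_colSym (T : Cells μ ≃ Fin n) :
    polytabloid μ T = colSym (tabloidRep n) T (MonoidAlgebra.single (rowTabloid T) 1) := by
  rw [colSym_apply, polytabloid]
  refine Finset.sum_bij' (fun σ _ => σ⁻¹) (fun σ _ => σ⁻¹) (fun _ h => inv_mem_colGroup h)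
    (fun _ h => inv_mem_colGroup h) (by simp) (by simp) fun σ _ => ?_
  rw [Equiv.Perm.sign_inv, tabloidRep_single, permCongr_inv', inv_inv]
  congr 2
  funext k
  simp [rowTabloid, Tabloid.mk]

theorem perm_polytabloid (T : Cells μ ≃ Fin n) {τ : Equiv.Perm (Cells μ)}
    (hτ : τ ∈ colGroup μ) : tabloidRep n (T.permCongr τ) (polytabloid μ T) =
      ((Equiv.Perm.sign τ : ℤ) : ℂ) • polytabloid μ T := by
  rw [polytabloid_eq_colSym, perm_colSym _ _ hτ]

/-- The sum of the row indices over the cells of a diagram. -/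
def rowSum (μ : YoungDiagram) : ℕ := ∑ c : Cells μ, c.1.1

theorem sum_rowTabloid (T : Cells μ ≃ Fin n) : ∑ k, rowTabloid T k = rowSum μ := by
  rw [rowSum, ← Equiv.sum_comp T.symm]; rfl

/-- An injective map on the cells that preserves columns and does not increase the total row
index is a column permutation. -/
theorem exists_colGroup_of_sum_le (s : Cells μ → ℕ)
    (hinj : ∀ c d : Cells μ, c.1.2 = d.1.2 → s c = s d → c = d)
    (hs : ∑ c, s c ≤ rowSum μ) : ∃ σ ∈ colGroup μ, ∀ c, s c = (σ c).1.1 := by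
  let F : Cells μ → ℕ × ℕ := fun c => (s c, c.1.2)
  have hF : Function.Injective F := fun c d h =>
    hinj c d (Prod.ext_iff.1 h).2 (Prod.ext_iff.1 h).1
  -- This weight is negative exactly on the cells of `μ`. Columns are preserved, so the column
  -- lengths have the same sum over `I` and over `μ`, and the bound on `s` becomes an inequality of
  -- weights. After removal of the common cells, a sum that is at least zero is bounded by one that
  -- is at most `-|μ \ I|`, which forces `μ ⊆ I`.
  let φ : ℕ × ℕ → ℤ := fun x => (x.1 : ℤ) - μ.colLen x.2
  let I : Finset (ℕ × ℕ) := Finset.univ.image F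
  have hI : ∑ x ∈ I, φ x = ∑ c, ((s c : ℤ) - μ.colLen c.1.2) :=
    Finset.sum_image fun c _ d _ h => hF h
  have hμ : ∑ x ∈ μ.cells, φ x = ∑ c : Cells μ, ((c.1.1 : ℤ) - μ.colLen c.1.2) :=
    (Finset.sum_coe_sort μ.cells φ).symm
  have hle : ∑ x ∈ I, φ x ≤ ∑ x ∈ μ.cells, φ x := by
    rw [hI, hμ, Finset.sum_sub_distrib, Finset.sum_sub_distrib]
    have : ((∑ c, s c : ℕ) : ℤ) ≤ (rowSum μ : ℕ) := by exact_mod_cast hs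
    rw [rowSum] at this
    push_cast at this
    linarith
  rw [← Finset.sum_sdiff_le_sum_sdiff] at hle
  have h1 : 0 ≤ ∑ x ∈ I \ μ.cells, φ x := Finset.sum_nonneg fun x hx => by
    have : x ∉ μ := fun h => (Finset.mem_sdiff.1 hx).2 ((YoungDiagram.mem_cells x).2 h)
    have h2 : ¬ x.1 < μ.colLen x.2 := fun h => this (YoungDiagram.mem_iff_lt_colLen.2 h)
    simp only [φ]; omega
  have h2 : ∑ x ∈ μ.cells \ I, φ x ≤ ∑ x ∈ μ.cells \ I, (-1 : ℤ) :=
    Finset.sum_le_sum fun x hx => by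
      have h := YoungDiagram.mem_iff_lt_colLen.1
        ((YoungDiagram.mem_cells x).1 (Finset.mem_sdiff.1 hx).1)
      simp only [φ]; omega
  have h3 : (μ.cells \ I).card = 0 := by
    simp only [Finset.sum_const, nsmul_eq_mul] at h2
    omega
  have h4 : μ.cells ⊆ I := by
    rw [Finset.card_eq_zero, Finset.sdiff_eq_empty_iff_subset] at h3
    exact h3
  have h5 : I = μ.cells := (Finset.eq_of_subset_of_card_le h4 (by
    rw [Finset.card_image_of_injective _ hF, Finset.card_univ, Fintype.card_coe])).symm
  have hmem : ∀ c, F c ∈ μ.cells := fun c => h5 ▸ Finset.mem_image_of_mem F (Finset.mem_univ c)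
  let G : Cells μ → Cells μ := fun c => ⟨F c, hmem c⟩
  have hG : Function.Injective G := fun c d h => hF (congrArg Subtype.val h)
  exact ⟨Equiv.ofBijective G (Finite.injective_iff_bijective.1 hG),
    mem_colGroup.2 fun c => rfl, fun c => rfl⟩

/-- If two numbers in one column of `T` share a row of `s`, their transposition kills the
antisymmetrization. Otherwise `s` separates every column, and the bound on the total row index
leaves only column permutations of `T`. Comparing row sums takes the place of the dominance order.
-/
theorem colSym_single (T : Cells μ ≃ Fin n) (s : Tabloid n) (hs : ∑ k, s k ≤ rowSum μ) :
    colSym (tabloidRep n) T (MonoidAlgebra.single s 1) = 0 ∨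
      ∃ σ ∈ colGroup μ, s = Tabloid.mk fun k => (σ (T.symm k)).1.1 := by
  by_cases hinj : ∀ c d : Cells μ, c.1.2 = d.1.2 → s (T c) = s (T d) → c = d
  · right
    obtain ⟨σ, hσ, h⟩ := exists_colGroup_of_sum_le (fun c => s (T c)) hinj
      (by rwa [Equiv.sum_comp T fun k => s k])
    refine ⟨σ, hσ, ?_⟩
    funext k
    rw [Tabloid.mk, ← h, Equiv.apply_symm_apply]
  · left
    push Not at hinj
    obtain ⟨c, d, h1, h2, h3⟩ := hinj
    refine colSym_eq_zero_of_swap _ T _ h3 h1 ?_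
    rw [tabloidRep_single]
    congr 1
    funext k
    rw [Tabloid.mk, Equiv.swap_inv]
    rcases eq_or_ne k (T c) with rfl | hc
    · simp [h2]
    rcases eq_or_ne k (T d) with rfl | hd
    · simp [h2]
    rw [Equiv.swap_apply_of_ne_of_ne hc hd]

/-- The span of the row tabloids of shape `μ`. -/
def tabloidSpan (n : ℕ) (μ : YoungDiagram) : Submodule ℂ (MonoidAlgebra ℂ (Tabloid n)) :=
  Submodule.span ℂ {x | ∃ T : Cells μ ≃ Fin n, x = MonoidAlgebra.single (rowTabloid T) 1}

theorem tabloid_colPerm (T : Cells μ ≃ Fin n) (σ : Equiv.Perm (Cells μ)) :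
    (Tabloid.mk fun k => (σ (T.symm k)).1.1) = rowTabloid (σ.symm.trans T) := rfl

theorem specht_le_tabloidSpan (μ : Shape n) :
    (specht μ).toSubmodule ≤ tabloidSpan n μ.1 := by
  refine Submodule.span_le.2 ?_
  rintro _ ⟨T, rfl⟩
  exact Submodule.sum_mem _ fun σ _ =>
    Submodule.smul_mem _ _ (Submodule.subset_span ⟨_, by rw [tabloid_colPerm]⟩)

/-- A tabloid remembers how many numbers lie in each row, that is, the row lengths. -/
theorem eq_of_rowTabloid_eq {T : Cells μ ≃ Fin n} {T' : Cells ν ≃ Fin n}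
    (h : rowTabloid T = rowTabloid T') : μ = ν := by
  have key : ∀ (κ : YoungDiagram) (S : Cells κ ≃ Fin n) (i : ℕ),
      κ.rowLen i = (Finset.univ.filter fun k => (S.symm k).1.1 = i).card := by
    intro κ S i
    rw [YoungDiagram.rowLen_eq_card]
    refine Finset.card_bij' (fun c hc => S ⟨c, (YoungDiagram.mem_cells c).2
        (YoungDiagram.mem_row_iff.1 hc).1⟩) (fun k _ => (S.symm k).1) ?_ ?_ ?_ ?_
    · intro c hc
      simpa using (YoungDiagram.mem_row_iff.1 hc).2
    · intro k hk
      exact YoungDiagram.mem_row_iff.2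
        ⟨(YoungDiagram.mem_cells _).1 (S.symm k).2, (Finset.mem_filter.1 hk).2⟩
    · intro c hc; simp
    · intro k hk; simp
  have h2 : ∀ i, μ.rowLen i = ν.rowLen i := fun i => by
    rw [key μ T, key ν T']
    have h' : ∀ k, (T.symm k).1.1 = (T'.symm k).1.1 := congrFun h
    simp only [h']
  ext ⟨i, j⟩
  rw [YoungDiagram.mem_cells, YoungDiagram.mem_cells, YoungDiagram.mem_iff_lt_rowLen,
    YoungDiagram.mem_iff_lt_rowLen, h2]

theorem colSym_rowTabloid_mem (T T' : Cells μ ≃ Fin n) :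
    colSym (tabloidRep n) T (MonoidAlgebra.single (rowTabloid T') 1) ∈
      Submodule.span ℂ {polytabloid μ T} := by
  rcases colSym_single T (rowTabloid T') (sum_rowTabloid T').le with h | ⟨σ, hσ, h⟩
  · rw [h]; exact Submodule.zero_mem _
  · have : MonoidAlgebra.single (rowTabloid T') (1 : ℂ) = tabloidRep n (T.permCongr σ⁻¹)
        (MonoidAlgebra.single (rowTabloid T) 1) := by
      rw [tabloidRep_single, permCongr_inv', inv_inv, h]
      congr 1
      funext k
      simp [rowTabloid, Tabloid.mk]
    rw [this, colSym_perm _ _ (inv_mem_colGroup hσ), ← polytabloid_eq_colSym]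
    exact Submodule.smul_mem _ _ (Submodule.mem_span_singleton_self _)

/-- On tabloids of its own shape the antisymmetrizer has rank one: `colSym_single` sends each of
them to zero or to `± polytabloid μ T`. The irreducibility of Specht modules rests on this. -/
theorem colSym_mem_span_polytabloid (T : Cells μ ≃ Fin n) {x : MonoidAlgebra ℂ (Tabloid n)}
    (hx : x ∈ tabloidSpan n μ) :
    colSym (tabloidRep n) T x ∈ Submodule.span ℂ {polytabloid μ T} := by
  rw [← Submodule.mem_comap]
  refine Submodule.span_le.2 ?_ hx
  rintro _ ⟨T', rfl⟩
  exact colSym_rowTabloid_mem T T'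

/-- In the second case of `colSym_single` a tabloid of shape `ν` would also be one of shape `μ`. Of
two shapes, one always satisfies `hle` with respect to the other, so this suffices to tell them
apart. -/
theorem colSym_eq_zero_of_ne (T : Cells μ ≃ Fin n) (hne : μ ≠ ν) (hle : rowSum ν ≤ rowSum μ)
    {x : MonoidAlgebra ℂ (Tabloid n)} (hx : x ∈ tabloidSpan n ν) :
    colSym (tabloidRep n) T x = 0 := by
  rw [← LinearMap.mem_ker]
  refine Submodule.span_le.2 ?_ hx
  rintro _ ⟨T', rfl⟩
  rcases colSym_single T (rowTabloid T') ((sum_rowTabloid T').trans_le hle) with h | ⟨σ, hσ, h⟩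
  · exact h
  · exact absurd (eq_of_rowTabloid_eq (h.trans (tabloid_colPerm T σ))).symm hne

/-- The standard Hermitian form on `ℂ[Tabloid n]`, conjugate linear in the first argument. -/
def tabForm (x : MonoidAlgebra ℂ (Tabloid n)) : MonoidAlgebra ℂ (Tabloid n) →ₗ[ℂ] ℂ :=
  (Finsupp.lsum ℂ fun s => (starRingEnd ℂ (x.coeff s)) • LinearMap.id).comp
    (MonoidAlgebra.coeffLinearEquiv ℂ).toLinearMap

theorem tabForm_apply (x y : MonoidAlgebra ℂ (Tabloid n)) :
    tabForm x y = y.coeff.sum fun s a => starRingEnd ℂ (x.coeff s) * a := rfl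

theorem tabForm_single (x : MonoidAlgebra ℂ (Tabloid n)) (s : Tabloid n) :
    tabForm x (MonoidAlgebra.single s 1) = starRingEnd ℂ (x.coeff s) := by
  rw [tabForm_apply, MonoidAlgebra.coeff_single, Finsupp.sum_single_index] <;> simp

theorem tabForm_add_left (x x' y : MonoidAlgebra ℂ (Tabloid n)) :
    tabForm (x + x') y = tabForm x y + tabForm x' y := by
  simp [tabForm_apply, add_mul, Finsupp.sum_add]

theorem tabForm_smul_left (c : ℂ) (x y : MonoidAlgebra ℂ (Tabloid n)) :
    tabForm (c • x) y = starRingEnd ℂ c * tabForm x y := by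
  simp [tabForm_apply, Finsupp.mul_sum, mul_assoc]

theorem tabForm_zero_left (y : MonoidAlgebra ℂ (Tabloid n)) : tabForm 0 y = 0 := by
  simp [tabForm_apply]

theorem tabForm_sum_left {ι : Type*} (s : Finset ι) (x : ι → MonoidAlgebra ℂ (Tabloid n))
    (y : MonoidAlgebra ℂ (Tabloid n)) : tabForm (∑ i ∈ s, x i) y = ∑ i ∈ s, tabForm (x i) y := by
  classical
  induction s using Finset.induction_on with
  | empty => simp [tabForm_zero_left]
  | insert a s ha ih => rw [Finset.sum_insert ha, Finset.sum_insert ha, tabForm_add_left, ih]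

theorem eq_zero_of_tabForm_self {x : MonoidAlgebra ℂ (Tabloid n)} (h : tabForm x x = 0) :
    x = 0 := by
  have h1 : tabForm x x = ((∑ s ∈ x.coeff.support, ‖x.coeff s‖ ^ 2 : ℝ) : ℂ) := by
    rw [tabForm_apply, Finsupp.sum, Complex.ofReal_sum]
    exact Finset.sum_congr rfl fun s _ => by rw [Complex.conj_mul']; norm_cast
  rw [h1, Complex.ofReal_eq_zero, Finset.sum_eq_zero_iff_of_nonneg fun _ _ => by positivity] at h
  ext s
  by_contra hs
  have := h s (Finsupp.mem_support_iff.2 hs)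
  simp at this
  exact hs (by simpa using this)

theorem tabForm_perm (τ : Equiv.Perm (Fin n)) (x y : MonoidAlgebra ℂ (Tabloid n)) :
    tabForm (tabloidRep n τ x) y = tabForm x (tabloidRep n τ⁻¹ y) := by
  have : tabForm (tabloidRep n τ x) = tabForm x ∘ₗ tabloidRep n τ⁻¹ := by
    refine MonoidAlgebra.lhom_ext' fun s => LinearMap.ext_ring ?_
    change tabForm (tabloidRep n τ x) (MonoidAlgebra.single s 1) =
      tabForm x (tabloidRep n τ⁻¹ (MonoidAlgebra.single s 1))
    rw [tabForm_single, tabloidRep, Representation.ofMulAction_single, tabForm_single,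
      Representation.coeff_ofMulAction]
  exact LinearMap.congr_fun this y

theorem tabForm_colSym (T : Cells μ ≃ Fin n) (x y : MonoidAlgebra ℂ (Tabloid n)) :
    tabForm (colSym (tabloidRep n) T x) y = tabForm x (colSym (tabloidRep n) T y) := by
  rw [colSym_apply, colSym_apply, map_sum, tabForm_sum_left]
  refine Finset.sum_bij' (fun σ _ => σ⁻¹) (fun σ _ => σ⁻¹) (fun _ h => inv_mem_colGroup h)
    (fun _ h => inv_mem_colGroup h) (by simp) (by simp) fun σ _ => ?_
  rw [tabForm_smul_left, tabForm_perm, map_smul, permCongr_inv', Equiv.Perm.sign_inv]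
  simp

theorem tabForm_eq_zero_of_specht (μ : Shape n) {y : MonoidAlgebra ℂ (Tabloid n)}
    (h : ∀ T : Cells μ.1 ≃ Fin n, tabForm (polytabloid μ.1 T) y = 0) :
    ∀ x ∈ (specht μ).toSubmodule, tabForm x y = 0 := by
  intro x hx
  induction hx using Submodule.span_induction with
  | mem x hx => obtain ⟨T, rfl⟩ := hx; exact h T
  | zero => exact tabForm_zero_left y
  | add a b _ _ ha hb => rw [tabForm_add_left, ha, hb, add_zero]
  | smul c a _ ha => rw [tabForm_smul_left, ha, mul_zero]

theorem polytabloid_mem_specht (μ : Shape n) (T : Cells μ.1 ≃ Fin n) :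
    polytabloid μ.1 T ∈ (specht μ).toSubmodule := Submodule.subset_span ⟨T, rfl⟩

theorem specht_le_of_polytabloid_mem (μ : Shape n) (T : Cells μ.1 ≃ Fin n)
    (U : Submodule ℂ (MonoidAlgebra ℂ (Tabloid n)))
    (hU : ∀ g, ∀ x ∈ U, tabloidRep n g x ∈ U) (h : polytabloid μ.1 T ∈ U) :
    (specht μ).toSubmodule ≤ U := by
  refine Submodule.span_le.2 ?_
  rintro _ ⟨T', rfl⟩
  have := hU (T.symm.trans T') _ h
  rw [tabloidRep_polytabloid] at this
  rwa [← Equiv.trans_assoc, Equiv.self_trans_symm, Equiv.refl_trans] at this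

theorem coeff_polytabloid (T : Cells μ ≃ Fin n) :
    (polytabloid μ T).coeff (rowTabloid T) = 1 := by
  classical
  rw [polytabloid, MonoidAlgebra.coeff_sum, Finset.sum_apply', Finset.sum_eq_single 1]
  · rw [MonoidAlgebra.coeff_smul_apply, MonoidAlgebra.coeff_single]
    simp [rowTabloid]
  · intro σ hσ hne
    rw [MonoidAlgebra.coeff_smul_apply, MonoidAlgebra.coeff_single, Finsupp.single_apply, if_neg,
      smul_zero]
    intro h
    refine hne (Equiv.ext fun c => Subtype.ext (Prod.ext ?_ (mem_colGroup.1 hσ c)))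
    have := congrFun h (T c)
    simpa [rowTabloid, Tabloid.mk] using this
  · exact fun h => absurd one_mem_colGroup h

theorem polytabloid_ne_zero (T : Cells μ ≃ Fin n) : polytabloid μ T ≠ 0 := fun h => by
  have := coeff_polytabloid T
  rw [h] at this
  simp at this

theorem nonempty_numbering (μ : Shape n) : Nonempty (Cells μ.1 ≃ Fin n) :=
  Fintype.card_eq.1 (by rw [Fintype.card_coe, Fintype.card_fin]; exact μ.2)

/-- A nonzero invariant subspace of a Specht module is the whole Specht module. -/
theorem specht_le_of_ne_bot (μ : Shape n) (U : Submodule ℂ (MonoidAlgebra ℂ (Tabloid n)))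
    (hU : ∀ g, ∀ x ∈ U, tabloidRep n g x ∈ U) (hle : U ≤ (specht μ).toSubmodule) (h0 : U ≠ ⊥) :
    (specht μ).toSubmodule ≤ U := by
  obtain ⟨u, huU, hu0⟩ := (Submodule.ne_bot_iff U).1 h0
  -- The submodule theorem of James. The antisymmetrizers are self-adjoint, so if all of them kill
  -- `u`, then `u` is orthogonal to every polytabloid, hence to itself. If one does not, it sends
  -- `u` to a nonzero multiple of a polytabloid, which generates the Specht module.
  by_cases h : ∀ T : Cells μ.1 ≃ Fin n, colSym (tabloidRep n) T u = 0
  · refine absurd (eq_zero_of_tabForm_self (tabForm_eq_zero_of_specht μ (fun T => ?_) u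
      (hle huU))) hu0
    rw [polytabloid_eq_colSym, tabForm_colSym, h T, map_zero]
  · push Not at h
    obtain ⟨T, hT⟩ := h
    obtain ⟨a, ha⟩ := Submodule.mem_span_singleton.1
      (colSym_mem_span_polytabloid T (specht_le_tabloidSpan μ (hle huU)))
    have ha0 : a ≠ 0 := by rintro rfl; rw [zero_smul] at ha; exact hT ha.symm
    refine specht_le_of_polytabloid_mem μ T U hU ?_
    rw [← inv_smul_smul₀ ha0 (polytabloid μ.1 T), ha]
    exact Submodule.smul_mem _ _ (colSym_mem _ T U hU huU)

/-- Specht modules are irreducible. -/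
instance specht_isIrreducible (μ : Shape n) :
    (specht μ).toRepresentation.IsIrreducible where
  exists_pair_ne := by
    obtain ⟨T⟩ := nonempty_numbering μ
    refine ⟨⊥, ⊤, fun h => polytabloid_ne_zero T ?_⟩
    have : (⟨_, polytabloid_mem_specht μ T⟩ : (specht μ).toSubmodule) ∈
        (⊥ : Subrepresentation (specht μ).toRepresentation) := h ▸ trivial
    exact congrArg Subtype.val (show (⟨_, polytabloid_mem_specht μ T⟩ :
      (specht μ).toSubmodule) = 0 from this)
  eq_bot_or_eq_top U := by
    by_cases h : U.toSubmodule = ⊥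
    · left; exact Subrepresentation.toSubmodule_injective h
    · right
      apply Subrepresentation.toSubmodule_injective
      have := specht_le_of_ne_bot μ (U.toSubmodule.map (specht μ).toSubmodule.subtype)
        (by
          rintro g _ ⟨x, hx, rfl⟩
          exact ⟨_, U.apply_mem_toSubmodule g hx, rfl⟩)
        (Submodule.map_subtype_le _ _) fun h' => h
          (Submodule.map_injective_of_injective (Submodule.subtype_injective _)
            (h'.trans (Submodule.map_bot _).symm))
      refine eq_top_iff.2 fun x _ => ?_
      obtain ⟨y, hy, hxy⟩ := this x.2
      rwa [← Subtype.ext hxy]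

/-- The antisymmetrizer of `T` multiplies the polytabloid of `T` by the nonzero order of the column
group, but acts as zero on the Specht module of a different shape `ν` with `rowSum ν ≤ rowSum μ`. An
isomorphism would intertwine the two actions. -/
theorem specht_equiv_eq_aux {μ ν : Shape n} (hle : rowSum ν.1 ≤ rowSum μ.1)
    (e : (specht μ).toRepresentation.Equiv (specht ν).toRepresentation) : μ = ν := by
  obtain ⟨T⟩ := nonempty_numbering μ
  by_contra hne
  set x : (specht μ).toSubmodule := ⟨_, polytabloid_mem_specht μ T⟩
  let f : (specht μ).toSubmodule →ₗ[ℂ] MonoidAlgebra ℂ (Tabloid n) :=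
    (specht ν).toSubmodule.subtype ∘ₗ e.toLinearMap
  have hf : ∀ g y, f ((specht μ).toRepresentation g y) = tabloidRep n g (f y) := fun g y =>
    congrArg Subtype.val (e.toIntertwiningMap.isIntertwining _ _ g y)
  have h1 : colSym (specht μ).toRepresentation T x = ((colGroup μ.1).card : ℂ) • x :=
    colSym_of_alternating _ _ _ fun τ hτ => Subtype.ext (perm_polytabloid T hτ)
  have h2 := map_colSym _ _ T f hf x
  rw [h1, map_smul, colSym_eq_zero_of_ne T (x := f x) (fun h => hne (Subtype.ext h)) hle
    (specht_le_tabloidSpan ν (e x).2), smul_eq_zero_iff_right card_colGroup_ne_zero] at h2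
  have h3 : x = 0 := by
    have : e x = 0 := Subtype.ext h2
    rw [← e.symm_apply_apply x, this]
    exact map_zero e.symm
  exact polytabloid_ne_zero T (congrArg Subtype.val h3)

/-- Specht modules of different shapes are not isomorphic. -/
theorem specht_equiv_eq {μ ν : Shape n}
    (e : (specht μ).toRepresentation.Equiv (specht ν).toRepresentation) : μ = ν := by
  rcases le_total (rowSum ν.1) (rowSum μ.1) with h | h
  · exact specht_equiv_eq_aux h e
  · exact (specht_equiv_eq_aux h e.symm).symm

end Specht

/-! ## Every representation of the symmetric group is a sum of Specht modules -/

section Exhaustion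

variable {n : ℕ}

theorem card_cellsOfRowLens (w : List ℕ) : (YoungDiagram.cellsOfRowLens w).card = w.sum := by
  induction w with
  | nil => rfl
  | cons a w ih =>
    rw [YoungDiagram.cellsOfRowLens, Finset.card_union_of_disjoint, Finset.card_product,
      Finset.card_map, ih, Finset.card_singleton, Finset.card_range, one_mul, List.sum_cons]
    rw [Finset.disjoint_left]
    rintro ⟨i, j⟩ h1 h2
    obtain ⟨x, -, hx⟩ := Finset.mem_map.1 h2
    have h3 : i = 0 := by simpa using (Finset.mem_product.1 h1).1
    have h4 : x.1 + 1 = i := congrArg Prod.fst hx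
    omega

/-- The Young diagram of the cycle type of a permutation. -/
def cycleShape (σ : Equiv.Perm (Fin n)) : Shape n :=
  ⟨YoungDiagram.ofRowLens (σ.partition.parts.sort (· ≥ ·))
    (Multiset.pairwise_sort _ _).sortedGE, by
      change (YoungDiagram.cellsOfRowLens _).card = n
      rw [card_cellsOfRowLens, ← Multiset.sum_coe, Multiset.sort_eq, σ.partition.parts_sum,
        Fintype.card_fin]⟩

theorem isConj_of_cycleShape_eq {σ τ : Equiv.Perm (Fin n)} (h : cycleShape σ = cycleShape τ) :
    IsConj σ τ := by
  rw [Equiv.Perm.partition_eq_of_isConj]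
  have h1 := congrArg (fun μ : Shape n => μ.1.rowLens) h
  simp only [cycleShape] at h1
  rw [YoungDiagram.rowLens_ofRowLens_eq_self, YoungDiagram.rowLens_ofRowLens_eq_self] at h1
  · refine Nat.Partition.ext ?_
    rw [← Multiset.sort_eq σ.partition.parts (· ≥ ·), h1, Multiset.sort_eq]
  · intro x hx
    exact τ.partition.parts_pos ((Multiset.mem_sort _).1 hx)
  · intro x hx
    exact σ.partition.parts_pos ((Multiset.mem_sort _).1 hx)

instance specht_finiteDimensional (μ : Shape n) :
    FiniteDimensional ℂ (specht μ).toSubmodule :=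
  FiniteDimensional.span_of_finite ℂ (Set.finite_range _)

/-- The pairing of functions on the symmetric group for which irreducible characters are
orthonormal. -/
def charPairing (f g : Equiv.Perm (Fin n) → ℂ) : ℂ :=
  (Nat.card (Equiv.Perm (Fin n)) : ℂ)⁻¹ * ∑ σ, f σ * g σ⁻¹

theorem charPairing_sum {ι : Type*} (s : Finset ι) (a : ι → ℂ)
    (f : ι → Equiv.Perm (Fin n) → ℂ) (g : Equiv.Perm (Fin n) → ℂ) :
    charPairing (fun σ => ∑ i ∈ s, a i * f i σ) g = ∑ i ∈ s, a i * charPairing (f i) g := by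
  simp only [charPairing, Finset.sum_mul, Finset.mul_sum]
  rw [Finset.sum_comm]
  exact Finset.sum_congr rfl fun i _ => Finset.sum_congr rfl fun σ _ => by ring

open Classical in
theorem charPairing_character {V W : Type*} [AddCommGroup V] [Module ℂ V] [AddCommGroup W]
    [Module ℂ W] [FiniteDimensional ℂ V] [FiniteDimensional ℂ W]
    (ρ : Representation ℂ (Equiv.Perm (Fin n)) V) (σ : Representation ℂ (Equiv.Perm (Fin n)) W)
    [ρ.IsIrreducible] [σ.IsIrreducible] :
    charPairing ρ.character σ.character = if Nonempty (σ.Equiv ρ) then 1 else 0 := by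
  have : Invertible (Nat.card (Equiv.Perm (Fin n)) : ℂ) :=
    invertibleOfNonzero (Nat.cast_ne_zero.2 Nat.card_pos.ne')
  exact Representation.char_orthonormal ρ σ

/-- The character of a Specht module, as a function on conjugacy classes. -/
def spechtChar (μ : Shape n) (c : ConjClasses (Equiv.Perm (Fin n))) : ℂ :=
  (specht μ).toRepresentation.character (Quotient.out c)

theorem character_out {V : Type*} [AddCommGroup V] [Module ℂ V]
    (ρ : Representation ℂ (Equiv.Perm (Fin n)) V) (g : Equiv.Perm (Fin n)) :
    ρ.character (Quotient.out (ConjClasses.mk g)) = ρ.character g := by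
  have h : IsConj (Quotient.out (ConjClasses.mk g)) g :=
    ConjClasses.mk_eq_mk_iff_isConj.1 (Quotient.out_eq _)
  obtain ⟨c, hc⟩ := isConj_iff.1 h
  conv_rhs => rw [← hc, Representation.char_conj]

open Classical in
theorem charPairing_specht (μ ν : Shape n) :
    charPairing (specht μ).toRepresentation.character (specht ν).toRepresentation.character =
      if μ = ν then 1 else 0 := by
  rw [charPairing_character]
  refine if_congr ⟨fun ⟨e⟩ => (specht_equiv_eq e).symm, ?_⟩ rfl rfl
  rintro rfl
  exact ⟨Representation.Equiv.refl _⟩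

/-- Pairing a linear relation with one Specht character isolates its coefficient, by orthonormality.
-/
theorem linearIndependent_spechtChar :
    LinearIndependent ℂ (spechtChar (n := n)) := by
  rw [linearIndependent_iff']
  intro s a h ν hν
  have h1 : (fun σ => ∑ μ ∈ s, a μ * (specht μ).toRepresentation.character σ) =
      fun _ => (0 : ℂ) := by
    funext σ
    have := congrFun h (ConjClasses.mk σ)
    simpa [spechtChar, character_out] using this
  have h2 := charPairing_sum s a (fun μ => (specht μ).toRepresentation.character)
    (specht ν).toRepresentation.character
  rw [h1] at h2
  classical
  have h3 : charPairing (fun _ => (0 : ℂ)) (specht ν).toRepresentation.character = 0 := by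
    simp [charPairing]
  rw [h3] at h2
  simp only [charPairing_specht] at h2
  simpa [hν] using h2.symm

/-- Finiteness comes from independence in the finite-dimensional space of class functions. -/
instance finite_shape : Finite (Shape n) := (linearIndependent_spechtChar (n := n)).finite

/-- Independence bounds the number of shapes by the number of conjugacy classes; the cycle type
gives an injection from classes to shapes, hence the reverse bound. -/
theorem span_spechtChar :
    Submodule.span ℂ (Set.range (spechtChar (n := n))) = ⊤ := by
  have := Fintype.ofFinite (Shape n)
  have := Fintype.ofFinite (ConjClasses (Equiv.Perm (Fin n)))
  refine (linearIndependent_spechtChar (n := n)).span_eq_top_of_card_eq_finrank' ?_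
  refine le_antisymm (linearIndependent_spechtChar (n := n)).fintype_card_le_finrank ?_
  rw [Module.finrank_fintype_fun_eq_card]
  refine Fintype.card_le_of_injective (fun c => cycleShape (Quotient.out c)) fun c d h => ?_
  rw [← Quotient.out_eq c, ← Quotient.out_eq d]
  exact ConjClasses.mk_eq_mk_iff_isConj.2 (isConj_of_cycleShape_eq h)

/-- Every irreducible representation of the symmetric group is a Specht module. -/
theorem exists_specht_equiv {W : Type*} [AddCommGroup W] [Module ℂ W] [FiniteDimensional ℂ W]
    (ρ : Representation ℂ (Equiv.Perm (Fin n)) W) [ρ.IsIrreducible] :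
    ∃ μ : Shape n, Nonempty ((specht μ).toRepresentation.Equiv ρ) := by
  by_contra hcon
  have := Fintype.ofFinite (Shape n)
  -- The character of a further irreducible representation would be orthogonal to all Specht
  -- characters and yet lie in their span, so its pairing with itself would be both 0 and 1.
  have h0 : ∀ μ : Shape n, charPairing (specht μ).toRepresentation.character ρ.character = 0 := by
    intro μ
    classical
    rw [charPairing_character, if_neg]
    exact fun ⟨e⟩ => hcon ⟨μ, ⟨e.symm⟩⟩
  have h1 : charPairing ρ.character ρ.character = 1 := by
    classical
    rw [charPairing_character, if_pos ⟨Representation.Equiv.refl _⟩]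
  have h2 : (fun c : ConjClasses (Equiv.Perm (Fin n)) => ρ.character (Quotient.out c)) ∈
      Submodule.span ℂ (Set.range (spechtChar (n := n))) := by
    rw [span_spechtChar]; trivial
  obtain ⟨a, ha⟩ := (Submodule.mem_span_range_iff_exists_fun ℂ).1 h2
  have h3 : ρ.character = fun σ => ∑ μ, a μ * (specht μ).toRepresentation.character σ := by
    funext σ
    have := congrFun ha (ConjClasses.mk σ)
    rw [character_out, Finset.sum_apply] at this
    rw [← this]
    exact Finset.sum_congr rfl fun μ _ => by rw [Pi.smul_apply, spechtChar, character_out]; rfl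
  have h4 := charPairing_sum Finset.univ a (fun μ => (specht μ).toRepresentation.character)
    ρ.character
  rw [← h3, h1] at h4
  simp [h0] at h4

theorem isIrreducible_of_isAtom {W : Type*} [AddCommGroup W] [Module ℂ W]
    {ρ : Representation ℂ (Equiv.Perm (Fin n)) W} {S : Subrepresentation ρ} (hS : IsAtom S) :
    S.toRepresentation.IsIrreducible where
  exists_pair_ne := by
    refine ⟨⊥, ⊤, fun h => hS.1 (Subrepresentation.toSubmodule_injective (eq_bot_iff.2 ?_))⟩
    intro x hx
    have : (⟨x, hx⟩ : S.toSubmodule) ∈ (⊥ : Subrepresentation S.toRepresentation) := h ▸ trivial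
    exact congrArg Subtype.val (show (⟨x, hx⟩ : S.toSubmodule) = 0 from this)
  eq_bot_or_eq_top U := by
    let U' : Subrepresentation ρ :=
      { toSubmodule := U.toSubmodule.map S.toSubmodule.subtype
        apply_mem_toSubmodule := by
          rintro g _ ⟨x, hx, rfl⟩
          exact ⟨_, U.apply_mem_toSubmodule g hx, rfl⟩ }
    have hU : U' ≤ S := by
      rintro _ ⟨x, _, rfl⟩
      exact x.2
    rcases hS.le_iff.1 hU with h | h
    · left
      apply Subrepresentation.toSubmodule_injective
      exact Submodule.map_injective_of_injective (Submodule.subtype_injective _)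
        ((congrArg Subrepresentation.toSubmodule h).trans (Submodule.map_bot _).symm)
    · right
      apply Subrepresentation.toSubmodule_injective
      refine Submodule.map_injective_of_injective (Submodule.subtype_injective S.toSubmodule)
        ((congrArg Subrepresentation.toSubmodule h).trans ?_)
      change _ = Submodule.map _ ⊤
      rw [Submodule.map_subtype_top]

/-- Maschke's theorem, carried from modules over the group algebra to subrepresentations. The free
index type `κ` allows the summands to be relabelled later by shape and multiplicity. -/
theorem exists_isInternal_isAtom {W : Type*} [AddCommGroup W] [Module ℂ W]
    [FiniteDimensional ℂ W] (ρ : Representation ℂ (Equiv.Perm (Fin n)) W) :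
    ∃ (s : Set (Submodule (MonoidAlgebra ℂ (Equiv.Perm (Fin n))) ρ.asModule)) (_ : Finite s)
      (B : s → Subrepresentation ρ), (∀ i, IsAtom (B i)) ∧
      ∀ (κ : Type) [DecidableEq κ] (E : κ ≃ s),
        DirectSum.IsInternal fun p => (B (E p)).toSubmodule := by
  have : NeZero (Nat.card (Equiv.Perm (Fin n)) : ℂ) := ⟨Nat.cast_ne_zero.2 Nat.card_pos.ne'⟩
  have : Module.Finite ℂ ρ.asModule := inferInstanceAs (Module.Finite ℂ W)
  have : Module.Finite (MonoidAlgebra ℂ (Equiv.Perm (Fin n))) ρ.asModule :=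
    Module.Finite.of_restrictScalars_finite ℂ _ _
  obtain ⟨s, hind, htop, hs⟩ := IsSemisimpleModule.exists_sSupIndep_sSup_simples_eq_top
    (MonoidAlgebra ℂ (Equiv.Perm (Fin n))) ρ.asModule
  refine ⟨s, WellFoundedGT.finite_of_iSupIndep ((sSupIndep_iff _).mp hind) fun S =>
    have := hs S.1 S.2
    (S.1.nontrivial_iff_ne_bot).mp
      (IsSimpleModule.nontrivial (MonoidAlgebra ℂ (Equiv.Perm (Fin n))) S.1),
    fun S => Subrepresentation.ofSubmodule' S.1, fun S => ?_, fun κ _ E => ?_⟩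
  · have h1 := isSimpleModule_iff_isAtom.1 (hs S.1 S.2)
    exact (Subrepresentation.subrepresentationSubmoduleOrderIso (ρ := ρ)).symm.isAtom_iff _ |>.2 h1
  · have hint : DirectSum.IsInternal fun p => (E p).1 :=
      DirectSum.isInternal_submodule_of_iSupIndep_of_iSup_eq_top
        (((sSupIndep_iff _).mp hind).comp E.injective)
        ((E.iSup_comp (g := fun S : s => S.1)).trans (by rw [← sSup_eq_iSup', htop]))
    exact hint

/-- This sorts irreducible summands by isomorphism type; the multiplicities are the sizes of the
fibres. -/
theorem exists_sigma_fin_equiv {α : Type*} {β : Type*} [Finite α] (f : α → β) :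
    ∃ (m : β → ℕ) (E : (Σ b, Fin (m b)) ≃ α), ∀ p, f (E p) = p.1 :=
  ⟨fun b => Nat.card {a // f a = b},
    (Equiv.sigmaCongrRight fun b => (Finite.equivFin {a // f a = b}).symm).trans
      (Equiv.sigmaFiberEquiv f),
    fun p => ((Finite.equivFin {a // f a = p.1}).symm p.2).2⟩

theorem nonempty_equiv_of_isInternal {W : Type*} [AddCommGroup W] [Module ℂ W]
    (ρ : Representation ℂ (Equiv.Perm (Fin n)) W) {κ : Type} [DecidableEq κ]
    {V : κ → Type*} [∀ p, AddCommGroup (V p)] [∀ p, Module ℂ (V p)]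
    (σ : ∀ p, Representation ℂ (Equiv.Perm (Fin n)) (V p)) (B : κ → Subrepresentation ρ)
    (hB : DirectSum.IsInternal fun p => (B p).toSubmodule)
    (ψ : ∀ p, (σ p).Equiv (B p).toRepresentation) :
    Nonempty (ρ.Equiv (Representation.directSum σ)) := by
  let Θ : (⨁ p, V p) ≃ₗ[ℂ] W :=
    (DirectSum.congrLinearEquiv fun p => (ψ p).toLinearEquiv).trans
      (LinearEquiv.ofBijective (DirectSum.coeLinearMap fun p => (B p).toSubmodule) hB)
  have hΘ : ∀ p x, Θ (DirectSum.lof ℂ κ V p x) = (ψ p x : W) := by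
    intro p x
    change DirectSum.coeLinearMap (fun p => (B p).toSubmodule)
      (DirectSum.lmap (fun p => (ψ p).toLinearEquiv.toLinearMap) (DirectSum.lof ℂ κ V p x)) = _
    rw [DirectSum.lmap_lof, DirectSum.coeLinearMap_lof]
    rfl
  refine ⟨(Representation.Equiv.mk Θ fun g => ?_).symm⟩
  refine DirectSum.linearMap_ext _ fun p => LinearMap.ext fun x => ?_
  change Θ (DirectSum.lmap (fun p => σ p g) (DirectSum.lof ℂ κ V p x)) =
    ρ g (Θ (DirectSum.lof ℂ κ V p x))
  rw [DirectSum.lmap_lof, hΘ, hΘ]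
  exact congrArg Subtype.val ((ψ p).toIntertwiningMap.isIntertwining _ _ g x)

/-- Every finite-dimensional representation of the symmetric group is a sum of Specht modules. -/
theorem exists_equiv_spechtSum {W : Type*} [AddCommGroup W] [Module ℂ W] [FiniteDimensional ℂ W]
    (ρ : Representation ℂ (Equiv.Perm (Fin n)) W) :
    ∃ m : Shape n → ℕ, Nonempty (ρ.Equiv (spechtSum m)) := by
  classical
  obtain ⟨s, _, B, hB, hint⟩ := exists_isInternal_isAtom ρ
  have hex : ∀ S, ∃ μ : Shape n, Nonempty ((specht μ).toRepresentation.Equiv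
      (B S).toRepresentation) := fun S =>
    have := isIrreducible_of_isAtom (hB S)
    exists_specht_equiv _
  choose f hf using hex
  obtain ⟨m, E, hE⟩ := exists_sigma_fin_equiv f
  have hψ : ∀ p : Σ μ : Shape n, Fin (m μ), Nonempty ((specht p.1).toRepresentation.Equiv
      (B (E p)).toRepresentation) := fun p => hE p ▸ hf (E p)
  refine ⟨m, ?_⟩
  have hE' := hint _ E
  exact nonempty_equiv_of_isInternal ρ
    (fun p : Σ μ : Shape n, Fin (m μ) => (specht p.1).toRepresentation)
    (fun p => B (E p)) hE' fun p => (hψ p).some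

end Exhaustion

/-! ## The commutant of the symmetric group on a tensor power -/

section SchurWeylDuality

variable {n : ℕ} {V : Type*} [AddCommGroup V] [Module ℂ V]

/-- The symmetrization of `f₁ ⊗ ⋯ ⊗ f_n`. -/
def symT (f : Fin n → Module.End ℂ V) : Module.End ℂ (TPow (Fin n) V) :=
  ∑ σ : Equiv.Perm (Fin n), PiTensorProduct.map fun k => f (σ k)

theorem symT_comp (f : Fin n → Module.End ℂ V) (τ : Equiv.Perm (Fin n)) :
    symT (fun k => f (τ k)) = symT f :=
  Fintype.sum_equiv (Equiv.mulLeft τ) _ _ fun _ => rfl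

theorem slot_mul_map {ι : Type} [DecidableEq ι] (k : ι) (g : Module.End ℂ V)
    (F : ι → Module.End ℂ V) :
    slot k g * PiTensorProduct.map F = PiTensorProduct.map (Function.update F k (g * F k)) := by
  rw [slot, ← PiTensorProduct.map_mul]
  congr 1
  funext i
  by_cases h : i = k
  · subst h; simp
  · simp [h]

theorem tensorRep_mul_symT (g : Module.End ℂ V) (f : Fin n → Module.End ℂ V) :
    tensorRep g * symT f = ∑ l, symT (Function.update f l (g * f l)) := by
  change (∑ k, slot k g) * symT f = _
  simp only [symT, Finset.mul_sum, Finset.sum_mul, slot_mul_map]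
  conv_rhs => rw [Finset.sum_comm]
  refine Finset.sum_congr rfl fun σ _ => ?_
  refine Fintype.sum_equiv σ _ _ fun k => ?_
  congr 1
  funext i
  by_cases h : i = k
  · subst h; simp
  · rw [Function.update_of_ne h, Function.update_of_ne (σ.injective.ne h)]

open Classical in
-- Induction on the number of factors different from 1. Replace one such factor `f j` by 1,
-- symmetrize, and multiply by `tensorRep (f j)`. The terms where `f j` meets a factor 1 all equal
-- `symT f`; in the others it is absorbed by a factor different from 1, so they have fewer such
-- factors than `f`. Solving for `symT f` divides by the number of factors 1, which is positive
-- because position `j` is one of them.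
theorem symT_mem_adjoin (f : Fin n → Module.End ℂ V) :
    symT f ∈ Algebra.adjoin ℂ (Set.range (tensorRep (ι := Fin n) (V := V))) := by
  induction hs : (Finset.univ.filter fun k => f k ≠ 1).card using Nat.strong_induction_on
    generalizing f with
  | _ s ih =>
  by_cases hall : ∀ k, f k = 1
  · have : symT f = ∑ σ : Equiv.Perm (Fin n), 1 := by
      refine Finset.sum_congr rfl fun σ _ => ?_
      simp only [hall]
      exact PiTensorProduct.map_one
    rw [this]
    exact Subalgebra.sum_mem _ fun _ _ => Subalgebra.one_mem _
  · push Not at hall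
    obtain ⟨j, hj⟩ := hall
    set f' := Function.update f j 1 with hf'
    have hlt : (Finset.univ.filter fun k => f' k ≠ 1).card < s := by
      rw [← hs]
      refine Finset.card_lt_card ⟨fun k hk => ?_, fun h => ?_⟩
      · have := (Finset.mem_filter.1 hk).2
        rcases eq_or_ne k j with rfl | hkj
        · simp [hf'] at this
        · simpa [hf', hkj] using this
      · have := h (Finset.mem_filter.2 ⟨Finset.mem_univ j, hj⟩)
        simp [hf'] at this
    have h1 := tensorRep_mul_symT (f j) f'
    rw [← Finset.sum_filter_add_sum_filter_not Finset.univ (fun l => f' l = 1)] at h1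
    have h2 : ∑ l with f' l = 1, symT (Function.update f' l (f j * f' l)) =
        ((Finset.univ.filter fun l => f' l = 1).card : ℂ) • symT f := by
      rw [Finset.sum_congr rfl fun l hl => ?_, Finset.sum_const, Nat.cast_smul_eq_nsmul]
      have hl1 := (Finset.mem_filter.1 hl).2
      -- Putting `f j` at a position `l` where `f'` is 1 gives `f` with the positions `j` and `l`
      -- exchanged.
      rw [hl1, mul_one, ← symT_comp f (Equiv.swap j l)]
      congr 1
      funext k
      rcases eq_or_ne k l with rfl | hkl
      · simp
      rw [Function.update_of_ne hkl]
      rcases eq_or_ne k j with rfl | hkj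
      · rw [hf', Function.update_of_ne hkl.symm] at hl1
        simp [hf', hl1]
      · rw [Equiv.swap_apply_of_ne_of_ne hkj hkl, hf', Function.update_of_ne hkj]
    have h3 : ((Finset.univ.filter fun l => f' l = 1).card : ℂ) ≠ 0 := by
      refine Nat.cast_ne_zero.2 (Finset.card_ne_zero.2 ⟨j, ?_⟩)
      simp [hf']
    rw [h2, ← sub_eq_iff_eq_add] at h1
    rw [← inv_smul_smul₀ h3 (symT f), ← h1]
    refine Subalgebra.smul_mem _ (Subalgebra.sub_mem _ (Subalgebra.mul_mem _
      (Algebra.subset_adjoin (Set.mem_range_self _)) (ih _ hlt f' rfl))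
      (Subalgebra.sum_mem _ fun l hl => ?_)) _
    refine ih _ (lt_of_le_of_lt (Finset.card_le_card fun k hk => ?_) hlt) _ rfl
    have hl1 := (Finset.mem_filter.1 hl).2
    have hk1 := (Finset.mem_filter.1 hk).2
    refine Finset.mem_filter.2 ⟨Finset.mem_univ k, ?_⟩
    rcases eq_or_ne k l with rfl | hkl
    · exact hl1
    · rwa [Function.update_of_ne hkl] at hk1

theorem permT_mul_map_mul (σ : Equiv.Perm (Fin n)) (f : Fin n → Module.End ℂ V) :
    permT σ⁻¹ * PiTensorProduct.map f * permT σ = PiTensorProduct.map fun k => f (σ k) := by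
  apply PiTensorProduct.ext
  apply MultilinearMap.ext
  intro w
  simp only [LinearMap.compMultilinearMap_apply, Module.End.mul_apply, permT_tprod,
    PiTensorProduct.map_tprod]
  congr 1
  funext k
  change f (σ k) (w (σ⁻¹ (σ k))) = f (σ k) (w k)
  rw [← Equiv.Perm.mul_apply, inv_mul_cancel]
  rfl

variable {κ : Type*} [Fintype κ] [DecidableEq κ]

theorem span_map_eq_top (b : Module.Basis κ ℂ V) (a : Module.End ℂ (TPow (Fin n) V)) :
    a ∈ Submodule.span ℂ (Set.range fun f : Fin n → Module.End ℂ V => PiTensorProduct.map f) := by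
  let B : Module.Basis (Fin n → κ) ℂ (TPow (Fin n) V) := Basis.piTensorProduct fun _ => b
  -- Matrix units of `V`; their tensor products are the matrix units of the tensor power.
  let E : κ → κ → Module.End ℂ V := fun p q => (b.coord q).smulRight (b p)
  have hE : ∀ p q s, E p q (b s) = if s = q then b p else 0 := by
    intro p q s
    simp [E, Finsupp.single_apply]
  have key : a = ∑ c, ∑ d, B.repr (a (B c)) d •
      PiTensorProduct.map (fun k => E (d k) (c k)) := by
    refine B.ext fun e => ?_
    simp only [LinearMap.sum_apply, LinearMap.smul_apply]
    rw [Finset.sum_eq_single e]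
    · conv_lhs => rw [← B.sum_repr (a (B e))]
      refine Finset.sum_congr rfl fun d _ => ?_
      congr 1
      rw [Basis.piTensorProduct_apply, Basis.piTensorProduct_apply, PiTensorProduct.map_tprod]
      simp [hE]
    · intro c _ hc
      obtain ⟨k, hk⟩ := Function.ne_iff.1 hc
      refine Finset.sum_eq_zero fun d _ => ?_
      rw [Basis.piTensorProduct_apply _ e, PiTensorProduct.map_tprod]
      have : E (d k) (c k) (b (e k)) = 0 := by rw [hE, if_neg hk.symm]
      rw [(PiTensorProduct.tprod ℂ).map_coord_zero k this, smul_zero]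
    · intro h; exact absurd (Finset.mem_univ e) h
  rw [key]
  exact Submodule.sum_mem _ fun c _ => Submodule.sum_mem _ fun d _ =>
    Submodule.smul_mem _ _ (Submodule.subset_span ⟨_, rfl⟩)

theorem sum_conj_mem_adjoin (b : Module.Basis κ ℂ V) (a : Module.End ℂ (TPow (Fin n) V)) :
    ∑ σ : Equiv.Perm (Fin n), permT σ⁻¹ * a * permT σ ∈
      Algebra.adjoin ℂ (Set.range (tensorRep (ι := Fin n) (V := V))) := by
  induction span_map_eq_top b a using Submodule.span_induction with
  | mem x hx =>
    obtain ⟨f, rfl⟩ := hx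
    simp only [permT_mul_map_mul]
    exact symT_mem_adjoin f
  | zero => simp
  | add x y _ _ hx hy =>
    simp only [mul_add, add_mul, Finset.sum_add_distrib]
    exact Subalgebra.add_mem _ hx hy
  | smul c x _ hx =>
    simp only [mul_smul_comm, smul_mul_assoc, ← Finset.smul_sum]
    exact Subalgebra.smul_mem _ hx c

/-- An endomorphism of a tensor power that commutes with the permutations of the factors is a
polynomial in the operators of the natural action of `End V`. -/
theorem mem_adjoin_of_commute (b : Module.Basis κ ℂ V) (a : Module.End ℂ (TPow (Fin n) V))
    (ha : ∀ σ : Equiv.Perm (Fin n), a * permT σ = permT σ * a) :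
    a ∈ Algebra.adjoin ℂ (Set.range (tensorRep (ι := Fin n) (V := V))) := by
  have h := sum_conj_mem_adjoin b a
  -- An operator that commutes with all permutations is its own average over conjugation, and
  -- averages lie in the algebra by `sum_conj_mem_adjoin`.
  have h1 : ∑ σ : Equiv.Perm (Fin n), permT σ⁻¹ * a * permT σ =
      (Fintype.card (Equiv.Perm (Fin n)) : ℂ) • a := by
    rw [Finset.sum_congr rfl fun σ _ => ?_, Finset.sum_const, Finset.card_univ,
      Nat.cast_smul_eq_nsmul]
    rw [mul_assoc, ha, ← mul_assoc]
    have : permT (V := V) σ⁻¹ * permT σ = 1 := by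
      apply PiTensorProduct.ext
      apply MultilinearMap.ext
      intro w
      simp only [LinearMap.compMultilinearMap_apply, Module.End.mul_apply, permT_tprod,
        Module.End.one_apply]
      congr 1
      funext k
      change w (σ⁻¹ (σ k)) = w k
      rw [← Equiv.Perm.mul_apply, inv_mul_cancel]
      rfl
    rw [this, one_mul]
  rw [h1] at h
  have h2 : (Fintype.card (Equiv.Perm (Fin n)) : ℂ) ≠ 0 := Nat.cast_ne_zero.2 Fintype.card_ne_zero
  rw [← inv_smul_smul₀ h2 a]
  exact Subalgebra.smul_mem _ h _

end SchurWeylDuality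

/-! ### Cyclic submodules over the enveloping algebra. -/

section Orbit

variable {L : Type*} [LieRing L] [LieAlgebra ℂ L] {V W : Type*} [AddCommGroup V] [Module ℂ V]
  [AddCommGroup W] [Module ℂ W]

/-- By the universal property the extension of `ρ` to the enveloping algebra factors through any
subalgebra that contains the image of `L`. -/
theorem LieRep.lift_mem (ρ : LieRep L V) (S : Subalgebra ℂ (Module.End ℂ V))
    (h : ∀ x, ρ x ∈ S) (u : UniversalEnvelopingAlgebra ℂ L) :
    UniversalEnvelopingAlgebra.lift ℂ ρ u ∈ S := by
  let ρ' : L →ₗ⁅ℂ⁆ S :=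
    { toFun := fun x => ⟨ρ x, h x⟩
      map_add' := fun x y => Subtype.ext (map_add ρ x y)
      map_smul' := fun c x => Subtype.ext (map_smul ρ c x)
      map_lie' := fun {x y} => Subtype.ext (LieHom.map_lie ρ x y) }
  have : S.val.comp (UniversalEnvelopingAlgebra.lift ℂ ρ') =
      UniversalEnvelopingAlgebra.lift ℂ ρ := by
    apply UniversalEnvelopingAlgebra.hom_ext
    ext x : 1
    change S.val (UniversalEnvelopingAlgebra.lift ℂ ρ' (UniversalEnvelopingAlgebra.ι ℂ x)) =
      UniversalEnvelopingAlgebra.lift ℂ ρ (UniversalEnvelopingAlgebra.ι ℂ x)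
    rw [UniversalEnvelopingAlgebra.lift_ι_apply, UniversalEnvelopingAlgebra.lift_ι_apply]
    rfl
  rw [← this]
  exact (UniversalEnvelopingAlgebra.lift ℂ ρ' u).2

theorem LieRep.mem_orbit_top (ρ : LieRep L V) (v w : V) :
    w ∈ ρ.orbit ⊤ v ↔ ∃ a ∈ Algebra.adjoin ℂ (Set.range ρ), a v = w := by
  constructor
  · rintro ⟨u, -, rfl⟩
    exact ⟨_, ρ.lift_mem _ (fun x => Algebra.subset_adjoin (Set.mem_range_self x)) u, rfl⟩
  · rintro ⟨a, ha, rfl⟩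
    have : Algebra.adjoin ℂ (Set.range ρ) ≤ (UniversalEnvelopingAlgebra.lift ℂ ρ).range := by
      refine Algebra.adjoin_le ?_
      rintro _ ⟨x, rfl⟩
      exact ⟨_, UniversalEnvelopingAlgebra.lift_ι_apply ℂ ρ x⟩
    obtain ⟨u, rfl⟩ := this ha
    exact ⟨u, trivial, rfl⟩

/-- The orbit of a vector lies in every invariant subspace that contains the vector. -/
theorem LieRep.orbit_le (ρ : LieRep L V) (S : Submodule ℂ (UniversalEnvelopingAlgebra ℂ L))
    {v : V} {P : Submodule ℂ V} (hP : ∀ x, ∀ w ∈ P, ρ x w ∈ P) (hv : v ∈ P) :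
    ρ.orbit S v ≤ P := by
  rintro _ ⟨u, -, rfl⟩
  let A : Subalgebra ℂ (Module.End ℂ V) :=
    { carrier := {a | ∀ w ∈ P, a w ∈ P}
      mul_mem' := fun ha hb w hw => ha _ (hb w hw)
      add_mem' := fun ha hb w hw => P.add_mem (ha w hw) (hb w hw)
      algebraMap_mem' := fun c w hw => P.smul_mem c hw }
  exact ρ.lift_mem A hP u v hv

theorem LieRep.map_orbit_top (ρ : LieRep L V) (σ : LieRep L W) (f : V →ₗ[ℂ] W)
    (hf : ∀ x v, f (ρ x v) = σ x (f v)) (v : V) :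
    (ρ.orbit ⊤ v).map f = σ.orbit ⊤ (f v) := by
  have key : ∀ u w, f (UniversalEnvelopingAlgebra.lift ℂ ρ u w) =
      UniversalEnvelopingAlgebra.lift ℂ σ u (f w) := by
    intro u
    -- The pairs of operators intertwined by `f` form a subalgebra. It contains all `(ρ x, σ x)`, so
    -- `ρ` and `σ` lift to it together.
    let A : Subalgebra ℂ (Module.End ℂ V × Module.End ℂ W) :=
      { carrier := {a | ∀ w, f (a.1 w) = a.2 (f w)}
        mul_mem' := fun {a b} ha hb w => by
          change f (a.1 (b.1 w)) = a.2 (b.2 (f w))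
          rw [ha, hb]
        add_mem' := fun {a b} ha hb w => by
          change f (a.1 w + b.1 w) = a.2 (f w) + b.2 (f w)
          rw [map_add, ha, hb]
        algebraMap_mem' := fun c w => map_smul f c w }
    let τ : L →ₗ⁅ℂ⁆ A :=
      { toFun := fun x => ⟨(ρ x, σ x), hf x⟩
        map_add' := fun x y => Subtype.ext (Prod.ext (map_add ρ x y) (map_add σ x y))
        map_smul' := fun c x => Subtype.ext (Prod.ext (map_smul ρ c x) (map_smul σ c x))
        map_lie' := fun {x y} => Subtype.ext
          (Prod.ext (LieHom.map_lie ρ x y) (LieHom.map_lie σ x y)) }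
    have h1 : (AlgHom.fst ℂ _ _).comp (A.val.comp (UniversalEnvelopingAlgebra.lift ℂ τ)) =
        UniversalEnvelopingAlgebra.lift ℂ ρ := by
      apply UniversalEnvelopingAlgebra.hom_ext
      ext x : 1
      change (UniversalEnvelopingAlgebra.lift ℂ τ (UniversalEnvelopingAlgebra.ι ℂ x)).1.1 =
        UniversalEnvelopingAlgebra.lift ℂ ρ (UniversalEnvelopingAlgebra.ι ℂ x)
      rw [UniversalEnvelopingAlgebra.lift_ι_apply, UniversalEnvelopingAlgebra.lift_ι_apply]
      rfl
    have h2 : (AlgHom.snd ℂ _ _).comp (A.val.comp (UniversalEnvelopingAlgebra.lift ℂ τ)) =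
        UniversalEnvelopingAlgebra.lift ℂ σ := by
      apply UniversalEnvelopingAlgebra.hom_ext
      ext x : 1
      change (UniversalEnvelopingAlgebra.lift ℂ τ (UniversalEnvelopingAlgebra.ι ℂ x)).1.2 =
        UniversalEnvelopingAlgebra.lift ℂ σ (UniversalEnvelopingAlgebra.ι ℂ x)
      rw [UniversalEnvelopingAlgebra.lift_ι_apply, UniversalEnvelopingAlgebra.lift_ι_apply]
      rfl
    intro w
    rw [← h1, ← h2]
    exact (UniversalEnvelopingAlgebra.lift ℂ τ u).2 w
  refine le_antisymm ?_ ?_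
  · rintro _ ⟨_, ⟨u, -, rfl⟩, rfl⟩
    exact ⟨u, trivial, (key u v).symm⟩
  · rintro _ ⟨u, -, rfl⟩
    exact ⟨_, ⟨u, trivial, rfl⟩, key u v⟩

end Orbit

/-! ## Coordinates on `V_r^{⊗ n} ⊗ M` -/

section Coordinates

variable {r n : ℕ} {M M' : Type*} [AddCommGroup M] [Module ℂ M] [AddCommGroup M'] [Module ℂ M']

/-- The standard basis of `V_r`. -/
def vrBasis (r : ℕ) : Module.Basis (Fin r) ℂ (Vr r) := Pi.basisFun ℂ (Fin r)

theorem vrBasis_apply (i j : Fin r) : vrBasis r i j = if j = i then 1 else 0 := by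
  change (Pi.basisFun ℂ (Fin r) i : Fin r → ℂ) j = _
  rw [Pi.basisFun_apply, Pi.single_apply]

/-- The basis of a tensor power of `V_r`. -/
def tpBasis (r : ℕ) (ι : Type) [Fintype ι] : Module.Basis (ι → Fin r) ℂ (TPow ι (Vr r)) :=
  Basis.piTensorProduct fun _ => vrBasis r

theorem tpBasis_apply {ι : Type} [Fintype ι] (c : ι → Fin r) :
    tpBasis r ι c = PiTensorProduct.tprod ℂ fun k => vrBasis r (c k) :=
  Basis.piTensorProduct_apply _ _

theorem tensorPermRep_basis (σ : Equiv.Perm (Fin n)) (c : Fin n → Fin r) :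
    tensorPermRep r n σ (tpBasis r (Fin n) c) = tpBasis r (Fin n) fun k => c (σ⁻¹ k) := by
  rw [tpBasis_apply, tpBasis_apply]
  exact permT_tprod σ _

/-- The coefficient at a basis vector of the first factor. -/
def tcoeff (c : Fin n → Fin r) : (TPow (Fin n) (Vr r)) ⊗[ℂ] M →ₗ[ℂ] M :=
  (TensorProduct.lid ℂ M).toLinearMap ∘ₗ ((tpBasis r (Fin n)).coord c).rTensor M

theorem tcoeff_tmul (c : Fin n → Fin r) (w : TPow (Fin n) (Vr r)) (m : M) :
    tcoeff c (w ⊗ₜ[ℂ] m) = (tpBasis r (Fin n)).repr w c • m := by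
  simp [tcoeff]

theorem sum_tcoeff (x : (TPow (Fin n) (Vr r)) ⊗[ℂ] M) :
    ∑ c, tpBasis r (Fin n) c ⊗ₜ[ℂ] tcoeff c x = x := by
  induction x using TensorProduct.induction_on with
  | zero => simp
  | tmul w m =>
    simp only [tcoeff_tmul, ← TensorProduct.smul_tmul, ← TensorProduct.sum_tmul]
    rw [(tpBasis r (Fin n)).sum_repr]
  | add x y hx hy =>
    simp only [map_add, TensorProduct.tmul_add, Finset.sum_add_distrib, hx, hy]

theorem eq_zero_of_tcoeff {x : (TPow (Fin n) (Vr r)) ⊗[ℂ] M} (h : ∀ c, tcoeff c x = 0) :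
    x = 0 := by
  rw [← sum_tcoeff x]
  simp [h]

theorem tpBasis_repr_perm (σ : Equiv.Perm (Fin n)) (w : TPow (Fin n) (Vr r)) (c : Fin n → Fin r) :
    (tpBasis r (Fin n)).repr (tensorPermRep r n σ w) c =
      (tpBasis r (Fin n)).repr w fun k => c (σ k) := by
  have : (tpBasis r (Fin n)).coord c ∘ₗ tensorPermRep r n σ =
      (tpBasis r (Fin n)).coord fun k => c (σ k) := by
    refine (tpBasis r (Fin n)).ext fun d => ?_
    rw [LinearMap.comp_apply, tensorPermRep_basis, Module.Basis.coord_apply,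
      Module.Basis.coord_apply, Module.Basis.repr_self, Module.Basis.repr_self,
      Finsupp.single_apply, Finsupp.single_apply]
    refine if_congr ⟨fun h => ?_, fun h => ?_⟩ rfl rfl
    · funext k
      rw [← h]
      change d k = d ((σ⁻¹ * σ) k)
      rw [inv_mul_cancel]
      rfl
    · funext k
      rw [h]
      change c ((σ * σ⁻¹) k) = c k
      rw [mul_inv_cancel]
      rfl
  exact LinearMap.congr_fun this w

theorem tcoeff_perm (μ : Representation ℂ (Equiv.Perm (Fin n)) M) (σ : Equiv.Perm (Fin n))
    (c : Fin n → Fin r) (x : (TPow (Fin n) (Vr r)) ⊗[ℂ] M) :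
    tcoeff c ((tensorPermRep r n).tprod μ σ x) = μ σ (tcoeff (fun k => c (σ k)) x) := by
  induction x using TensorProduct.induction_on with
  | zero => simp
  | tmul w m =>
    rw [Representation.tprod_apply, TensorProduct.map_tmul, tcoeff_tmul, tcoeff_tmul,
      tpBasis_repr_perm, map_smul]
  | add x y hx hy => rw [map_add, map_add, hx, hy, map_add, map_add]

/-- The sum over the symmetric group of the translates of a tensor. -/
def permSum (μ : Representation ℂ (Equiv.Perm (Fin n)) M) :
    Module.End ℂ ((TPow (Fin n) (Vr r)) ⊗[ℂ] M) :=
  ∑ σ, (tensorPermRep r n).tprod μ σ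

theorem permSum_apply (μ : Representation ℂ (Equiv.Perm (Fin n)) M)
    (x : (TPow (Fin n) (Vr r)) ⊗[ℂ] M) :
    permSum μ x = ∑ σ, (tensorPermRep r n).tprod μ σ x := by
  simp [permSum]

theorem permSum_mem (μ : Representation ℂ (Equiv.Perm (Fin n)) M)
    (x : (TPow (Fin n) (Vr r)) ⊗[ℂ] M) : permSum μ x ∈ SWInv r μ := by
  intro τ
  rw [permSum_apply, map_sum]
  refine Fintype.sum_equiv (Equiv.mulLeft τ) _ _ fun σ => ?_
  rw [Equiv.coe_mulLeft, map_mul, Module.End.mul_apply]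

theorem permSum_perm (μ : Representation ℂ (Equiv.Perm (Fin n)) M) (τ : Equiv.Perm (Fin n))
    (x : (TPow (Fin n) (Vr r)) ⊗[ℂ] M) :
    permSum μ ((tensorPermRep r n).tprod μ τ x) = permSum μ x := by
  rw [permSum_apply, permSum_apply]
  refine Fintype.sum_equiv (Equiv.mulRight τ) _ _ fun σ => ?_
  rw [Equiv.coe_mulRight, map_mul, Module.End.mul_apply]

theorem permSum_of_mem (μ : Representation ℂ (Equiv.Perm (Fin n)) M)
    {x : (TPow (Fin n) (Vr r)) ⊗[ℂ] M} (hx : x ∈ SWInv r μ) :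
    permSum μ x = (Fintype.card (Equiv.Perm (Fin n)) : ℂ) • x := by
  rw [permSum_apply, Finset.sum_congr rfl fun σ _ => hx σ, Finset.sum_const, Finset.card_univ,
    Nat.cast_smul_eq_nsmul]

theorem card_perm_ne_zero : (Fintype.card (Equiv.Perm (Fin n)) : ℂ) ≠ 0 :=
  Nat.cast_ne_zero.2 Fintype.card_ne_zero

end Coordinates

/-! ## The module `(V_r^{⊗ n} ⊗ π_λ)^{Σ_n}` -/

section SpechtToGl

variable {r n : ℕ} {μ : YoungDiagram}

theorem coeff_polytabloid_conj (T : Cells μ ≃ Fin n) (s : Tabloid n) :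
    starRingEnd ℂ ((polytabloid μ T).coeff s) = (polytabloid μ T).coeff s := by
  classical
  rw [polytabloid, MonoidAlgebra.coeff_sum, Finset.sum_apply', map_sum]
  refine Finset.sum_congr rfl fun σ _ => ?_
  rw [MonoidAlgebra.coeff_smul_apply, MonoidAlgebra.coeff_single, Finsupp.single_apply]
  split_ifs <;> simp

theorem tabForm_conj {x y : MonoidAlgebra ℂ (Tabloid n)}
    (hx : ∀ s, starRingEnd ℂ (x.coeff s) = x.coeff s)
    (hy : ∀ s, starRingEnd ℂ (y.coeff s) = y.coeff s) :
    starRingEnd ℂ (tabForm x y) = tabForm x y := by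
  rw [tabForm_apply, Finsupp.sum, map_sum]
  exact Finset.sum_congr rfl fun s _ => by rw [map_mul, hy, hx, hx]

theorem coeff_perm_polytabloid_conj (T : Cells μ ≃ Fin n) (σ : Equiv.Perm (Fin n))
    (s : Tabloid n) : starRingEnd ℂ ((tabloidRep n σ (polytabloid μ T)).coeff s) =
      (tabloidRep n σ (polytabloid μ T)).coeff s := by
  rw [tabloidRep_polytabloid, coeff_polytabloid_conj]

/-- The coefficient of the translate by `σ` in the projection to the Specht module. -/
def spechtCoeff (T : Cells μ ≃ Fin n) (σ : Equiv.Perm (Fin n)) : ℂ :=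
  tabForm (polytabloid μ T) (tabloidRep n σ (polytabloid μ T))

/-- The element `∑ σ, ⟨e_T, σ e_T⟩ σ` of the group algebra, acting on a representation. -/
def spechtOp {W : Type*} [AddCommGroup W] [Module ℂ W]
    (ρ : Representation ℂ (Equiv.Perm (Fin n)) W) (T : Cells μ ≃ Fin n) : Module.End ℂ W :=
  ∑ σ, spechtCoeff T σ • ρ σ

theorem spechtOp_apply {W : Type*} [AddCommGroup W] [Module ℂ W]
    (ρ : Representation ℂ (Equiv.Perm (Fin n)) W) (T : Cells μ ≃ Fin n) (w : W) :
    spechtOp ρ T w = ∑ σ, spechtCoeff T σ • ρ σ w := by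
  simp [spechtOp]

/-- The coefficient `⟨e_T, σ e_T⟩` changes by the sign of `τ` when `σ` is multiplied on the left by
a column permutation `τ`. The result is therefore alternating, and by the rank one property it is a
multiple of `e_T`. The multiple is nonzero because the pairing of the result with `e_T` is `∑ σ,
|⟨e_T, σ e_T⟩|²`, whose term at `σ = 1` is positive. -/
theorem spechtOp_polytabloid (T : Cells μ ≃ Fin n) :
    ∃ a : ℂ, a ≠ 0 ∧ spechtOp (tabloidRep n) T (polytabloid μ T) = a • polytabloid μ T := by
  set e := polytabloid μ T with he
  set x := spechtOp (tabloidRep n) T e with hx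
  have hxs : x ∈ tabloidSpan n μ := by
    rw [hx, spechtOp_apply]
    refine Submodule.sum_mem _ fun σ _ => Submodule.smul_mem _ _ ?_
    rw [he, tabloidRep_polytabloid]
    exact Submodule.sum_mem _ fun σ _ =>
      Submodule.smul_mem _ _ (Submodule.subset_span ⟨_, by rw [tabloid_colPerm]⟩)
  have halt : ∀ τ ∈ colGroup μ, tabloidRep n (T.permCongr τ) x =
      ((Equiv.Perm.sign τ : ℤ) : ℂ) • x := by
    intro τ hτ
    rw [hx, spechtOp_apply, map_sum, Finset.smul_sum]
    refine Fintype.sum_equiv (Equiv.mulLeft (T.permCongr τ)) _ _ fun σ => ?_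
    rw [Equiv.coe_mulLeft, map_smul, map_mul, Module.End.mul_apply, smul_smul]
    congr 1
    rw [spechtCoeff, spechtCoeff, map_mul, Module.End.mul_apply]
    have h1 := tabForm_perm (T.permCongr τ)⁻¹ (polytabloid μ T)
      (tabloidRep n σ (polytabloid μ T))
    rw [inv_inv, ← permCongr_inv', perm_polytabloid T (inv_mem_colGroup hτ), tabForm_smul_left,
      Equiv.Perm.sign_inv] at h1
    rw [← h1]
    simp only [map_intCast]
    rw [← mul_assoc, sign_mul_self_complex, one_mul]
  obtain ⟨b, hb⟩ := Submodule.mem_span_singleton.1 (colSym_mem_span_polytabloid T hxs)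
  rw [colSym_of_alternating _ T x halt] at hb
  have hxe : x = (((colGroup μ).card : ℂ)⁻¹ * b) • e := by
    rw [mul_smul, he, hb, inv_smul_smul₀ card_colGroup_ne_zero]
  refine ⟨_, fun h0 => ?_, hxe⟩
  rw [h0, zero_smul] at hxe
  have h2 : tabForm e x = ((∑ σ, ‖spechtCoeff T σ‖ ^ 2 : ℝ) : ℂ) := by
    rw [hx, spechtOp_apply, map_sum, Complex.ofReal_sum]
    refine Finset.sum_congr rfl fun σ _ => ?_
    rw [map_smul, smul_eq_mul]
    change spechtCoeff T σ * spechtCoeff T σ = _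
    have h3 : starRingEnd ℂ (spechtCoeff T σ) = spechtCoeff T σ :=
      tabForm_conj (coeff_polytabloid_conj T) (coeff_perm_polytabloid_conj T σ)
    nth_rewrite 1 [← h3]
    rw [Complex.conj_mul']
    norm_cast
  rw [hxe, map_zero, eq_comm, Complex.ofReal_eq_zero,
    Finset.sum_eq_zero_iff_of_nonneg fun _ _ => by positivity] at h2
  have h3 := h2 1 (Finset.mem_univ _)
  rw [sq_eq_zero_iff, norm_eq_zero, spechtCoeff, map_one] at h3
  exact polytabloid_ne_zero T (eq_zero_of_tabForm_self h3)

/-- `w ⊗ s ↦ ⟨x, s⟩ w` on `V_r^{⊗ n} ⊗ π_λ`. -/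
def spechtEval (r : ℕ) (μ : Shape n) (x : MonoidAlgebra ℂ (Tabloid n)) :
    (TPow (Fin n) (Vr r)) ⊗[ℂ] (specht μ).toSubmodule →ₗ[ℂ] TPow (Fin n) (Vr r) :=
  (TensorProduct.rid ℂ _).toLinearMap ∘ₗ
    (tabForm x ∘ₗ (specht μ).toSubmodule.subtype).lTensor _

theorem spechtEval_tmul (μ : Shape n) (x : MonoidAlgebra ℂ (Tabloid n))
    (w : TPow (Fin n) (Vr r)) (s : (specht μ).toSubmodule) :
    spechtEval r μ x (w ⊗ₜ[ℂ] s) = tabForm x s • w := by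
  simp [spechtEval]

theorem spechtEval_leftGl (μ : Shape n) (x : MonoidAlgebra ℂ (Tabloid n)) (A : gl r)
    (y : (TPow (Fin n) (Vr r)) ⊗[ℂ] (specht μ).toSubmodule) :
    spechtEval r μ x (leftGlRep r n _ A y) = tensorGlRep r (Fin n) A (spechtEval r μ x y) := by
  induction y using TensorProduct.induction_on with
  | zero => simp
  | tmul w s =>
    change spechtEval r μ x ((tensorGlRep r (Fin n) A w) ⊗ₜ[ℂ] s) = _
    rw [spechtEval_tmul, spechtEval_tmul, map_smul]
  | add y z hy hz => simp only [map_add, hy, hz]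

theorem spechtEval_perm (μ : Shape n) (x : MonoidAlgebra ℂ (Tabloid n))
    (σ : Equiv.Perm (Fin n)) (y : (TPow (Fin n) (Vr r)) ⊗[ℂ] (specht μ).toSubmodule) :
    spechtEval r μ (tabloidRep n σ x)
      ((tensorPermRep r n).tprod (specht μ).toRepresentation σ y) =
        tensorPermRep r n σ (spechtEval r μ x y) := by
  induction y using TensorProduct.induction_on with
  | zero => simp
  | tmul w s =>
    rw [Representation.tprod_apply, TensorProduct.map_tmul, spechtEval_tmul, spechtEval_tmul,
      map_smul, tabForm_perm]
    congr 2
    change tabloidRep n σ⁻¹ (tabloidRep n σ s) = s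
    rw [← Module.End.mul_apply, ← map_mul, inv_mul_cancel, map_one]
    rfl
  | add y z hy hz => simp only [map_add, hy, hz]

theorem tabForm_tcoeff (μ : Shape n) (x : MonoidAlgebra ℂ (Tabloid n)) (c : Fin n → Fin r)
    (y : (TPow (Fin n) (Vr r)) ⊗[ℂ] (specht μ).toSubmodule) :
    tabForm x (tcoeff c y : (specht μ).toSubmodule) =
      (tpBasis r (Fin n)).repr (spechtEval r μ x y) c := by
  induction y using TensorProduct.induction_on with
  | zero => simp
  | tmul w s =>
    rw [tcoeff_tmul, spechtEval_tmul, Submodule.coe_smul, map_smul, map_smul]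
    exact mul_comm _ _
  | add y z hy hz =>
    rw [map_add, map_add, map_add, Submodule.coe_add, map_add, hy, hz]
    rfl

/-- Invariance carries the vanishing from `T` to every numbering. Each coefficient of `y` is then
orthogonal to the whole Specht module, in which it lies. -/
theorem eq_zero_of_spechtEval (μ : Shape n) (T : Cells μ.1 ≃ Fin n)
    {y : (TPow (Fin n) (Vr r)) ⊗[ℂ] (specht μ).toSubmodule}
    (hy : y ∈ SWInv r (specht μ).toRepresentation)
    (h : spechtEval r μ (polytabloid μ.1 T) y = 0) : y = 0 := by
  have h1 : ∀ T' : Cells μ.1 ≃ Fin n, spechtEval r μ (polytabloid μ.1 T') y = 0 := by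
    intro T'
    have := spechtEval_perm μ (polytabloid μ.1 T) (T.symm.trans T') y
    rwa [hy, tabloidRep_polytabloid, ← Equiv.trans_assoc, Equiv.self_trans_symm,
      Equiv.refl_trans, h, map_zero] at this
  refine eq_zero_of_tcoeff fun c => ?_
  have h2 : ∀ x ∈ (specht μ).toSubmodule,
      tabForm x (tcoeff c y : (specht μ).toSubmodule) = 0 := by
    refine tabForm_eq_zero_of_specht μ fun T' => ?_
    rw [tabForm_tcoeff, h1]
    simp
  exact Subtype.ext (eq_zero_of_tabForm_self (h2 _ (tcoeff c y).2))

/-- With `exists_permSum_eq`, this identifies the embedded copy of the invariants with the image of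
`spechtOp`. -/
theorem spechtEval_permSum (μ : Shape n) (T : Cells μ.1 ≃ Fin n) (w : TPow (Fin n) (Vr r)) :
    spechtEval r μ (polytabloid μ.1 T) (permSum (specht μ).toRepresentation
      (w ⊗ₜ[ℂ] (⟨_, polytabloid_mem_specht μ T⟩ : (specht μ).toSubmodule))) =
        spechtOp (tensorPermRep r n) T w := by
  rw [permSum_apply, map_sum, spechtOp_apply]
  refine Finset.sum_congr rfl fun σ _ => ?_
  rw [Representation.tprod_apply, TensorProduct.map_tmul, spechtEval_tmul]
  rfl

/-- All polytabloids are translates of one, and the symmetrization absorbs a translation, which is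
moved to the first factor. -/
theorem exists_permSum_eq (μ : Shape n) (T : Cells μ.1 ≃ Fin n)
    (y : (TPow (Fin n) (Vr r)) ⊗[ℂ] (specht μ).toSubmodule) :
    ∃ w : TPow (Fin n) (Vr r), permSum (specht μ).toRepresentation y =
      permSum (specht μ).toRepresentation
        (w ⊗ₜ[ℂ] (⟨_, polytabloid_mem_specht μ T⟩ : (specht μ).toSubmodule)) := by
  induction y using TensorProduct.induction_on with
  | zero => exact ⟨0, by simp⟩
  | tmul w s =>
    obtain ⟨s, hs⟩ := s
    induction hs using Submodule.span_induction generalizing w with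
    | mem s hs =>
      obtain ⟨T', rfl⟩ := hs
      refine ⟨tensorPermRep r n (T'.symm.trans T) w, ?_⟩
      rw [← permSum_perm _ (T'.symm.trans T), Representation.tprod_apply,
        TensorProduct.map_tmul]
      congr 2
      refine Subtype.ext ?_
      change tabloidRep n _ (polytabloid μ.1 T') = polytabloid μ.1 T
      rw [tabloidRep_polytabloid, ← Equiv.trans_assoc, Equiv.self_trans_symm, Equiv.refl_trans]
    | zero =>
      refine ⟨0, ?_⟩
      change permSum _ (w ⊗ₜ[ℂ] (0 : (specht μ).toSubmodule)) = _
      simp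
    | add a b ha hb iha ihb =>
      obtain ⟨w1, h1⟩ := iha w
      obtain ⟨w2, h2⟩ := ihb w
      refine ⟨w1 + w2, ?_⟩
      rw [TensorProduct.add_tmul, map_add, ← h1, ← h2, ← map_add, ← TensorProduct.tmul_add]
      rfl
    | smul a s hs ih =>
      obtain ⟨w1, h1⟩ := ih (a • w)
      refine ⟨w1, ?_⟩
      rw [← h1, TensorProduct.smul_tmul]
      rfl
  | add y z hy hz =>
    obtain ⟨w1, h1⟩ := hy
    obtain ⟨w2, h2⟩ := hz
    exact ⟨w1 + w2, by rw [map_add, h1, h2, TensorProduct.add_tmul, map_add]⟩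

/-- A basis tensor as a row tabloid. -/
def tensorToTabloid (r n : ℕ) : TPow (Fin n) (Vr r) →ₗ[ℂ] MonoidAlgebra ℂ (Tabloid n) :=
  (tpBasis r (Fin n)).constr ℂ fun c =>
    MonoidAlgebra.single (Tabloid.mk fun k => (c k : ℕ)) 1

theorem tensorToTabloid_basis (c : Fin n → Fin r) :
    tensorToTabloid r n (tpBasis r (Fin n) c) =
      MonoidAlgebra.single (Tabloid.mk fun k => (c k : ℕ)) 1 :=
  Module.Basis.constr_basis _ _ _ _

theorem tensorToTabloid_perm (σ : Equiv.Perm (Fin n)) (w : TPow (Fin n) (Vr r)) :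
    tensorToTabloid r n (tensorPermRep r n σ w) = tabloidRep n σ (tensorToTabloid r n w) := by
  have : tensorToTabloid r n ∘ₗ tensorPermRep r n σ = tabloidRep n σ ∘ₗ tensorToTabloid r n := by
    refine (tpBasis r (Fin n)).ext fun c => ?_
    rw [LinearMap.comp_apply, LinearMap.comp_apply, tensorPermRep_basis, tensorToTabloid_basis,
      tensorToTabloid_basis, tabloidRep_single]
    rfl
  exact LinearMap.congr_fun this w

theorem tensorToTabloid_injective : Function.Injective (tensorToTabloid r n) := by
  have h : (MonoidAlgebra.coeffLinearEquiv ℂ).toLinearMap ∘ₗ tensorToTabloid r n =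
      Finsupp.lmapDomain ℂ ℂ (fun c : Fin n → Fin r => Tabloid.mk fun k => (c k : ℕ)) ∘ₗ
        (tpBasis r (Fin n)).repr.toLinearMap := by
    refine (tpBasis r (Fin n)).ext fun c => ?_
    simp only [LinearMap.comp_apply, LinearEquiv.coe_coe]
    rw [tensorToTabloid_basis, Module.Basis.repr_self, Finsupp.lmapDomain_apply,
      Finsupp.mapDomain_single]
    rfl
  have hinj : Function.Injective fun c : Fin n → Fin r =>
      Tabloid.mk fun k => (c k : ℕ) := fun c d h =>
    funext fun k => Fin.ext (congrFun h k)
  have h2 : Function.Injective ((MonoidAlgebra.coeffLinearEquiv ℂ).toLinearMap ∘ₗ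
      tensorToTabloid r n) := by
    rw [h]
    exact (Finsupp.mapDomain_injective hinj).comp (tpBasis r (Fin n)).repr.injective
  exact fun x y hxy => h2 (congrArg (MonoidAlgebra.coeffLinearEquiv ℂ) hxy)

/-- The highest weight vector with the factors numbered by `T`. -/
def hwTensor (r : ℕ) (T : Cells μ ≃ Fin n) : TPow (Fin n) (Vr r) :=
  ∑ σ ∈ colGroup μ, ((Equiv.Perm.sign σ : ℤ) : ℂ) •
    PiTensorProduct.tprod ℂ fun k => stdVec r (σ (T.symm k)).1.1

theorem row_lt_of_rowLen_eq_zero (h : μ.rowLen r = 0) (c : Cells μ) : c.1.1 < r := by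
  have h1 := YoungDiagram.mem_iff_lt_rowLen.1 ((YoungDiagram.mem_cells c.1).1 c.2)
  by_contra h2
  have h3 := μ.rowLen_anti r c.1.1 (not_lt.1 h2)
  exact absurd h1 (by rw [h, Nat.le_zero] at h3; rw [h3]; exact Nat.not_lt_zero _)

/-- The condition on `μ` keeps every row index below `r`; a larger index would make `stdVec` zero.
-/
theorem tensorToTabloid_hwTensor (h : μ.rowLen r = 0) (T : Cells μ ≃ Fin n) :
    tensorToTabloid r n (hwTensor r T) = polytabloid μ T := by
  rw [hwTensor, map_sum, polytabloid]
  refine Finset.sum_congr rfl fun σ _ => ?_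
  rw [map_smul]
  congr 1
  have := tensorToTabloid_basis (r := r)
    fun k : Fin n => ⟨(σ (T.symm k)).1.1, row_lt_of_rowLen_eq_zero h _⟩
  rw [tpBasis_apply] at this
  rw [← this]
  congr 2
  funext k
  funext i
  rw [vrBasis_apply, stdVec]
  exact if_congr ⟨fun h => Fin.ext h, fun h => congrArg Fin.val h⟩ rfl rfl

/-- The equivariant map `x ↦ ∑ σ, x(σ{T}) σ w` from tabloids to tensors. -/
def tabloidToTensor (T : Cells μ ≃ Fin n) (w : TPow (Fin n) (Vr r)) :
    MonoidAlgebra ℂ (Tabloid n) →ₗ[ℂ] TPow (Fin n) (Vr r) :=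
  ∑ σ, ((Finsupp.lapply (Tabloid.mk fun k => rowTabloid T (σ⁻¹ k))).comp
    (MonoidAlgebra.coeffLinearEquiv ℂ).toLinearMap).smulRight (tensorPermRep r n σ w)

theorem tabloidToTensor_apply (T : Cells μ ≃ Fin n) (w : TPow (Fin n) (Vr r))
    (x : MonoidAlgebra ℂ (Tabloid n)) : tabloidToTensor T w x =
      ∑ σ, x.coeff (Tabloid.mk fun k => rowTabloid T (σ⁻¹ k)) • tensorPermRep r n σ w := by
  simp [tabloidToTensor, LinearMap.sum_apply]

theorem tabloidToTensor_perm (T : Cells μ ≃ Fin n) (w : TPow (Fin n) (Vr r))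
    (τ : Equiv.Perm (Fin n)) (x : MonoidAlgebra ℂ (Tabloid n)) :
    tabloidToTensor T w (tabloidRep n τ x) = tensorPermRep r n τ (tabloidToTensor T w x) := by
  rw [tabloidToTensor_apply, tabloidToTensor_apply, map_sum]
  symm
  refine Fintype.sum_equiv (Equiv.mulLeft τ) _ _ fun σ => ?_
  rw [Equiv.coe_mulLeft, map_smul, map_mul, Module.End.mul_apply, tabloidRep,
    Representation.coeff_ofMulAction]
  congr 2
  funext k
  change rowTabloid T (σ⁻¹ k) = rowTabloid T ((τ * σ)⁻¹ (τ⁻¹⁻¹ k))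
  rw [mul_inv_rev, Equiv.Perm.mul_apply, inv_inv, ← Equiv.Perm.mul_apply τ⁻¹ τ, inv_mul_cancel]
  rfl

/-- Writing the second polytabloid in `⟨e_T, σ e_T⟩` as an antisymmetrized tabloid turns the
coefficient into a signed sum of entries of `e_T`. Reindexing moves that signed sum onto `w`, which
is why the map is built from the antisymmetrization of `w`. -/
theorem tabloidToTensor_polytabloid (T : Cells μ ≃ Fin n) (w : TPow (Fin n) (Vr r)) :
    tabloidToTensor T (colSym (tensorPermRep r n) T w) (polytabloid μ T) =
      spechtOp (tensorPermRep r n) T w := by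
  rw [tabloidToTensor_apply, spechtOp_apply]
  have h1 : ∀ σ, spechtCoeff T σ = ∑ π ∈ colGroup μ, ((Equiv.Perm.sign π : ℤ) : ℂ) *
      (polytabloid μ T).coeff
        (Tabloid.mk fun k => rowTabloid T ((σ * T.permCongr π)⁻¹ k)) := by
    intro σ
    rw [spechtCoeff]
    nth_rewrite 2 [polytabloid_eq_colSym]
    rw [colSym_apply, map_sum, map_sum]
    refine Finset.sum_congr rfl fun π _ => ?_
    rw [map_smul, map_smul, ← Module.End.mul_apply, ← map_mul, tabloidRep_single, tabForm_single,
      coeff_polytabloid_conj]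
    rfl
  simp only [h1, colSym_apply, map_sum, Finset.smul_sum, Finset.sum_smul]
  rw [Finset.sum_comm]
  conv_rhs => rw [Finset.sum_comm]
  refine Finset.sum_bij' (fun σ _ => σ⁻¹) (fun σ _ => σ⁻¹) (fun _ h => inv_mem_colGroup h)
    (fun _ h => inv_mem_colGroup h) (by simp) (by simp) fun π _ => ?_
  refine Fintype.sum_equiv (Equiv.mulRight (T.permCongr π)) _ _ fun σ => ?_
  rw [Equiv.coe_mulRight, map_smul, smul_smul, map_mul, Module.End.mul_apply, permCongr_inv',
    mul_inv_cancel_right, Equiv.Perm.sign_inv, mul_comm]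

theorem mem_adjoin_tensorGlRep (a : Module.End ℂ (TPow (Fin n) (Vr r)))
    (ha : ∀ σ, a * tensorPermRep r n σ = tensorPermRep r n σ * a) :
    a ∈ Algebra.adjoin ℂ (Set.range (tensorGlRep r (Fin n))) := by
  have h := mem_adjoin_of_commute (vrBasis r) a ha
  convert h using 2
  ext x
  constructor
  · rintro ⟨A, rfl⟩; exact ⟨_, rfl⟩
  · rintro ⟨f, rfl⟩
    obtain ⟨A, hA⟩ := (Matrix.toLinAlgEquiv' (R := ℂ) (n := Fin r)).surjective f
    exact ⟨A, congrArg (tensorRep (V := Vr r) (ι := Fin n)) hA⟩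

theorem commute_of_mem_adjoin {a : Module.End ℂ (TPow (Fin n) (Vr r))}
    (ha : a ∈ Algebra.adjoin ℂ (Set.range (tensorGlRep r (Fin n)))) (σ : Equiv.Perm (Fin n)) :
    a * tensorPermRep r n σ = tensorPermRep r n σ * a := by
  induction ha using Algebra.adjoin_induction with
  | mem x hx => obtain ⟨A, rfl⟩ := hx; exact tensorGl_comm r n A σ
  | algebraMap c => exact Algebra.commutes c _
  | add x y _ _ hx hy => rw [add_mul, mul_add, hx, hy]
  | mul x y _ _ hx hy => rw [mul_assoc, hy, ← mul_assoc, hx, mul_assoc]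

/-- The passage from tensors to tabloids and back is equivariant and takes the highest weight vector
to the wanted vector. Being in the commutant of `Σ_n`, it is a polynomial in the operators of
`gl_r`. -/
theorem spechtOp_mem_orbit (h : μ.rowLen r = 0) (T : Cells μ ≃ Fin n)
    (w : TPow (Fin n) (Vr r)) :
    spechtOp (tensorPermRep r n) T w ∈ (tensorGlRep r (Fin n)).orbit ⊤ (hwTensor r T) := by
  refine (LieRep.mem_orbit_top _ _ _).2
    ⟨tabloidToTensor T (colSym (tensorPermRep r n) T w) ∘ₗ tensorToTabloid r n,
      mem_adjoin_tensorGlRep _ fun σ => LinearMap.ext fun x => ?_, ?_⟩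
  · change tabloidToTensor _ _ (tensorToTabloid r n (tensorPermRep r n σ x)) =
      tensorPermRep r n σ (tabloidToTensor _ _ (tensorToTabloid r n x))
    rw [tensorToTabloid_perm, tabloidToTensor_perm]
  · rw [LinearMap.comp_apply, tensorToTabloid_hwTensor h, tabloidToTensor_polytabloid]

/-- `spechtOp` scales the highest weight vector by a nonzero number and commutes with `gl_r`, so it
scales the whole cyclic module by that number. -/
theorem exists_spechtOp_eq (h : μ.rowLen r = 0) (T : Cells μ ≃ Fin n)
    {v : TPow (Fin n) (Vr r)} (hv : v ∈ (tensorGlRep r (Fin n)).orbit ⊤ (hwTensor r T)) :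
    ∃ w, spechtOp (tensorPermRep r n) T w = v := by
  obtain ⟨a, ha, rfl⟩ := (LieRep.mem_orbit_top _ _ _).1 hv
  obtain ⟨b, hb0, hb⟩ := spechtOp_polytabloid T
  have h1 : spechtOp (tensorPermRep r n) T (hwTensor r T) = b • hwTensor r T := by
    apply tensorToTabloid_injective
    rw [map_smul, tensorToTabloid_hwTensor h, ← hb, spechtOp_apply, spechtOp_apply, map_sum]
    exact Finset.sum_congr rfl fun σ _ => by
      rw [map_smul, tensorToTabloid_perm, tensorToTabloid_hwTensor h]
  refine ⟨b⁻¹ • a (hwTensor r T), ?_⟩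
  have h2 : ∀ w, spechtOp (tensorPermRep r n) T (a w) = a (spechtOp (tensorPermRep r n) T w) := by
    intro w
    rw [spechtOp_apply, spechtOp_apply, map_sum]
    exact Finset.sum_congr rfl fun σ _ => by
      rw [map_smul]
      exact congrArg _ (LinearMap.congr_fun (commute_of_mem_adjoin ha σ) w).symm
  rw [map_smul, h2, h1, map_smul, inv_smul_smul₀ hb0]

/-- `(V_r^{⊗ n} ⊗ π_λ)^{Σ_n}` is zero when `λ` has more than `r` rows. -/
theorem swInv_specht_eq_zero (μ : Shape n) (h : μ.1.rowLen r ≠ 0)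
    {y : (TPow (Fin n) (Vr r)) ⊗[ℂ] (specht μ).toSubmodule}
    (hy : y ∈ SWInv r (specht μ).toRepresentation) : y = 0 := by
  obtain ⟨T⟩ := nonempty_numbering μ
  refine eq_zero_of_spechtEval μ T hy ?_
  set v := spechtEval r μ (polytabloid μ.1 T) y with hv
  refine (tpBasis r (Fin n)).ext_elem fun c => ?_
  -- The first column has at least `r + 1` cells, so two of them carry the same index of `c`. Their
  -- transposition negates `v` and preserves its coefficient at `c`.
  have hcell : ∀ i : Fin (r + 1), ((i : ℕ), 0) ∈ μ.1.cells := fun i => by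
    rw [YoungDiagram.mem_cells, YoungDiagram.mem_iff_lt_rowLen]
    have := μ.1.rowLen_anti i r (by omega)
    omega
  obtain ⟨i, j, hij, hc⟩ := Fintype.exists_ne_map_eq_of_card_lt
    (fun i : Fin (r + 1) => c (T ⟨_, hcell i⟩)) (by simp)
  have hne : (⟨_, hcell i⟩ : Cells μ.1) ≠ ⟨_, hcell j⟩ := fun h => hij (by
    have := congrArg (fun c : Cells μ.1 => c.1.1) h
    exact Fin.ext this)
  have hswap : Equiv.swap (⟨_, hcell i⟩ : Cells μ.1) ⟨_, hcell j⟩ ∈ colGroup μ.1 :=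
    swap_mem_colGroup rfl
  have h1 := spechtEval_perm μ (polytabloid μ.1 T) (T.permCongr
    (Equiv.swap (⟨_, hcell i⟩ : Cells μ.1) ⟨_, hcell j⟩)) y
  rw [hy, perm_polytabloid T hswap, Equiv.Perm.sign_swap hne] at h1
  have h2 : spechtEval r μ ((((-1 : ℤˣ) : ℤ) : ℂ) • polytabloid μ.1 T) y = -v := by
    have : tabForm ((((-1 : ℤˣ) : ℤ) : ℂ) • polytabloid μ.1 T) = -tabForm (polytabloid μ.1 T) := by
      ext1 z
      refine LinearMap.ext_ring ?_
      change tabForm _ (MonoidAlgebra.single z 1) = -tabForm _ (MonoidAlgebra.single z 1)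
      rw [tabForm_smul_left]
      simp
    rw [hv, spechtEval, this, LinearMap.neg_comp, LinearMap.lTensor_neg]
    simp [spechtEval]
  rw [h2] at h1
  have h3 := congrArg (fun z => (tpBasis r (Fin n)).repr z c) h1
  simp only [map_neg, Finsupp.neg_apply] at h3
  rw [tpBasis_repr_perm, permCongr_swap'] at h3
  have h4 : (fun k => c (Equiv.swap (T ⟨_, hcell i⟩) (T ⟨_, hcell j⟩) k)) = c := by
    funext k
    rcases eq_or_ne k (T ⟨_, hcell i⟩) with rfl | hi
    · rw [Equiv.swap_apply_left]; exact hc.symm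
    rcases eq_or_ne k (T ⟨_, hcell j⟩) with rfl | hj
    · rw [Equiv.swap_apply_right]; exact hc
    rw [Equiv.swap_apply_of_ne_of_ne hi hj]
  rw [h4] at h3
  rw [map_zero, Finsupp.zero_apply]
  exact neg_eq_self.1 h3

theorem reindex_tensorGlRep {ι : Type} [Fintype ι] [DecidableEq ι] (e : Fin n ≃ ι) (A : gl r)
    (w : TPow (Fin n) (Vr r)) :
    PiTensorProduct.reindex ℂ (fun _ => Vr r) e (tensorGlRep r (Fin n) A w) =
      tensorGlRep r ι A (PiTensorProduct.reindex ℂ (fun _ => Vr r) e w) := by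
  have : (PiTensorProduct.reindex ℂ (fun _ => Vr r) e).toLinearMap ∘ₗ tensorGlRep r (Fin n) A =
      (show Module.End ℂ (TPow ι (Vr r)) from tensorGlRep r ι A) ∘ₗ
        (PiTensorProduct.reindex ℂ (fun _ => Vr r) e).toLinearMap := by
    apply PiTensorProduct.ext
    apply MultilinearMap.ext
    intro v
    simp only [LinearMap.compMultilinearMap_apply, LinearMap.comp_apply, LinearEquiv.coe_coe]
    rw [PiTensorProduct.reindex_tprod]
    change PiTensorProduct.reindex ℂ (fun _ => Vr r) e ((∑ k, slot k (vrRep r A)) _) =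
      (∑ k, slot k (vrRep r A)) _
    rw [LinearMap.sum_apply, LinearMap.sum_apply, map_sum]
    refine Fintype.sum_equiv e _ _ fun k => ?_
    rw [slot, slot, PiTensorProduct.map_tprod, PiTensorProduct.map_tprod,
      PiTensorProduct.reindex_tprod]
    congr 1
    funext i
    by_cases h : i = e k
    · subst h; simp
    · have : e.symm i ≠ k := fun h' => h (by rw [← h']; simp)
      simp [h, this]
  exact LinearMap.congr_fun this w

theorem reindex_hwTensor (T : Cells μ ≃ Fin n) :
    PiTensorProduct.reindex ℂ (fun _ => Vr r) T.symm (hwTensor r T) = hwVec r μ := by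
  rw [hwTensor, map_sum, hwVec]
  refine Finset.sum_congr rfl fun σ _ => ?_
  rw [map_smul, PiTensorProduct.reindex_tprod]
  simp

/-- `(V_r^{⊗ n} ⊗ π_λ)^{Σ_n} ≅ π^λ` when `λ` has at most `r` rows. -/
theorem swInv_specht_iso (μ : Shape n) (h : μ.1.rowLen r = 0) :
    (swInvRep r (specht μ).toRepresentation).Iso (glIrrep r μ.1) := by
  obtain ⟨T⟩ := nonempty_numbering μ
  let e := PiTensorProduct.reindex ℂ (fun _ : Fin n => Vr r) T.symm
  let f : SWInv r (specht μ).toRepresentation →ₗ[ℂ] TPow (Cells μ.1) (Vr r) :=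
    e.toLinearMap ∘ₗ spechtEval r μ (polytabloid μ.1 T) ∘ₗ
      (SWInv r (specht μ).toRepresentation).subtype
  have hf : Function.Injective f := by
    intro y z hyz
    have h1 : spechtEval r μ (polytabloid μ.1 T) y.1 = spechtEval r μ (polytabloid μ.1 T) z.1 :=
      e.injective hyz
    exact Subtype.ext (sub_eq_zero.1 (eq_zero_of_spechtEval μ T (Submodule.sub_mem _ y.2 z.2)
      (by rw [map_sub, h1, sub_self])))
  have horb : (tensorGlRep r (Cells μ.1)).orbit ⊤ (hwVec r μ.1) =
      ((tensorGlRep r (Fin n)).orbit ⊤ (hwTensor r T)).map e.toLinearMap := by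
    rw [LieRep.map_orbit_top _ (tensorGlRep r (Cells μ.1)) e.toLinearMap
      fun A w => reindex_tensorGlRep T.symm A w]
    congr 1
    exact (reindex_hwTensor T).symm
  -- Up to renumbering of the factors, both sides are the image of `spechtOp`.
  have hrange : LinearMap.range f = (tensorGlRep r (Cells μ.1)).orbit ⊤ (hwVec r μ.1) := by
    rw [horb]
    refine le_antisymm ?_ ?_
    · rintro _ ⟨y, rfl⟩
      refine ⟨_, ?_, rfl⟩
      obtain ⟨w, hw⟩ := exists_permSum_eq μ T y.1
      rw [permSum_of_mem _ y.2] at hw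
      change spechtEval r μ (polytabloid μ.1 T) y.1 ∈ _
      rw [← inv_smul_smul₀ (card_perm_ne_zero (n := n)) y.1, hw, map_smul, spechtEval_permSum]
      exact Submodule.smul_mem _ _ (spechtOp_mem_orbit h T w)
    · rintro _ ⟨v, hv, rfl⟩
      obtain ⟨w, rfl⟩ := exists_spechtOp_eq h T hv
      refine ⟨⟨_, permSum_mem _ (w ⊗ₜ[ℂ] ⟨_, polytabloid_mem_specht μ T⟩)⟩, ?_⟩
      exact congrArg e (spechtEval_permSum μ T w)
  refine ⟨(LinearEquiv.ofInjective f hf).trans (LinearEquiv.ofEq _ _ hrange), fun A y => ?_⟩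
  refine Subtype.ext ?_
  change e (spechtEval r μ _ (leftGlRep r n _ A y.1)) = tensorGlRep r (Cells μ.1) A (e _)
  rw [spechtEval_leftGl, reindex_tensorGlRep]
  rfl

end SpechtToGl

/-! ## Functoriality of `(V_r^{⊗ n} ⊗ M)^{Σ_n}` and the Frobenius map -/

section Functoriality

variable {L : Type*} [LieRing L] [LieAlgebra ℂ L] {V W X : Type*} [AddCommGroup V] [Module ℂ V]
  [AddCommGroup W] [Module ℂ W] [AddCommGroup X] [Module ℂ X]

theorem LieRep.Iso.symm {ρ : LieRep L V} {σ : LieRep L W} (h : ρ.Iso σ) : σ.Iso ρ := by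
  obtain ⟨e, he⟩ := h
  exact ⟨e.symm, fun x v => e.injective (by rw [he, e.apply_symm_apply, e.apply_symm_apply])⟩

theorem LieRep.Iso.trans {ρ : LieRep L V} {σ : LieRep L W} {τ : LieRep L X} (h : ρ.Iso σ)
    (h' : σ.Iso τ) : ρ.Iso τ := by
  obtain ⟨e, he⟩ := h
  obtain ⟨e', he'⟩ := h'
  exact ⟨e.trans e', fun x v => by simp [he, he']⟩

/-- A representation with a finite complete system of inclusions and projections is a direct
sum. -/
theorem LieRep.iso_directSum {κ : Type*} [Fintype κ] [DecidableEq κ] {Y : κ → Type*}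
    [∀ q, AddCommGroup (Y q)] [∀ q, Module ℂ (Y q)] (ρ : LieRep L V) (σ : ∀ q, LieRep L (Y q))
    (f : ∀ q, Y q →ₗ[ℂ] V) (g : ∀ q, V →ₗ[ℂ] Y q) (hgf : ∀ q y, g q (f q y) = y)
    (hgf' : ∀ q q', q ≠ q' → ∀ y, g q (f q' y) = 0) (hfg : ∀ v, ∑ q, f q (g q v) = v)
    (hg : ∀ q x v, g q (ρ x v) = σ q x (g q v)) : ρ.Iso (LieRep.directSum σ) := by
  let F : V →ₗ[ℂ] ⨁ q, Y q := ∑ q, DirectSum.lof ℂ κ Y q ∘ₗ g q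
  have hF : ∀ v, F v = ∑ q, DirectSum.lof ℂ κ Y q (g q v) := fun v => by
    simp [F, LinearMap.sum_apply]
  refine ⟨LinearEquiv.ofLinearMap F (DirectSum.toModule ℂ κ V f) ?_ ?_, fun x v => ?_⟩
  · refine DirectSum.linearMap_ext _ fun q => LinearMap.ext fun y => ?_
    simp only [LinearMap.comp_apply, DirectSum.toModule_lof, hF, LinearMap.id_apply]
    rw [Finset.sum_eq_single q]
    · rw [hgf]
    · intro q' _ hq
      rw [hgf' q' q hq, map_zero]
    · intro h; exact absurd (Finset.mem_univ q) h
  · refine LinearMap.ext fun v => ?_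
    simp only [LinearMap.comp_apply, hF, map_sum, DirectSum.toModule_lof, LinearMap.id_apply]
    exact hfg v
  · change F (ρ x v) = DirectSum.lmap (fun q => σ q x) (F v)
    rw [hF, hF, map_sum]
    exact Finset.sum_congr rfl fun q _ => by rw [DirectSum.lmap_lof, hg]

end Functoriality

/-! ### Invariants of direct sums, and the Frobenius map. -/

section SWFunctor

variable {r n : ℕ} {M M' : Type*} [AddCommGroup M] [Module ℂ M] [AddCommGroup M'] [Module ℂ M']
  {μ : Representation ℂ (Equiv.Perm (Fin n)) M} {μ' : Representation ℂ (Equiv.Perm (Fin n)) M'}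

theorem lTensor_mem_swInv (φ : M →ₗ[ℂ] M') (hφ : ∀ σ m, φ (μ σ m) = μ' σ (φ m)) :
    ∀ x ∈ SWInv r μ, φ.lTensor (TPow (Fin n) (Vr r)) x ∈ SWInv r μ' := by
  intro x hx σ
  have h : ∀ y, (tensorPermRep r n).tprod μ' σ (φ.lTensor (TPow (Fin n) (Vr r)) y) =
      φ.lTensor (TPow (Fin n) (Vr r)) ((tensorPermRep r n).tprod μ σ y) := by
    intro y
    induction y using TensorProduct.induction_on with
    | zero => simp
    | tmul w m =>
      simp only [LinearMap.lTensor_tmul, Representation.tprod_apply, TensorProduct.map_tmul, hφ]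
    | add y z hy hz => simp only [map_add, hy, hz]
  rw [h, hx]

/-- The map of invariants induced by an equivariant map. -/
def swMap (φ : M →ₗ[ℂ] M') (hφ : ∀ σ m, φ (μ σ m) = μ' σ (φ m)) :
    SWInv r μ →ₗ[ℂ] SWInv r μ' :=
  (φ.lTensor (TPow (Fin n) (Vr r))).restrict (lTensor_mem_swInv φ hφ)

theorem coe_swMap (φ : M →ₗ[ℂ] M') (hφ : ∀ σ m, φ (μ σ m) = μ' σ (φ m)) (x : SWInv r μ) :
    (swMap φ hφ x).1 = φ.lTensor (TPow (Fin n) (Vr r)) x.1 := rfl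

theorem lTensor_leftGl (φ : M →ₗ[ℂ] M') (A : gl r) (x : (TPow (Fin n) (Vr r)) ⊗[ℂ] M) :
    φ.lTensor (TPow (Fin n) (Vr r)) (leftGlRep r n M A x) =
      leftGlRep r n M' A (φ.lTensor (TPow (Fin n) (Vr r)) x) := by
  induction x using TensorProduct.induction_on with
  | zero => simp
  | tmul w m => rfl
  | add y z hy hz => simp only [map_add, hy, hz]

theorem swMap_swInvRep (φ : M →ₗ[ℂ] M') (hφ : ∀ σ m, φ (μ σ m) = μ' σ (φ m)) (A : gl r)
    (x : SWInv r μ) : swMap φ hφ (swInvRep r μ A x) = swInvRep r μ' A (swMap φ hφ x) :=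
  Subtype.ext (lTensor_leftGl φ A x.1)

theorem swInvRep_iso_of_equiv (r : ℕ) (e : μ.Equiv μ') :
    (swInvRep r μ).Iso (swInvRep r μ') := by
  have h1 : ∀ σ m, e.toLinearEquiv.toLinearMap (μ σ m) = μ' σ (e.toLinearEquiv.toLinearMap m) :=
    fun σ m => e.toIntertwiningMap.isIntertwining _ _ σ m
  have h2 : ∀ σ m, e.toLinearEquiv.symm.toLinearMap (μ' σ m) =
      μ σ (e.toLinearEquiv.symm.toLinearMap m) :=
    fun σ m => e.symm.toIntertwiningMap.isIntertwining _ _ σ m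
  refine ⟨LinearEquiv.ofLinearMap (swMap _ h1) (swMap _ h2) ?_ ?_,
    fun A x => swMap_swInvRep _ h1 A x⟩
  · refine LinearMap.ext fun x => Subtype.ext ?_
    rw [LinearMap.comp_apply, coe_swMap, coe_swMap, ← LinearMap.comp_apply,
      ← LinearMap.lTensor_comp]
    have : e.toLinearEquiv.toLinearMap ∘ₗ e.toLinearEquiv.symm.toLinearMap = LinearMap.id :=
      LinearMap.ext fun y => e.toLinearEquiv.apply_symm_apply y
    rw [this, LinearMap.lTensor_id]
    rfl
  · refine LinearMap.ext fun x => Subtype.ext ?_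
    rw [LinearMap.comp_apply, coe_swMap, coe_swMap, ← LinearMap.comp_apply,
      ← LinearMap.lTensor_comp]
    have : e.toLinearEquiv.symm.toLinearMap ∘ₗ e.toLinearEquiv.toLinearMap = LinearMap.id :=
      LinearMap.ext fun y => e.toLinearEquiv.symm_apply_apply y
    rw [this, LinearMap.lTensor_id]
    rfl

variable {κ : Type} [DecidableEq κ] {Y : κ → Type*} [∀ p, AddCommGroup (Y p)]
  [∀ p, Module ℂ (Y p)] (σ : ∀ p, Representation ℂ (Equiv.Perm (Fin n)) (Y p))

/-- The inclusion of the invariants of a summand. -/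
def swIncl (r : ℕ) (p : κ) : SWInv r (σ p) →ₗ[ℂ] SWInv r (Representation.directSum σ) :=
  swMap (DirectSum.lof ℂ κ Y p) fun g m => by
    change _ = DirectSum.lmap _ _
    rw [DirectSum.lmap_lof]

/-- The projection to the invariants of a summand. -/
def swProj (r : ℕ) (p : κ) : SWInv r (Representation.directSum σ) →ₗ[ℂ] SWInv r (σ p) :=
  swMap (DirectSum.component ℂ κ Y p) fun g m => by
    change (DirectSum.lmap (fun q => σ q g) m : ⨁ q, Y q) p = σ p g (m p)
    rw [DirectSum.lmap_apply]

theorem swProj_swIncl (p : κ) (x : SWInv r (σ p)) : swProj σ r p (swIncl σ r p x) = x := by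
  refine Subtype.ext ?_
  rw [swProj, swIncl, coe_swMap, coe_swMap, ← LinearMap.comp_apply, ← LinearMap.lTensor_comp]
  have : DirectSum.component ℂ κ Y p ∘ₗ DirectSum.lof ℂ κ Y p = LinearMap.id :=
    LinearMap.ext fun y => DirectSum.component.lof_self ℂ p y
  rw [this, LinearMap.lTensor_id]
  rfl

theorem swProj_swIncl_of_ne {p q : κ} (h : p ≠ q) (x : SWInv r (σ q)) :
    swProj σ r p (swIncl σ r q x) = 0 := by
  refine Subtype.ext ?_
  rw [swProj, swIncl, coe_swMap, coe_swMap, ← LinearMap.comp_apply, ← LinearMap.lTensor_comp]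
  have : DirectSum.component ℂ κ Y p ∘ₗ DirectSum.lof ℂ κ Y q = 0 :=
    LinearMap.ext fun y => by
      rw [LinearMap.comp_apply, DirectSum.component.of, dif_neg h.symm]
      rfl
  rw [this, LinearMap.lTensor_zero]
  rfl

theorem sum_swIncl_swProj [Fintype κ] (x : SWInv r (Representation.directSum σ)) :
    ∑ p, swIncl σ r p (swProj σ r p x) = x := by
  refine Subtype.ext ?_
  rw [Submodule.coe_sum]
  have h1 : ∀ p, (swIncl σ r p (swProj σ r p x)).1 = LinearMap.lTensorHom (TPow (Fin n) (Vr r))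
      (DirectSum.lof ℂ κ Y p ∘ₗ DirectSum.component ℂ κ Y p) x.1 := fun p => by
    rw [swProj, swIncl, coe_swMap, coe_swMap, ← LinearMap.comp_apply, ← LinearMap.lTensor_comp]
    rfl
  have h : ∑ p, (DirectSum.lof ℂ κ Y p ∘ₗ DirectSum.component ℂ κ Y p) = LinearMap.id := by
    refine LinearMap.ext fun y => ?_
    rw [LinearMap.sum_apply]
    exact DirectSum.sum_univ_of y
  rw [Finset.sum_congr rfl fun p _ => h1 p, ← LinearMap.sum_apply, ← map_sum, h]
  exact LinearMap.congr_fun (LinearMap.lTensor_id _ _) x.1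

/-- Summands outside the range of `j` contribute no invariants, so the inclusions and projections
indexed by `κ'` alone form a complete system. They will be the shapes with more than `r` rows. -/
theorem swInv_directSum_iso [Fintype κ] {κ' : Type} [Fintype κ'] [DecidableEq κ']
    {Z : κ' → Type*} [∀ q, AddCommGroup (Z q)] [∀ q, Module ℂ (Z q)]
    (τ : ∀ q, LieRep (gl r) (Z q)) (j : κ' → κ) (hj : Function.Injective j)
    (h : ∀ q, (swInvRep r (σ (j q))).Iso (τ q))
    (h0 : ∀ p, p ∉ Set.range j → ∀ y : SWInv r (σ p), y = 0) :
    (swInvRep r (Representation.directSum σ)).Iso (LieRep.directSum τ) := by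
  choose e he using h
  refine LieRep.iso_directSum (swInvRep r (Representation.directSum σ)) τ
    (fun q => swIncl σ r (j q) ∘ₗ (e q).symm.toLinearMap)
    (fun q => (e q).toLinearMap ∘ₗ swProj σ r (j q)) ?_ ?_ ?_ ?_
  · intro q y
    simp only [LinearMap.comp_apply, LinearEquiv.coe_coe]
    rw [swProj_swIncl, LinearEquiv.apply_symm_apply]
  · intro q q' hne y
    simp only [LinearMap.comp_apply, LinearEquiv.coe_coe]
    rw [swProj_swIncl_of_ne σ (hj.ne hne), map_zero]
  · intro v
    simp only [LinearMap.comp_apply, LinearEquiv.coe_coe, LinearEquiv.symm_apply_apply]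
    conv_rhs => rw [← sum_swIncl_swProj σ v]
    refine Finset.sum_of_injOn j hj.injOn (fun _ _ => Finset.mem_coe.2 (Finset.mem_univ _)) ?_
      fun _ _ => rfl
    intro p _ hp
    rw [h0 p (fun ⟨q, hq⟩ => hp ⟨q, by simp, hq⟩) (swProj σ r p v), map_zero]
  · intro q A v
    simp only [LinearMap.comp_apply, LinearEquiv.coe_coe]
    rw [← he]
    congr 1
    exact swMap_swInvRep _ _ A v

/-- `(V_r^{⊗ n} ⊗ ⨁ π_λ^{m_λ})^{Σ_n}` is the image of the Frobenius map. -/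
theorem swInv_spechtSum_iso (r : ℕ) (m : Shape n → ℕ) :
    (swInvRep (M := ⨁ p : Σ μ : Shape n, Fin (m μ), (specht p.1).toSubmodule) r
      (spechtSum m)).Iso (frobeniusSum r m) := by
  classical
  have := Fintype.ofFinite (Shape n)
  refine swInv_directSum_iso (fun p : Σ μ : Shape n, Fin (m μ) => (specht p.1).toRepresentation)
    (fun q : Σ μ : {μ : Shape n // μ.1.rowLen r = 0}, Fin (m μ.1) => glIrrep r q.1.1.1)
    (fun q => ⟨q.1.1, q.2⟩) ?_ (fun q => swInv_specht_iso q.1.1 q.1.2) ?_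
  · rintro ⟨⟨a, ha⟩, i⟩ ⟨⟨b, hb⟩, i'⟩ h
    simp only [Sigma.mk.injEq] at h
    obtain ⟨rfl, h2⟩ := h
    rw [eq_of_heq h2]
  · intro p hp y
    exact Subtype.ext (swInv_specht_eq_zero p.1 (fun h => hp ⟨⟨⟨p.1, h⟩, p.2⟩, rfl⟩) y.2)

theorem isFrobeniusImage_of_iso [FiniteDimensional ℂ M] {W : Type*} [AddCommGroup W] [Module ℂ W]
    (μ : Representation ℂ (Equiv.Perm (Fin n)) M) (ρ : LieRep (gl r) W)
    (h : ρ.Iso (swInvRep r μ)) : IsFrobeniusImage r μ ρ :=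
  ⟨exists_equiv_spechtSum μ, fun m ⟨e⟩ =>
    h.trans ((swInvRep_iso_of_equiv r e).trans (swInv_spechtSum_iso r m))⟩

end SWFunctor

/-! ## Weight spaces -/

section Weights

variable {r n : ℕ} {M : Type*} [AddCommGroup M] [Module ℂ M]
  {μ : Representation ℂ (Equiv.Perm (Fin n)) M}

theorem finrank_weightSpace_of_iso {V W : Type*} [AddCommGroup V] [Module ℂ V] [AddCommGroup W]
    [Module ℂ W] {ρ : LieRep (gl r) V} {σ : LieRep (gl r) W} (h : ρ.Iso σ) (η : Fin r → ℤ) :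
    Module.finrank ℂ (weightSpace ρ η) = Module.finrank ℂ (weightSpace σ η) := by
  obtain ⟨e, he⟩ := h
  have : weightSpace σ η = (weightSpace ρ η).map e.toLinearMap := by
    ext w
    rw [Submodule.mem_map_equiv]
    refine forall_congr' fun i => ?_
    rw [← e.injective.eq_iff, he, map_smul, e.apply_symm_apply]
  rw [this]
  exact (e.submoduleMap (weightSpace ρ η)).finrank_eq

/-- The number of occurrences of `i` in `c`. -/
def content (c : Fin n → Fin r) (i : Fin r) : ℕ := (Finset.univ.filter fun k => c k = i).card

theorem sum_content (c : Fin n → Fin r) : ∑ i, content c i = n := by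
  have := Finset.card_eq_sum_card_fiberwise (s := Finset.univ) (t := Finset.univ) (f := c)
    (fun _ _ => Finset.mem_coe.2 (Finset.mem_univ _))
  rw [Finset.card_univ, Fintype.card_fin] at this
  exact this.symm

theorem tensorGlRep_single_basis (i : Fin r) (c : Fin n → Fin r) :
    tensorGlRep r (Fin n) (Matrix.single i i 1) (tpBasis r (Fin n) c) =
      (content c i : ℂ) • tpBasis r (Fin n) c := by
  change (∑ k, slot k (vrRep r (Matrix.single i i 1))) _ = _
  rw [LinearMap.sum_apply, content, Finset.card_filter, Nat.cast_sum, Finset.sum_smul]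
  refine Finset.sum_congr rfl fun k _ => ?_
  rw [tpBasis_apply, slot_tprod]
  have hE : vrRep r (Matrix.single i i 1) (vrBasis r (c k)) =
      (if c k = i then (1 : ℂ) else 0) • vrBasis r (c k) := by
    funext j
    change (Matrix.single i i (1 : ℂ)).mulVec (vrBasis r (c k)) j =
      (if c k = i then (1 : ℂ) else 0) * vrBasis r (c k) j
    change ∑ l, Matrix.single i i (1 : ℂ) j l * vrBasis r (c k) l = _
    rw [Finset.sum_eq_single i]
    · rw [vrBasis_apply, vrBasis_apply]
      by_cases h : c k = i
      · subst h
        by_cases hj : j = c k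
        · subst hj; simp
        · simp [hj, Matrix.single_apply_of_ne, Ne.symm hj]
      · simp [h, Ne.symm h]
    · intro l _ hl
      rw [Matrix.single_apply_of_col_ne _ _ hl.symm, zero_mul]
    · intro h; exact absurd (Finset.mem_univ i) h
  have h2 : (fun l => Function.update (fun _ => (1 : Module.End ℂ (Vr r))) k
      (vrRep r (Matrix.single i i 1)) l (vrBasis r (c l))) =
      Function.update (fun l => vrBasis r (c l)) k
        ((if c k = i then (1 : ℂ) else 0) • vrBasis r (c k)) := by
    funext l
    by_cases h : l = k
    · subst h; simp only [Function.update_self]; exact hE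
    · simp [h]
  rw [h2, MultilinearMap.map_update_smul, Function.update_eq_self]
  split_ifs <;> simp

theorem tcoeff_leftGl_single (i : Fin r) (c : Fin n → Fin r)
    (x : (TPow (Fin n) (Vr r)) ⊗[ℂ] M) :
    tcoeff c (leftGlRep r n M (Matrix.single i i 1) x) = (content c i : ℂ) • tcoeff c x := by
  have key : (tpBasis r (Fin n)).coord c ∘ₗ tensorGlRep r (Fin n) (Matrix.single i i 1) =
      (content c i : ℂ) • (tpBasis r (Fin n)).coord c := by
    refine (tpBasis r (Fin n)).ext fun d => ?_
    rw [LinearMap.comp_apply, tensorGlRep_single_basis, map_smul, LinearMap.smul_apply,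
      Module.Basis.coord_apply, Module.Basis.repr_self, Finsupp.single_apply]
    split_ifs with h
    · rw [h]
    · simp
  induction x using TensorProduct.induction_on with
  | zero => simp
  | tmul w m =>
    change tcoeff c ((tensorGlRep r (Fin n) (Matrix.single i i 1) w) ⊗ₜ[ℂ] m) = _
    rw [tcoeff_tmul, tcoeff_tmul, smul_smul]
    congr 1
    exact LinearMap.congr_fun key w
  | add y z hy hz => simp only [map_add, smul_add, hy, hz]

/-- Each basis tensor is a weight vector whose weight is its content, so belonging to a weight space
is a condition on the support. -/
theorem mem_weightSpace_swInv (η : Fin r → ℤ) (x : SWInv r μ) :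
    x ∈ weightSpace (swInvRep r μ) η ↔
      ∀ c, tcoeff c x.1 ≠ 0 → ∀ i, (content c i : ℤ) = η i := by
  have h1 : x ∈ weightSpace (swInvRep r μ) η ↔
      ∀ i, leftGlRep r n M (Matrix.single i i 1) x.1 = (η i : ℂ) • x.1 :=
    forall_congr' fun i => Subtype.ext_iff
  rw [h1]
  constructor
  · intro h c hc i
    have h2 := congrArg (tcoeff c) (h i)
    rw [tcoeff_leftGl_single, map_smul, ← sub_eq_zero, ← sub_smul, smul_eq_zero,
      or_iff_left hc, sub_eq_zero] at h2
    exact_mod_cast h2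
  · intro h i
    rw [← sub_eq_zero]
    refine eq_zero_of_tcoeff fun c => ?_
    rw [map_sub, tcoeff_leftGl_single, map_smul, ← sub_smul]
    by_cases hc : tcoeff c x.1 = 0
    · rw [hc, smul_zero]
    · rw [← h c hc i, Int.cast_natCast, sub_self, zero_smul]

theorem finrank_weightSpace_eq_zero (η : Fin r → ℤ) (h : ¬ ((∀ i, 0 ≤ η i) ∧ ∑ i, η i = n)) :
    Module.finrank ℂ (weightSpace (swInvRep r μ) η) = 0 := by
  have : weightSpace (swInvRep r μ) η = ⊥ := by
    refine (Submodule.eq_bot_iff _).2 fun x hx => Subtype.ext (eq_zero_of_tcoeff fun c => ?_)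
    by_contra hc
    have hη := (mem_weightSpace_swInv η x).1 hx c hc
    refine h ⟨fun i => hη i ▸ Int.natCast_nonneg _, ?_⟩
    rw [← Finset.sum_congr rfl fun i _ => hη i, ← Nat.cast_sum, sum_content]
  rw [this, finrank_bot]

theorem exists_block_function (η : Fin r → ℕ) (hη : ∑ i, η i = n) :
    ∃ c : Fin n → Fin r, (∀ k i, c k = i ↔ k ∈ block n η i) ∧ content c = η := by
  have hIic : ∀ i : Fin r, ∑ j ∈ Finset.Iic i, η j = ∑ j ∈ Finset.Iio i, η j + η i := by
    intro i
    rw [← Finset.Iio_insert, Finset.sum_insert (by simp), add_comm]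
  have hmono : ∀ i i' : Fin r, i < i' → ∑ j ∈ Finset.Iic i, η j ≤ ∑ j ∈ Finset.Iio i', η j :=
    fun i i' h => Finset.sum_le_sum_of_subset fun j hj =>
      Finset.mem_Iio.2 ((Finset.mem_Iic.1 hj).trans_lt h)
  have huniq : ∀ (k : Fin n) (i i' : Fin r), k ∈ block n η i → k ∈ block n η i' → i = i' := by
    intro k i i' h h'
    rcases lt_trichotomy i i' with hlt | heq | hlt
    · have := hmono i i' hlt
      exact absurd (h.2.trans_le (this.trans h'.1)) (lt_irrefl _)
    · exact heq
    · have := hmono i' i hlt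
      exact absurd (h'.2.trans_le (this.trans h.1)) (lt_irrefl _)
  have hex : ∀ k : Fin n, ∃ i, k ∈ block n η i := by
    intro k
    by_contra hcon
    push Not at hcon
    -- If `k` lies in no block, then inductively each block ends at or before `k`. For the last
    -- block this says `n ≤ k`.
    have h2 : ∀ m : ℕ, ∀ i : Fin r, (i : ℕ) = m → ∑ j ∈ Finset.Iic i, η j ≤ (k : ℕ) := by
      intro m
      induction m using Nat.strong_induction_on with
      | _ m ih =>
        intro i hi
        by_contra hlt
        refine hcon i ⟨?_, not_le.1 hlt⟩
        rcases Nat.eq_zero_or_pos m with h0 | hpos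
        · have : Finset.Iio i = ∅ := by
            ext j
            simp only [Finset.mem_Iio, Fin.lt_def, Finset.notMem_empty, iff_false]
            omega
          rw [this, Finset.sum_empty]
          exact Nat.zero_le _
        · have hr : m - 1 < r := by omega
          have : Finset.Iio i = Finset.Iic ⟨m - 1, hr⟩ := by
            ext j
            simp only [Finset.mem_Iio, Finset.mem_Iic, Fin.lt_def, Fin.le_def]
            omega
          rw [this]
          exact ih (m - 1) (by omega) _ rfl
    rcases Nat.eq_zero_or_pos r with h0 | hpos
    · subst h0
      have := k.2
      simp at hη
      omega
    · have h3 := h2 (r - 1) ⟨r - 1, by omega⟩ rfl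
      have : Finset.Iic (⟨r - 1, by omega⟩ : Fin r) = Finset.univ := by
        ext j
        simp only [Finset.mem_Iic, Fin.le_def, Finset.mem_univ, iff_true]
        omega
      rw [this, hη] at h3
      exact absurd k.2 (not_lt.2 h3)
  choose c hc using hex
  have hciff : ∀ k i, c k = i ↔ k ∈ block n η i :=
    fun k i => ⟨fun h => h ▸ hc k, fun h => huniq k _ _ (hc k) h⟩
  refine ⟨c, hciff, funext fun i => ?_⟩
  have hle : ∑ j ∈ Finset.Iic i, η j ≤ n := by
    rw [← hη]
    exact Finset.sum_le_sum_of_subset (Finset.subset_univ _)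
  have : (Finset.univ.filter fun k => c k = i).map Fin.valEmbedding =
      Finset.Ico (∑ j ∈ Finset.Iio i, η j) (∑ j ∈ Finset.Iic i, η j) := by
    ext x
    simp only [Finset.mem_map, Finset.mem_filter, Finset.mem_univ, true_and, Finset.mem_Ico,
      hciff, Fin.valEmbedding_apply]
    constructor
    · rintro ⟨k, hk, rfl⟩; exact hk
    · intro hx
      exact ⟨⟨x, hx.2.trans_le hle⟩, hx, rfl⟩
  rw [content, ← Finset.card_map Fin.valEmbedding, this, Nat.card_Ico, hIic]
  omega

theorem exists_perm_of_content_eq {c d : Fin n → Fin r} (h : content c = content d) :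
    ∃ σ : Equiv.Perm (Fin n), (fun k => d (σ k)) = c := by
  have he : ∀ i, Nonempty ({k // c k = i} ≃ {k // d k = i}) := fun i => by
    refine ⟨Fintype.equivOfCardEq ?_⟩
    rw [Fintype.card_subtype, Fintype.card_subtype]
    exact congrFun h i
  exact ⟨Equiv.ofFiberEquiv fun i => (he i).some, funext fun k => Equiv.ofFiberEquiv_map _ k⟩

theorem content_comp_perm (c : Fin n → Fin r) (σ : Equiv.Perm (Fin n)) :
    content (fun k => c (σ k)) = content c :=
  funext fun i => Finset.card_equiv σ fun k => by simp

/-- The weight spaces of `(V_r^{⊗ n} ⊗ M)^{Σ_n}` are the invariants of Young subgroups. -/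
theorem finrank_weightSpace_swInv (η : Fin r → ℕ) (hη : ∑ i, η i = n) :
    Module.finrank ℂ (weightSpace (swInvRep r μ) fun i => (η i : ℤ)) =
      Module.finrank ℂ (Representation.invariants (μ.comp (youngSubgroup n η).subtype)) := by
  classical
  obtain ⟨c₀, hblock, hc₀⟩ := exists_block_function η hη
  have hY : ∀ σ : Equiv.Perm (Fin n), σ ∈ youngSubgroup n η ↔ (fun k => c₀ (σ k)) = c₀ := by
    intro σ
    constructor
    · intro hσ
      funext k
      exact (hblock _ _).2 ((hσ _ _).2 ((hblock _ _).1 rfl))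
    · intro h i k
      rw [← hblock, ← hblock]
      exact iff_of_eq (congrArg (· = i) (congrFun h k))
  have hinv : ∀ x ∈ SWInv r μ, ∀ σ c, tcoeff c x = μ σ (tcoeff (fun k => c (σ k)) x) := by
    intro x hx σ c
    conv_lhs => rw [← hx σ]
    exact tcoeff_perm μ σ c x
  -- The isomorphism takes the coefficient at `c₀`. It is injective because every index function of
  -- content `η` is a translate of `c₀`, so invariance determines the other coefficients.
  let Ψ : weightSpace (swInvRep r μ) (fun i => (η i : ℤ)) →ₗ[ℂ]
      Representation.invariants (μ.comp (youngSubgroup n η).subtype) :=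
    ((tcoeff c₀ ∘ₗ (SWInv r μ).subtype) ∘ₗ Submodule.subtype _).codRestrict _ fun x σ => by
      have := hinv x.1.1 x.1.2 σ.1 c₀
      rw [(hY σ.1).1 σ.2] at this
      exact this.symm
  refine (LinearEquiv.ofBijective Ψ ⟨?_, ?_⟩).finrank_eq
  · intro x y hxy
    have h0 : tcoeff c₀ x.1.1 = tcoeff c₀ y.1.1 := congrArg Subtype.val hxy
    have hx := (mem_weightSpace_swInv _ _).1 x.2
    have hy := (mem_weightSpace_swInv _ _).1 y.2
    have h1 : x.1.1 - y.1.1 = 0 := by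
      refine eq_zero_of_tcoeff fun c => ?_
      rw [map_sub, sub_eq_zero]
      by_cases hcont : content c₀ = content c
      · obtain ⟨σ, hσ⟩ := exists_perm_of_content_eq hcont
        rw [hinv _ x.1.2 σ c, hinv _ y.1.2 σ c, hσ, h0]
      · have hz : ¬ ∀ i, (content c i : ℤ) = η i := fun h => hcont <| by
          rw [hc₀]
          funext i
          exact_mod_cast (h i).symm
        rw [not_ne_iff.1 fun h => hz (hx c h), not_ne_iff.1 fun h => hz (hy c h)]
    exact Subtype.ext (Subtype.ext (sub_eq_zero.1 h1))
  · intro m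
    -- A preimage of `m` up to a scalar: the coefficient at `c₀` of this symmetrization is `m` times
    -- the order of the stabilizer of `c₀`.
    set x := permSum μ (tpBasis r (Fin n) c₀ ⊗ₜ[ℂ] m.1) with hx
    have hcoeff : ∀ c, tcoeff c x =
        ∑ σ : Equiv.Perm (Fin n), if c₀ = fun k => c (σ k) then μ σ m.1 else 0 := by
      intro c
      rw [hx, permSum_apply, map_sum]
      refine Finset.sum_congr rfl fun σ _ => ?_
      rw [tcoeff_perm, tcoeff_tmul, Module.Basis.repr_self, Finsupp.single_apply]
      split_ifs <;> simp
    have hcard : ((Finset.univ.filter fun σ : Equiv.Perm (Fin n) =>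
        c₀ = fun k => c₀ (σ k)).card : ℂ) ≠ 0 :=
      Nat.cast_ne_zero.2 (Finset.card_ne_zero.2 ⟨1, by simp⟩)
    have hx0 : tcoeff c₀ x = ((Finset.univ.filter fun σ : Equiv.Perm (Fin n) =>
        c₀ = fun k => c₀ (σ k)).card : ℂ) • m.1 := by
      rw [hcoeff, ← Finset.sum_filter, Finset.sum_congr rfl fun σ hσ => ?_, Finset.sum_const,
        Nat.cast_smul_eq_nsmul]
      exact m.2 ⟨σ, (hY σ).2 (Finset.mem_filter.1 hσ).2.symm⟩
    have hw : (⟨x, permSum_mem μ _⟩ : SWInv r μ) ∈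
        weightSpace (swInvRep r μ) (fun i => (η i : ℤ)) := by
      rw [mem_weightSpace_swInv]
      intro c hc i
      rw [hcoeff] at hc
      obtain ⟨σ, -, hσ⟩ := Finset.exists_ne_zero_of_sum_ne_zero hc
      have h1 : c₀ = fun k => c (σ k) := by
        by_contra h
        exact hσ (if_neg h)
      rw [← content_comp_perm c σ, ← h1, hc₀]
    refine ⟨(((Finset.univ.filter fun σ : Equiv.Perm (Fin n) =>
        c₀ = fun k => c₀ (σ k)).card : ℂ))⁻¹ • ⟨_, hw⟩, Subtype.ext ?_⟩
    rw [map_smul]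
    change _ • tcoeff c₀ x = m.1
    rw [hx0, inv_smul_smul₀ hcard]

end Weights

/-! ## Complete reducibility and associated graded modules -/

section Graded

variable {L : Type*} [LieRing L] [LieAlgebra ℂ L] {V W : Type*} [AddCommGroup V] [Module ℂ V]
  [AddCommGroup W] [Module ℂ W]

/-- Every invariant subspace of `P` has an invariant complement in `P`. -/
def LieRep.HasComplements (ρ : LieRep L V) (P : Submodule ℂ V) : Prop :=
  ∀ S ≤ P, (∀ x, ∀ v ∈ S, ρ x v ∈ S) →
    ∃ C : Submodule ℂ V, (∀ x, ∀ v ∈ C, ρ x v ∈ C) ∧ Disjoint S C ∧ S ⊔ C = P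

/-- Pull the subspace back, take a complement there and push it forward. The image stays disjoint
because `f v ∈ S` already puts `v` in the pulled back subspace. -/
theorem LieRep.HasComplements.range {ρ : LieRep L V} {σ : LieRep L W}
    (h : ρ.HasComplements ⊤) (f : V →ₗ[ℂ] W) (hf : ∀ x v, f (ρ x v) = σ x (f v)) :
    σ.HasComplements (LinearMap.range f) := by
  intro S hS hinv
  obtain ⟨C, hC, hdisj, hsup⟩ := h (S.comap f) le_top fun x v hv => by
    rw [Submodule.mem_comap, hf]
    exact hinv x _ hv
  refine ⟨C.map f, ?_, ?_, ?_⟩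
  · rintro x _ ⟨v, hv, rfl⟩
    exact ⟨_, hC x v hv, hf x v⟩
  · rw [Submodule.disjoint_def] at hdisj ⊢
    rintro _ hw ⟨v, hv, rfl⟩
    rw [hdisj v hw hv, map_zero]
  · have h1 := congrArg (Submodule.map f) hsup
    rwa [Submodule.map_sup, Submodule.map_comap_eq, inf_eq_right.2 hS, Submodule.map_top] at h1

/-- If `C` is an invariant complement of `E` in `P`, then `C ⊓ F` maps isomorphically onto `F / E`;
the section is the inverse. -/
theorem LieRep.exists_section (ρ : LieRep L V) {P E F : Submodule ℂ V}
    (h : ρ.HasComplements P) (hE : ∀ x, ∀ v ∈ E, ρ x v ∈ E) (hF : ∀ x, ∀ v ∈ F, ρ x v ∈ F)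
    (hEF : E ≤ F) (hFP : F ≤ P) :
    ∃ s : (F ⧸ E.submoduleOf F) →ₗ[ℂ] V,
      (∀ x q, s ((ρ.sub F hF).quot (E.submoduleOf F) (fun x v hv => hE x v hv) x q) =
        ρ x (s q)) ∧ ∀ v : F, v.1 - s ((E.submoduleOf F).mkQ v) ∈ E := by
  obtain ⟨C, hC, hdisj, hsup⟩ := h E (hEF.trans hFP) hE
  rw [Submodule.disjoint_def] at hdisj
  let q : (C ⊓ F : Submodule ℂ V) →ₗ[ℂ] (F ⧸ E.submoduleOf F) :=
    (E.submoduleOf F).mkQ ∘ₗ Submodule.inclusion inf_le_right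
  have hq : Function.Bijective q := by
    constructor
    · intro v w hvw
      have h1 : v.1 - w.1 ∈ E := (Submodule.Quotient.eq (E.submoduleOf F)).1 hvw
      exact Subtype.ext (sub_eq_zero.1 (hdisj _ h1 (C.sub_mem v.2.1 w.2.1)))
    · intro y
      obtain ⟨v, rfl⟩ := (E.submoduleOf F).mkQ_surjective y
      obtain ⟨e, he, c, hc, hec⟩ := Submodule.mem_sup.1 (hsup.symm ▸ hFP v.2 : v.1 ∈ E ⊔ C)
      have hcF : c ∈ F := by
        rw [← add_sub_cancel_left e c, hec]
        exact F.sub_mem v.2 (hEF he)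
      refine ⟨⟨c, hc, hcF⟩, (Submodule.Quotient.eq _).2 ?_⟩
      change c - v.1 ∈ E
      rw [← hec, sub_add_cancel_right]
      exact E.neg_mem he
  let e := LinearEquiv.ofBijective q hq
  refine ⟨Submodule.subtype _ ∘ₗ e.symm.toLinearMap, fun x y => ?_, fun v => ?_⟩
  · obtain ⟨v, rfl⟩ := e.surjective y
    simp only [LinearMap.comp_apply, LinearEquiv.coe_coe, LinearEquiv.symm_apply_apply]
    have : (ρ.sub F hF).quot (E.submoduleOf F) (fun x v hv => hE x v hv) x (e v) =
        e ⟨ρ x v.1, hC x _ v.2.1, hF x _ v.2.2⟩ := rfl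
    rw [this, LinearEquiv.symm_apply_apply]
    rfl
  · obtain ⟨w, hw⟩ := e.surjective ((E.submoduleOf F).mkQ v)
    rw [← hw]
    simp only [LinearMap.comp_apply, LinearEquiv.coe_coe, LinearEquiv.symm_apply_apply]
    exact (Submodule.Quotient.eq (E.submoduleOf F)).1 hw.symm

/-- A representation with an exhaustive filtration is the direct sum of its graded pieces `Y i`,
if the projections to the pieces have equivariant sections. -/
theorem LieRep.directSum_iso_of_sections (ρ : LieRep L V) (P : Submodule ℂ V)
    (hP : ∀ x, ∀ v ∈ P, ρ x v ∈ P) (E F : ℕ → Submodule ℂ V) (h0 : E 0 = ⊥)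
    (hs : ∀ i, E (i + 1) = F i) (hmono : Monotone F) (hsup : ⨆ i, F i = P)
    {Y : ℕ → Type*} [∀ i, AddCommGroup (Y i)] [∀ i, Module ℂ (Y i)] (τ : ∀ i, LieRep L (Y i))
    (p : ∀ i, F i →ₗ[ℂ] Y i) (hp : ∀ i, Function.Surjective (p i))
    (hpE : ∀ i v, v.1 ∈ E i → p i v = 0) (s : ∀ i, Y i →ₗ[ℂ] V)
    (hs1 : ∀ i x y, s i (τ i x y) = ρ x (s i y)) (hs2 : ∀ i v, v.1 - s i (p i v) ∈ E i) :
    (LieRep.directSum τ).Iso (ρ.sub P hP) := by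
  have hFP : ∀ i, F i ≤ P := fun i => hsup ▸ le_iSup F i
  have hEF : ∀ i, E i ≤ F i := by
    rintro (_ | i)
    · rw [h0]; exact bot_le
    · rw [hs]; exact hmono (Nat.le_succ i)
  have hsF : ∀ i y, s i y ∈ F i := by
    intro i y
    obtain ⟨v, rfl⟩ := hp i y
    rw [← sub_sub_cancel v.1 (s i _)]
    exact (F i).sub_mem v.2 (hEF i (hs2 i v))
  let Θ : (⨁ i, Y i) →ₗ[ℂ] V := DirectSum.toModule ℂ ℕ V s
  have hΘ : ∀ i y, Θ (DirectSum.lof ℂ ℕ Y i y) = s i y := fun i y => DirectSum.toModule_lof ℂ i y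
  have hinj : Function.Injective Θ := by
    classical
    rw [injective_iff_map_eq_zero]
    intro x hx
    by_contra hne
    have hsupp : (DFinsupp.support x).Nonempty := by
      rw [Finset.nonempty_iff_ne_empty]
      exact fun h => hne (DFinsupp.support_eq_empty.1 h)
    -- The terms of a relation below its top index `m` lie in `E m`, hence so does the top term, and
    -- then its class `x m` is zero.
    set m := (DFinsupp.support x).max' hsupp with hm
    have hxm : x m ≠ 0 := DFinsupp.mem_support_iff.1 (Finset.max'_mem _ hsupp)
    have hsum : ∑ i ∈ DFinsupp.support x, s i (x i) = 0 := by
      rw [← hx]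
      conv_rhs => rw [← DirectSum.sum_support_of x]
      rw [map_sum]
      exact Finset.sum_congr rfl fun i _ => (hΘ i _).symm
    rw [← Finset.add_sum_erase _ _ (Finset.max'_mem _ hsupp), ← hm] at hsum
    have hlow : ∑ i ∈ (DFinsupp.support x).erase m, s i (x i) ∈ E m := by
      refine Submodule.sum_mem _ fun i hi => ?_
      have hlt : i < m := lt_of_le_of_ne (Finset.le_max' _ _ (Finset.mem_of_mem_erase hi))
        (Finset.ne_of_mem_erase hi)
      obtain ⟨k, hk⟩ := Nat.exists_eq_succ_of_ne_zero (Nat.ne_of_gt (Nat.zero_lt_of_lt hlt))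
      rw [hk, Nat.succ_eq_add_one, hs]
      exact hmono (by omega) (hsF i _)
    have hEm : s m (x m) ∈ E m := by
      rw [eq_neg_of_add_eq_zero_left hsum]
      exact (E m).neg_mem hlow
    obtain ⟨v, hv⟩ := hp m (x m)
    have h2 := hs2 m v
    rw [hv] at h2
    have h3 := (E m).add_mem h2 hEm
    rw [sub_add_cancel] at h3
    exact hxm (hv.symm.trans (hpE m v h3))
  have hrange : LinearMap.range Θ = P := by
    refine le_antisymm ?_ ?_
    · rintro _ ⟨x, rfl⟩
      induction x using DirectSum.induction_on with
      | zero => rw [map_zero]; exact P.zero_mem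
      | of i q =>
        have := hFP i (hsF i q)
        rw [← hΘ i q] at this
        exact this
      | add x y hx hy => rw [map_add]; exact P.add_mem hx hy
    · rw [← hsup]
      refine iSup_le fun i => ?_
      have key : ∀ i, E i ≤ LinearMap.range Θ → F i ≤ LinearMap.range Θ := by
        intro i hi v hv
        rw [← sub_add_cancel v (s i (p i ⟨v, hv⟩))]
        exact Submodule.add_mem _ (hi (hs2 i ⟨v, hv⟩)) ⟨_, hΘ i _⟩
      induction i with
      | zero => exact key 0 (h0 ▸ bot_le)
      | succ i ih => exact key (i + 1) (hs i ▸ ih)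
  refine ⟨(LinearEquiv.ofInjective Θ hinj).trans (LinearEquiv.ofEq _ _ hrange), fun x v => ?_⟩
  refine Subtype.ext ?_
  change Θ (DirectSum.lmap (fun i => τ i x) v) = ρ x (Θ v)
  induction v using DirectSum.induction_on with
  | zero => simp only [map_zero]
  | of i y =>
    change Θ (DirectSum.lmap _ (DirectSum.lof ℂ ℕ Y i y)) = ρ x (Θ (DirectSum.lof ℂ ℕ Y i y))
    rw [DirectSum.lmap_lof, hΘ, hΘ, hs1]
  | add x y hx hy => simp only [map_add, hx, hy]

/-- The associated graded module of an exhaustive filtration of a completely reducible module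
is isomorphic to that module. -/
theorem LieRep.gr_iso (ρ : LieRep L V) (P : Submodule ℂ V) (hP : ∀ x, ∀ v ∈ P, ρ x v ∈ P)
    (h : ρ.HasComplements P) (E F : ℕ → Submodule ℂ V)
    (hE : ∀ i x, ∀ v ∈ E i, ρ x v ∈ E i) (hF : ∀ i x, ∀ v ∈ F i, ρ x v ∈ F i)
    (h0 : E 0 = ⊥) (hs : ∀ i, E (i + 1) = F i) (hmono : Monotone F) (hsup : ⨆ i, F i = P) :
    (LieRep.directSum fun i => (ρ.sub (F i) (hF i)).quot ((E i).submoduleOf (F i))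
      (fun x v hv => hE i x v hv)).Iso (ρ.sub P hP) := by
  have hFP : ∀ i, F i ≤ P := fun i => hsup ▸ le_iSup F i
  have hEF : ∀ i, E i ≤ F i := by
    rintro (_ | i)
    · rw [h0]; exact bot_le
    · rw [hs]; exact hmono (Nat.le_succ i)
  choose s hs1 hs2 using fun i => ρ.exists_section h (hE i) (hF i) (hEF i) (hFP i)
  exact ρ.directSum_iso_of_sections P hP E F h0 hs hmono hsup _
    (fun i => ((E i).submoduleOf (F i)).mkQ) (fun i => ((E i).submoduleOf (F i)).mkQ_surjective)
    (fun i v hv => (Submodule.Quotient.mk_eq_zero ((E i).submoduleOf (F i))).2 hv) s hs1 hs2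

end Graded

/-! ### Complete reducibility from an invariant Hermitian structure. -/

section Unitary

variable {r : ℕ} {V : Type*} [AddCommGroup V] [Module ℂ V]

/-- A representation of `gl_r` in which `E_ab` and `E_ba` are adjoint is completely reducible. -/
theorem hasComplements_of_adjoint {κ : Type*} [Fintype κ] (ρ : LieRep (gl r) V)
    (B : Module.Basis κ ℂ V)
    (hB : ∀ a b i j, B.repr (ρ (Matrix.single a b 1) (B i)) j =
      star (B.repr (ρ (Matrix.single b a 1) (B j)) i)) : ρ.HasComplements ⊤ := by
  intro S _ hS
  -- This makes `B` orthonormal. The orthogonal complement of an invariant subspace is invariant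
  -- because the adjoint of `E_ab` is `E_ba`.
  let Ψ : V ≃ₗ[ℂ] EuclideanSpace ℂ κ := B.equivFun.trans (WithLp.linearEquiv 2 ℂ (κ → ℂ)).symm
  have hΨ : ∀ v w, inner ℂ (Ψ v) (Ψ w) = ∑ i, star (B.repr v i) * B.repr w i := by
    intro v w
    rw [PiLp.inner_apply]
    exact Finset.sum_congr rfl fun i _ => mul_comm _ _
  have hrepr : ∀ (A : gl r) v j, B.repr (ρ A v) j = ∑ i, B.repr v i * B.repr (ρ A (B i)) j := by
    intro A v j
    have h := congrArg (fun u => B.repr (ρ A u) j) (B.sum_repr v)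
    simp only [map_sum, map_smul, Finsupp.finsetSum_apply, Finsupp.smul_apply, smul_eq_mul] at h
    exact h.symm
  have hadj : ∀ a b v w, inner ℂ (Ψ v) (Ψ (ρ (Matrix.single a b 1) w)) =
      inner ℂ (Ψ (ρ (Matrix.single b a 1) v)) (Ψ w) := by
    intro a b v w
    rw [hΨ, hΨ]
    rw [Finset.sum_congr rfl fun i _ => by rw [hrepr _ w],
      Finset.sum_congr (s₁ := Finset.univ) (f := fun i => star (B.repr (ρ _ v) i) * _) rfl
        fun i _ => by rw [hrepr _ v]]
    simp only [star_sum, star_mul', Finset.mul_sum, Finset.sum_mul]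
    rw [Finset.sum_comm]
    refine Finset.sum_congr rfl fun i _ => Finset.sum_congr rfl fun j _ => ?_
    rw [hB a b]
    ring
  have hcompl := Submodule.isCompl_orthogonal (K := S.map Ψ.toLinearMap)
  refine ⟨(S.map Ψ.toLinearMap)ᗮ.comap Ψ.toLinearMap, fun A v hv => ?_, ?_, ?_⟩
  · induction A using Matrix.induction_on' with
    | h_zero => rw [map_zero]; exact Submodule.zero_mem _
    | h_add A A' hA hA' => rw [map_add]; exact Submodule.add_mem _ hA hA'
    | h_std_basis a b c =>
      have hc : Matrix.single a b c = c • Matrix.single a b (1 : ℂ) := by simp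
      rw [hc, map_smul]
      refine Submodule.smul_mem _ c ((Submodule.mem_orthogonal _ _).2 ?_)
      rintro _ ⟨w, hw, rfl⟩
      change inner ℂ (Ψ w) (Ψ (ρ (Matrix.single a b 1) v)) = 0
      rw [hadj]
      exact (Submodule.mem_orthogonal _ _).1 hv _ ⟨_, hS _ w hw, rfl⟩
  · rw [Submodule.disjoint_def]
    intro v hv hv'
    have := (Submodule.disjoint_def.1 hcompl.disjoint) (Ψ v) ⟨v, hv, rfl⟩ hv'
    exact Ψ.map_eq_zero_iff.1 this
  · refine eq_top_iff.2 fun v _ => ?_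
    obtain ⟨_, ⟨w, hw, rfl⟩, c, hc, hwc⟩ :=
      Submodule.mem_sup.1 (hcompl.sup_eq_top ▸ Submodule.mem_top : Ψ v ∈ S.map Ψ.toLinearMap ⊔ _)
    refine Submodule.mem_sup.2 ⟨w, hw, Ψ.symm c, ?_, ?_⟩
    · rw [Submodule.mem_comap]
      exact (Ψ.apply_symm_apply c).symm ▸ hc
    · apply Ψ.injective
      rw [map_add, Ψ.apply_symm_apply]
      exact hwc

/-- The condition in the sum is unchanged when `(a, c)` and `(b, d)` are exchanged, and the entries
are real; this is the adjointness needed for complete reducibility. -/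
theorem tensorGlRep_single_repr {n : ℕ} (a b : Fin r) (c d : Fin n → Fin r) :
    (tpBasis r (Fin n)).repr (tensorGlRep r (Fin n) (Matrix.single a b 1) (tpBasis r (Fin n) c)) d =
      ∑ k, if c k = b ∧ d = Function.update c k a then 1 else 0 := by
  change (tpBasis r (Fin n)).repr ((∑ k, slot k (vrRep r (Matrix.single a b 1))) _) d = _
  rw [LinearMap.sum_apply, map_sum, Finsupp.finsetSum_apply]
  refine Finset.sum_congr rfl fun k _ => ?_
  have hE : vrRep r (Matrix.single a b 1) (vrBasis r (c k)) =
      (if c k = b then (1 : ℂ) else 0) • vrBasis r a := by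
    funext j
    change ∑ l, Matrix.single a b (1 : ℂ) j l * vrBasis r (c k) l =
      (if c k = b then (1 : ℂ) else 0) * vrBasis r a j
    rw [Finset.sum_eq_single b]
    · rw [vrBasis_apply, vrBasis_apply, Matrix.single_apply]
      simp [eq_comm, mul_comm]
    · intro l _ hl
      rw [Matrix.single_apply_of_col_ne _ _ hl.symm, zero_mul]
    · intro h; exact absurd (Finset.mem_univ b) h
  have h2 : (fun l => Function.update (fun _ => (1 : Module.End ℂ (Vr r))) k
      (vrRep r (Matrix.single a b 1)) l (vrBasis r (c l))) =
      Function.update (fun l => vrBasis r (Function.update c k a l)) k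
        ((if c k = b then (1 : ℂ) else 0) • vrBasis r (Function.update c k a k)) := by
    funext l
    by_cases h : l = k
    · subst h; simp only [Function.update_self]; exact hE
    · simp [h]
  rw [tpBasis_apply, slot_tprod, h2, MultilinearMap.map_update_smul, Function.update_eq_self,
    ← tpBasis_apply, map_smul, Finsupp.smul_apply, Module.Basis.repr_self, Finsupp.single_apply,
    smul_eq_mul, ite_mul, one_mul, zero_mul, ← ite_and]
  simp only [eq_comm]

theorem hasComplements_leftGlRep (r n : ℕ) (M : Type*) [AddCommGroup M] [Module ℂ M]
    [FiniteDimensional ℂ M] : (leftGlRep r n M).HasComplements ⊤ := by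
  refine hasComplements_of_adjoint (leftGlRep r n M)
    ((tpBasis r (Fin n)).tensorProduct (Module.finBasis ℂ M)) ?_
  rintro a b ⟨c, i⟩ ⟨d, j⟩
  have h : ∀ (a b : Fin r) (c d : Fin n → Fin r) (i j),
      ((tpBasis r (Fin n)).tensorProduct (Module.finBasis ℂ M)).repr
        (leftGlRep r n M (Matrix.single a b 1)
          ((tpBasis r (Fin n)).tensorProduct (Module.finBasis ℂ M) (c, i))) (d, j) =
      (∑ k, if c k = b ∧ d = Function.update c k a then 1 else 0) * if i = j then 1 else 0 := by
    intro a b c d i j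
    rw [← tensorGlRep_single_repr, Module.Basis.tensorProduct_apply]
    change ((tpBasis r (Fin n)).tensorProduct (Module.finBasis ℂ M)).repr
        ((tensorGlRep r (Fin n) (Matrix.single a b 1) (tpBasis r (Fin n) c)) ⊗ₜ[ℂ]
          Module.finBasis ℂ M i) (d, j) = _
    rw [Module.Basis.tensorProduct_repr_tmul_apply, Module.Basis.repr_self, Finsupp.single_apply,
      smul_eq_mul, mul_comm]
  rw [h, h]
  simp only [star_mul', star_sum, apply_ite (star : ℂ → ℂ), star_one, star_zero]
  congr 1
  · refine Finset.sum_congr rfl fun k _ => if_congr ⟨?_, ?_⟩ rfl rfl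
    · rintro ⟨rfl, rfl⟩
      simp
    · rintro ⟨rfl, rfl⟩
      simp
  · exact if_congr eq_comm rfl rfl

end Unitary

/-! ## Wedges of basis vectors -/

section Levels

variable (N : ℤ)

/-- The class of `x^(N - 1 - l)`. -/
def lvec (l : ℕ) : Trunc N := (tailSub N).mkQ (LaurentPolynomial.T (N - 1 - l))

/-- The coefficient at `x^(N - 1 - l)`. -/
def lcoeff (l : ℕ) : Trunc N →ₗ[ℂ] ℂ :=
  (tailSub N).liftQ (Finsupp.lapply (N - 1 - l) ∘ₗ
    (AddMonoidAlgebra.coeffLinearEquiv ℂ).toLinearMap) <| by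
    rw [tailSub, Submodule.span_le]
    rintro _ ⟨i, hi, rfl⟩
    change (Finsupp.single i (1 : ℂ)) (N - 1 - l) = 0
    exact Finsupp.single_eq_of_ne (by omega)

theorem lcoeff_lvec (l m : ℕ) : lcoeff N l (lvec N m) = if m = l then 1 else 0 := by
  change (Finsupp.single (N - 1 - (m : ℤ)) (1 : ℂ)) (N - 1 - l) = _
  rw [Finsupp.single_apply]
  exact if_congr (by omega) rfl rfl

theorem xyAct_X_lvec_zero : xyAct N XYAlg.X (lvec N 0) = 0 := by
  rw [xyAct, XYAlg.X, RingQuot.liftAlgHom_mkAlgHom_apply, FreeAlgebra.lift_ι_apply]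
  change (tailSub N).mkQ (mulX _) = 0
  rw [mulX_T, Submodule.mkQ_apply, Submodule.Quotient.mk_eq_zero]
  exact Submodule.subset_span ⟨_, by push_cast; omega, rfl⟩

theorem xyAct_X_lvec_succ (l : ℕ) : xyAct N XYAlg.X (lvec N (l + 1)) = lvec N l := by
  rw [xyAct, XYAlg.X, RingQuot.liftAlgHom_mkAlgHom_apply, FreeAlgebra.lift_ι_apply]
  change (tailSub N).mkQ (mulX _) = _
  rw [mulX_T, lvec]
  congr 2
  push_cast
  ring

theorem xyAct_Y_lvec (l : ℕ) :
    xyAct N XYAlg.Y (lvec N l) = ((N - 1 - l : ℤ) : ℂ) • lvec N l := by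
  rw [xyAct, XYAlg.Y, RingQuot.liftAlgHom_mkAlgHom_apply, FreeAlgebra.lift_ι_apply]
  change (tailSub N).mkQ (euler _) = _
  rw [euler_T, map_smul, lvec]

theorem xyAct_X_pow_lvec (k l : ℕ) : xyAct N (XYAlg.X ^ k) (lvec N (l + k)) = lvec N l := by
  induction k with
  | zero => simp
  | succ k ih =>
    rw [pow_succ, map_mul, Module.End.mul_apply, ← add_assoc, xyAct_X_lvec_succ, ih]

theorem xyAct_aeval_Y_lvec (p : Polynomial ℂ) (l : ℕ) :
    xyAct N (Polynomial.aeval XYAlg.Y p) (lvec N l) =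
      p.eval ((N - 1 - l : ℤ) : ℂ) • lvec N l := by
  rw [← Polynomial.aeval_algHom_apply]
  exact Module.End.aeval_apply_of_mem_apply_eq_smul (xyAct_Y_lvec N l)

/-- The span of the powers `x^(N - 1 - m)` with `m ≤ l`. -/
def levelSpan (l : ℕ) : Submodule ℂ (Trunc N) := Submodule.span ℂ (lvec N '' Set.Iic l)

/-- Both generators preserve the span of the levels up to `l`: `X` lowers the level and `Y` is
diagonal. This triangularity is what keeps wedges within the parking condition. -/
theorem xyAct_lvec_mem (q : XYAlg) (l : ℕ) : xyAct N q (lvec N l) ∈ levelSpan N l := by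
  have key : ∀ q : XYAlg, ∀ l, ∀ v ∈ levelSpan N l, xyAct N q v ∈ levelSpan N l := by
    intro q
    obtain ⟨q, rfl⟩ := RingQuot.mkAlgHom_surjective ℂ XYRel q
    induction q using FreeAlgebra.induction with
    | grade0 c =>
      intro l v hv
      rw [AlgHom.commutes, AlgHom.commutes]
      exact Submodule.smul_mem _ c hv
    | grade1 x =>
      intro l v hv
      induction hv using Submodule.span_induction with
      | mem v hv =>
        obtain ⟨m, hm, rfl⟩ := hv
        fin_cases x
        · change xyAct N XYAlg.X _ ∈ _
          cases m with
          | zero => rw [xyAct_X_lvec_zero]; exact Submodule.zero_mem _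
          | succ m =>
            rw [xyAct_X_lvec_succ]
            exact Submodule.subset_span ⟨m, (Nat.le_succ m).trans hm, rfl⟩
        · change xyAct N XYAlg.Y _ ∈ _
          rw [xyAct_Y_lvec]
          exact Submodule.smul_mem _ _ (Submodule.subset_span ⟨m, hm, rfl⟩)
      | zero => rw [map_zero]; exact Submodule.zero_mem _
      | add v w _ _ hv hw => rw [map_add]; exact Submodule.add_mem _ hv hw
      | smul c v _ hv => rw [map_smul]; exact Submodule.smul_mem _ c hv
    | mul a b ha hb =>
      intro l v hv
      rw [map_mul, map_mul]
      exact ha l _ (hb l v hv)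
    | add a b ha hb =>
      intro l v hv
      rw [map_add, map_add]
      exact Submodule.add_mem _ (ha l v hv) (hb l v hv)
  exact key q l _ (Submodule.subset_span ⟨l, Set.mem_Iic.2 le_rfl, rfl⟩)

variable {r : ℕ}

/-- The basis vector `u_j ⊗ x^(N - 1 - l)`. -/
def uBasis (p : ℕ × Fin r) : VrN r N := Pi.single p.2 (lvec N p.1)

theorem vrnRep_apply (g : GXY r) (w : VrN r N) (i : Fin r) :
    vrnRep r N g w i = ∑ j, xyAct N (g i j) (w j) :=
  rfl

theorem vrnRep_single (g : GXY r) (j : Fin r) (t : Trunc N) :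
    vrnRep r N g (Pi.single j t) = fun i => xyAct N (g i j) t := by
  funext i
  rw [vrnRep_apply, Finset.sum_eq_single j]
  · rw [Pi.single_eq_same]
  · intro k _ hk
    rw [Pi.single_eq_of_ne hk, map_zero]
  · intro h; exact absurd (Finset.mem_univ j) h

theorem vrnRep_uBasis_mem (g : GXY r) (p : ℕ × Fin r) :
    vrnRep r N g (uBasis N p) ∈ Submodule.span ℂ (uBasis N '' {q : ℕ × Fin r | q.1 ≤ p.1}) := by
  rw [uBasis, vrnRep_single, ← Finset.univ_sum_single (fun i => xyAct N (g i p.2) (lvec N p.1))]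
  refine Submodule.sum_mem _ fun i _ => ?_
  have h := xyAct_lvec_mem N (g i p.2) p.1
  refine Submodule.span_induction (p := fun v _ => Pi.single i v ∈
    Submodule.span ℂ (uBasis N '' {q : ℕ × Fin r | q.1 ≤ p.1})) ?_ ?_ ?_ ?_ h
  · rintro _ ⟨m, hm, rfl⟩
    exact Submodule.subset_span ⟨(m, i), hm, rfl⟩
  · rw [Pi.single_zero]; exact Submodule.zero_mem _
  · intro v w _ _ hv hw
    rw [Pi.single_add]; exact Submodule.add_mem _ hv hw
  · intro c v _ hv
    rw [Pi.single_smul]; exact Submodule.smul_mem _ c hv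

end Levels

/-! ### The derivation action on wedges, and coefficient functionals. -/

section Wedges

variable {V : Type*} [AddCommGroup V] [Module ℂ V]

theorem extDer_ιMulti (f : Module.End ℂ V) {n : ℕ} (v : Fin n → V) :
    extDer f (ExteriorAlgebra.ιMulti ℂ n v) =
      ∑ k, ExteriorAlgebra.ιMulti ℂ n (Function.update v k (f (v k))) := by
  induction n with
  | zero =>
    simp only [ExteriorAlgebra.ιMulti_zero_apply, Finset.univ_eq_empty, Finset.sum_empty]
    rw [← map_one (algebraMap ℂ (ExteriorAlgebra ℂ V)), extDer_algebraMap]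
  | succ n ih =>
    rw [ExteriorAlgebra.ιMulti_succ_apply, extDer_mul, ih, extDer_ι, Fin.sum_univ_succ,
      Finset.mul_sum, add_comm]
    congr 1
    · rw [ExteriorAlgebra.ιMulti_succ_apply, Function.update_self]
      congr 2
    · refine Finset.sum_congr rfl fun k _ => ?_
      rw [ExteriorAlgebra.ιMulti_succ_apply, Function.update_of_ne (Fin.succ_ne_zero k).symm]
      congr 2
      exact (Fin.tail_update_succ v k _).symm

/-- The wedge product of the vectors `u_(c k) ⊗ x^(N - 1 - f k)`, where `g k = (f k, c k)`. -/
def wedge {r n : ℕ} (N : ℤ) (g : Fin n → ℕ × Fin r) : ExteriorAlgebra ℂ (VrN r N) :=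
  ExteriorAlgebra.ιMulti ℂ n fun k => uBasis N (g k)

theorem wedge_perm {r n : ℕ} (N : ℤ) (g : Fin n → ℕ × Fin r) (σ : Equiv.Perm (Fin n)) :
    wedge N (fun k => g (σ k)) = ((Equiv.Perm.sign σ : ℤ) : ℂ) • wedge N g := by
  have := (ExteriorAlgebra.ιMulti ℂ n).map_perm (fun k => uBasis N (g k)) σ
  rw [Units.smul_def, ← Int.cast_smul_eq_zsmul ℂ] at this
  exact this

theorem wedge_eq_zero {r n : ℕ} (N : ℤ) (g : Fin n → ℕ × Fin r) (h : ¬ Function.Injective g) :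
    wedge N g = 0 :=
  AlternatingMap.map_eq_zero_of_not_injective _ _ fun h' =>
    h (Function.Injective.of_comp (f := uBasis N) h')

/-- The functional on the exterior algebra that is the coefficient at the wedge `g`. -/
def wedgeCoeff {r n : ℕ} (N : ℤ) (g : Fin n → ℕ × Fin r) : ExteriorAlgebra ℂ (VrN r N) →ₗ[ℂ] ℂ :=
  ExteriorAlgebra.liftAlternating <| Function.update 0 n <|
    (Matrix.detRowAlternating (R := ℂ) (n := Fin n)).compLinearMap
      (LinearMap.pi fun k => lcoeff N (g k).1 ∘ₗ LinearMap.proj (g k).2)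

/-- The functional is the determinant of the coordinates at `g`; on a wedge of basis vectors the
matrix has entries 0 and 1, and a permutation contributes only if it matches `h` with `g`. -/
theorem wedgeCoeff_wedge {r n : ℕ} (N : ℤ) (g h : Fin n → ℕ × Fin r) :
    wedgeCoeff N g (wedge N h) =
      ∑ σ : Equiv.Perm (Fin n),
        if (fun k => h (σ k)) = g then ((Equiv.Perm.sign σ : ℤ) : ℂ) else 0 := by
  rw [wedgeCoeff, wedge, ExteriorAlgebra.liftAlternating_apply_ιMulti, Function.update_self]
  change Matrix.det (Matrix.of fun i k => lcoeff N (g k).1 (uBasis N (h i) (g k).2)) = _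
  have h1 : ∀ i k, lcoeff N (g k).1 (uBasis N (h i) (g k).2) = if h i = g k then 1 else 0 := by
    intro i k
    rw [uBasis, Pi.single_apply]
    split_ifs with h1 h2 h2
    · rw [lcoeff_lvec, if_pos (by rw [h2])]
    · rw [lcoeff_lvec, if_neg fun h3 => h2 (Prod.ext h3 h1.symm)]
    · exact absurd (by rw [h2]) h1
    · exact map_zero _
  rw [Matrix.det_apply]
  refine Finset.sum_congr rfl fun σ _ => ?_
  simp only [Matrix.of_apply, h1, Finset.prod_ite_zero, Finset.prod_const_one]
  simp [funext_iff, Units.smul_def]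

end Wedges

/-! ## The map from `V_r^{⊗ n} ⊗ ℂPF ⊗ Sign` to the exterior algebra -/

section ParkingWedges

variable {r n : ℕ} (N : ℤ) {ρ : List ℕ}

/-- The underlying function of a parking function. -/
def PF.fn (f : PF n ρ) : Fin n → Fin n := f.1

theorem PF.fn_injective : Function.Injective (PF.fn (n := n) (ρ := ρ)) :=
  Subtype.val_injective

theorem PF.fn_smul (σ : Equiv.Perm (Fin n)) (f : PF n ρ) (k : Fin n) :
    (σ • f).fn k = f.fn (σ⁻¹ k) := rfl

/-- The map `w ↦ w ⊗ t`. -/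
def tens (r : ℕ) (t : Trunc N) : Vr r →ₗ[ℂ] VrN r N where
  toFun w := fun i => w i • t
  map_add' v w := funext fun i => add_smul (v i) (w i) t
  map_smul' c v := funext fun i => mul_smul c (v i) t

/-- The map `w₁ ⊗ ⋯ ⊗ w_n ↦ ∧ w_k ⊗ x^(N - 1 - f k)`. -/
def tensWedge (r : ℕ) (f : Fin n → ℕ) :
    TPow (Fin n) (Vr r) →ₗ[ℂ] ExteriorAlgebra ℂ (VrN r N) :=
  PiTensorProduct.lift ((ExteriorAlgebra.ιMulti ℂ n).toMultilinearMap.compLinearMap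
    fun k => tens N r (lvec N (f k)))

theorem tensWedge_tprod (f : Fin n → ℕ) (w : Fin n → Vr r) :
    tensWedge N r f (PiTensorProduct.tprod ℂ w) =
      ExteriorAlgebra.ιMulti ℂ n fun k => tens N r (lvec N (f k)) (w k) :=
  PiTensorProduct.lift.tprod _

theorem tensWedge_basis (f : Fin n → ℕ) (c : Fin n → Fin r) :
    tensWedge N r f (tpBasis r (Fin n) c) = wedge N fun k => (f k, c k) := by
  rw [tpBasis_apply, tensWedge_tprod, wedge]
  congr 1
  funext k i
  change vrBasis r (c k) i • lvec N (f k) = _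
  rw [vrBasis_apply, uBasis, Pi.single_apply, ite_smul, one_smul, zero_smul]

/-- Constant matrices act only on the factor `V_r` and leave the powers of `x` unchanged, so both
actions are the same sum over positions. -/
theorem extGlRep_tensWedge (A : gl r) (f : Fin n → ℕ) (w : TPow (Fin n) (Vr r)) :
    extGlRep r N A (tensWedge N r f w) = tensWedge N r f (tensorGlRep r (Fin n) A w) := by
  have htens : ∀ t w, vrnRep r N (glConst r A) (tens N r t w) = tens N r t (vrRep r A w) := by
    intro t w
    funext i
    rw [vrnRep_apply]
    have h : ∀ j, xyAct N (glConst r A i j) (tens N r t w j) = (A i j * w j) • t := by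
      intro j
      change xyAct N (algebraMap ℂ XYAlg (A i j)) (w j • t) = _
      rw [AlgHom.commutes, Module.algebraMap_end_apply, mul_smul]
    rw [Finset.sum_congr rfl fun j _ => h j, ← Finset.sum_smul]
    rfl
  have key : (show Module.End ℂ _ from extGlRep r N A) ∘ₗ tensWedge N r f =
      tensWedge N r f ∘ₗ tensorGlRep r (Fin n) A := by
    apply PiTensorProduct.ext
    apply MultilinearMap.ext
    intro w
    simp only [LinearMap.compMultilinearMap_apply, LinearMap.comp_apply]
    change extDer (vrnRep r N (glConst r A)) _ =
      tensWedge N r f ((∑ k, slot k (vrRep r A)) (PiTensorProduct.tprod ℂ w))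
    rw [tensWedge_tprod, extDer_ιMulti, LinearMap.sum_apply, map_sum]
    refine Finset.sum_congr rfl fun k _ => ?_
    rw [slot_tprod, tensWedge_tprod]
    congr 1
    funext l
    by_cases h : l = k
    · subst h; simp only [Function.update_self, htens]
    · simp [h]
  exact LinearMap.congr_fun key w

/-- The map from `V_r^{⊗ n} ⊗ ℂPF_n(ρ) ⊗ Sign` to the exterior algebra of `V_r^{(N)}`. -/
def pfWedge (r n : ℕ) (ρ : List ℕ) :
    (TPow (Fin n) (Vr r)) ⊗[ℂ] (MonoidAlgebra ℂ (PF n ρ) ⊗[ℂ] ℂ) →ₗ[ℂ]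
      ExteriorAlgebra ℂ (VrN r N) :=
  TensorProduct.lift (LinearMap.flip
    (Finsupp.lsum ℂ (fun f : PF n ρ => LinearMap.toSpanSingleton ℂ _
        (tensWedge N r fun k => (f.fn k : ℕ))) ∘ₗ
      (MonoidAlgebra.coeffLinearEquiv ℂ).toLinearMap ∘ₗ (TensorProduct.rid ℂ _).toLinearMap))

theorem pfWedge_tmul (w : TPow (Fin n) (Vr r)) (f : PF n ρ) (z : ℂ) :
    pfWedge N r n ρ (w ⊗ₜ[ℂ] (MonoidAlgebra.single f 1 ⊗ₜ[ℂ] z)) =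
      z • tensWedge N r (fun k => (f.fn k : ℕ)) w := by
  rw [pfWedge, TensorProduct.lift.tmul, LinearMap.flip_apply, LinearMap.comp_apply,
    LinearMap.comp_apply, LinearEquiv.coe_coe, LinearEquiv.coe_coe, TensorProduct.rid_tmul, map_smul,
    map_smul,
    LinearMap.smul_apply]
  congr 1
  change Finsupp.lsum ℂ (fun f : PF n ρ => LinearMap.toSpanSingleton ℂ
    (TPow (Fin n) (Vr r) →ₗ[ℂ] ExteriorAlgebra ℂ (VrN r N)) (tensWedge N r fun k => (f.fn k : ℕ)))
    (Finsupp.single f (1 : ℂ)) w = _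
  rw [Finsupp.lsum_single, LinearMap.toSpanSingleton_apply, one_smul]

theorem tensor_pf_ext {X : Type*} [AddCommGroup X] [Module ℂ X]
    {F G : (TPow (Fin n) (Vr r)) ⊗[ℂ] (MonoidAlgebra ℂ (PF n ρ) ⊗[ℂ] ℂ) →ₗ[ℂ] X}
    (h : ∀ c f, F (tpBasis r (Fin n) c ⊗ₜ[ℂ] (MonoidAlgebra.single f 1 ⊗ₜ[ℂ] 1)) =
      G (tpBasis r (Fin n) c ⊗ₜ[ℂ] (MonoidAlgebra.single f 1 ⊗ₜ[ℂ] 1))) : F = G :=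
  TensorProduct.ext ((tpBasis r (Fin n)).ext fun c => TensorProduct.ext
    (MonoidAlgebra.lhom_ext' fun f => LinearMap.ext_ring (LinearMap.ext_ring (h c f))))

theorem pfWedge_leftGl (A : gl r)
    (x : (TPow (Fin n) (Vr r)) ⊗[ℂ] (MonoidAlgebra ℂ (PF n ρ) ⊗[ℂ] ℂ)) :
    pfWedge N r n ρ (leftGlRep r n _ A x) = extGlRep r N A (pfWedge N r n ρ x) := by
  have key : pfWedge N r n ρ ∘ₗ leftGlRep r n _ A =
      (show Module.End ℂ _ from extGlRep r N A) ∘ₗ pfWedge N r n ρ := by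
    refine tensor_pf_ext fun c f => ?_
    rw [LinearMap.comp_apply, LinearMap.comp_apply]
    change pfWedge N r n ρ (tensorGlRep r (Fin n) A (tpBasis r (Fin n) c) ⊗ₜ[ℂ]
      (MonoidAlgebra.single f 1 ⊗ₜ[ℂ] 1)) = _
    rw [pfWedge_tmul, pfWedge_tmul, one_smul, one_smul]
    exact (extGlRep_tensWedge N A _ _).symm
  exact LinearMap.congr_fun key x

theorem tprod_pfSignRep_tmul (σ : Equiv.Perm (Fin n)) (c : Fin n → Fin r) (f : PF n ρ) :
    (tensorPermRep r n).tprod (pfSignRep n ρ) σ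
        (tpBasis r (Fin n) c ⊗ₜ[ℂ] (MonoidAlgebra.single f 1 ⊗ₜ[ℂ] 1)) =
      tpBasis r (Fin n) (fun k => c (σ⁻¹ k)) ⊗ₜ[ℂ]
        (MonoidAlgebra.single (σ • f) 1 ⊗ₜ[ℂ] ((Equiv.Perm.sign σ : ℤ) : ℂ)) := by
  rw [Representation.tprod_apply, TensorProduct.map_tmul, tensorPermRep_basis, pfSignRep,
    Representation.tprod_apply, TensorProduct.map_tmul, pfRep, Representation.ofMulAction_single]
  congr 2
  change ((Equiv.Perm.sign σ : ℤ) : ℂ) • (1 : ℂ) = _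
  rw [smul_eq_mul, mul_one]

/-- Permuting the indices and the parking function simultaneously reorders the wedge, and the
resulting sign is cancelled by `Sign`. -/
theorem pfWedge_perm (σ : Equiv.Perm (Fin n))
    (x : (TPow (Fin n) (Vr r)) ⊗[ℂ] (MonoidAlgebra ℂ (PF n ρ) ⊗[ℂ] ℂ)) :
    pfWedge N r n ρ ((tensorPermRep r n).tprod (pfSignRep n ρ) σ x) = pfWedge N r n ρ x := by
  have key : pfWedge N r n ρ ∘ₗ (tensorPermRep r n).tprod (pfSignRep n ρ) σ = pfWedge N r n ρ := by
    refine tensor_pf_ext fun c f => ?_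
    rw [LinearMap.comp_apply, tprod_pfSignRep_tmul, pfWedge_tmul, pfWedge_tmul, one_smul,
      tensWedge_basis, tensWedge_basis]
    simp only [PF.fn_smul]
    rw [wedge_perm N (fun k => ((f.fn k : ℕ), c k)) σ⁻¹, smul_smul, Equiv.Perm.sign_inv,
      ← Int.cast_mul, ← Units.val_mul,
      Int.units_mul_self, Units.val_one, Int.cast_one, one_smul]
  exact LinearMap.congr_fun key x

/-- The coefficient at a basis vector. -/
def pfCoeff (c : Fin n → Fin r) (f : PF n ρ) :
    (TPow (Fin n) (Vr r)) ⊗[ℂ] (MonoidAlgebra ℂ (PF n ρ) ⊗[ℂ] ℂ) →ₗ[ℂ] ℂ :=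
  Finsupp.lapply f ∘ₗ (MonoidAlgebra.coeffLinearEquiv ℂ).toLinearMap ∘ₗ
    (TensorProduct.rid ℂ _).toLinearMap ∘ₗ tcoeff c

open Classical in
theorem pfCoeff_tmul (c d : Fin n → Fin r) (f g : PF n ρ) (z : ℂ) :
    pfCoeff c f (tpBasis r (Fin n) d ⊗ₜ[ℂ] (MonoidAlgebra.single g 1 ⊗ₜ[ℂ] z)) =
      if d = c ∧ g = f then z else 0 := by
  simp only [pfCoeff, LinearMap.comp_apply, LinearEquiv.coe_coe]
  rw [tcoeff_tmul, Module.Basis.repr_self, map_smul, TensorProduct.rid_tmul, map_smul, map_smul,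
    map_smul, map_smul]
  change _ • z • (Finsupp.single g (1 : ℂ)) f = _
  rw [Finsupp.single_apply, Finsupp.single_apply]
  by_cases h1 : d = c <;> by_cases h2 : g = f <;> simp [h1, h2]

/-- On an invariant tensor all terms of the sum agree, so the wedge determines every coefficient;
this gives injectivity on the invariants. -/
theorem wedgeCoeff_pfWedge (c : Fin n → Fin r) (f : PF n ρ)
    (x : (TPow (Fin n) (Vr r)) ⊗[ℂ] (MonoidAlgebra ℂ (PF n ρ) ⊗[ℂ] ℂ)) :
    wedgeCoeff N (fun k => ((f.fn k : ℕ), c k)) (pfWedge N r n ρ x) =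
      ∑ σ, pfCoeff c f ((tensorPermRep r n).tprod (pfSignRep n ρ) σ x) := by
  classical
  have key : wedgeCoeff N (fun k => ((f.fn k : ℕ), c k)) ∘ₗ pfWedge N r n ρ =
      ∑ σ, pfCoeff c f ∘ₗ (tensorPermRep r n).tprod (pfSignRep n ρ) σ := by
    refine tensor_pf_ext fun d g => ?_
    rw [LinearMap.comp_apply, pfWedge_tmul, one_smul, tensWedge_basis, wedgeCoeff_wedge,
      LinearMap.sum_apply]
    refine Fintype.sum_equiv (Equiv.inv _) _ _ fun σ => ?_
    rw [LinearMap.comp_apply, tprod_pfSignRep_tmul, pfCoeff_tmul, Equiv.inv_apply,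
      Equiv.Perm.sign_inv, inv_inv]
    refine if_congr ⟨fun h => ⟨?_, PF.fn_injective ?_⟩, fun h => ?_⟩ rfl rfl
    · funext k
      exact congrArg Prod.snd (congrFun h k)
    · funext k
      rw [PF.fn_smul, inv_inv]
      exact Fin.ext (congrArg Prod.fst (congrFun h k))
    · funext k
      refine Prod.ext ?_ (congrFun h.1 k)
      have h2 := congrFun (congrArg PF.fn h.2) k
      rw [PF.fn_smul, inv_inv] at h2
      exact congrArg Fin.val h2
  rw [← LinearMap.comp_apply, key, LinearMap.sum_apply]
  rfl

theorem eq_zero_of_pfWedge_eq_zero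
    {x : (TPow (Fin n) (Vr r)) ⊗[ℂ] (MonoidAlgebra ℂ (PF n ρ) ⊗[ℂ] ℂ)}
    (hx : x ∈ SWInv r (pfSignRep n ρ)) (h : pfWedge N r n ρ x = 0) : x = 0 := by
  refine eq_zero_of_tcoeff fun c => ?_
  apply (TensorProduct.rid ℂ (MonoidAlgebra ℂ (PF n ρ))).injective
  apply (MonoidAlgebra.coeffLinearEquiv ℂ).injective
  rw [map_zero, map_zero]
  refine Finsupp.ext fun f => ?_
  have h1 := wedgeCoeff_pfWedge N c f x
  rw [h, map_zero, Finset.sum_congr rfl fun σ _ => by rw [hx σ], Finset.sum_const,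
    ← Nat.cast_smul_eq_nsmul ℂ, eq_comm, smul_eq_zero,
    or_iff_right (Nat.cast_ne_zero.2 (Finset.card_ne_zero.2 ⟨1, Finset.mem_univ _⟩))] at h1
  exact h1

theorem range_pfWedge : LinearMap.range (pfWedge N r n ρ) =
    Submodule.span ℂ (Set.range fun p : PF n ρ × (Fin n → Fin r) =>
      wedge N fun k => ((p.1.fn k : ℕ), p.2 k)) := by
  refine le_antisymm ?_ ?_
  · rw [LinearMap.range_le_iff_comap, eq_top_iff]
    set S := Submodule.span ℂ (Set.range fun p : PF n ρ × (Fin n → Fin r) =>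
      wedge N fun k => ((p.1.fn k : ℕ), p.2 k))
    have key : S.mkQ ∘ₗ pfWedge N r n ρ = 0 := by
      refine tensor_pf_ext fun c f => ?_
      rw [LinearMap.comp_apply, pfWedge_tmul, one_smul, tensWedge_basis, LinearMap.zero_apply,
        Submodule.mkQ_apply, Submodule.Quotient.mk_eq_zero]
      exact Submodule.subset_span ⟨(f, c), rfl⟩
    intro x _
    exact (Submodule.Quotient.mk_eq_zero S).1 (LinearMap.congr_fun key x)
  · rw [Submodule.span_le]
    rintro _ ⟨⟨f, c⟩, rfl⟩
    refine ⟨tpBasis r (Fin n) c ⊗ₜ[ℂ] (MonoidAlgebra.single f 1 ⊗ₜ[ℂ] 1), ?_⟩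
    rw [pfWedge_tmul, one_smul, tensWedge_basis]

theorem range_pfWedge_stable (n : ℕ) (ρ : List ℕ) (A : gl r) :
    ∀ v ∈ LinearMap.range (pfWedge N r n ρ), extGlRep r N A v ∈
      LinearMap.range (pfWedge N r n ρ) := by
  rintro _ ⟨x, rfl⟩
  exact ⟨_, pfWedge_leftGl N A x⟩

theorem swInvRep_iso_range_pfWedge (n : ℕ) (ρ : List ℕ) : (swInvRep r (pfSignRep n ρ)).Iso
    ((extGlRep r N).sub (LinearMap.range (pfWedge N r n ρ)) (range_pfWedge_stable N n ρ)) := by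
  let F : SWInv r (pfSignRep n ρ) →ₗ[ℂ] ExteriorAlgebra ℂ (VrN r N) :=
    pfWedge N r n ρ ∘ₗ (SWInv r (pfSignRep n ρ)).subtype
  have hF : Function.Injective F := by
    intro x y hxy
    have h1 : pfWedge N r n ρ x.1 = pfWedge N r n ρ y.1 := hxy
    exact Subtype.ext (sub_eq_zero.1 (eq_zero_of_pfWedge_eq_zero N (Submodule.sub_mem _ x.2 y.2)
      (by rw [map_sub, h1, sub_self])))
  have hrange : LinearMap.range F = LinearMap.range (pfWedge N r n ρ) := by
    refine le_antisymm ?_ ?_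
    · rintro _ ⟨x, rfl⟩
      exact ⟨x.1, rfl⟩
    · rintro _ ⟨x, rfl⟩
      -- Surjectivity: symmetrizing a tensor only multiplies its image by `n!`.
      have h1 : pfWedge N r n ρ (permSum (pfSignRep n ρ) x) =
          ((Finset.univ : Finset (Equiv.Perm (Fin n))).card : ℂ) • pfWedge N r n ρ x := by
        rw [permSum_apply, map_sum, Finset.sum_congr rfl fun σ _ => pfWedge_perm N σ x,
          Finset.sum_const, Nat.cast_smul_eq_nsmul]
      have h2 : ((Finset.univ : Finset (Equiv.Perm (Fin n))).card : ℂ) ≠ 0 :=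
        Nat.cast_ne_zero.2 (Finset.card_ne_zero.2 ⟨1, Finset.mem_univ _⟩)
      rw [← inv_smul_smul₀ h2 (pfWedge N r n ρ x), ← h1]
      exact Submodule.smul_mem _ _ ⟨⟨_, permSum_mem _ x⟩, rfl⟩
  exact ⟨(LinearEquiv.ofInjective F hF).trans (LinearEquiv.ofEq _ _ hrange), fun A x =>
    Subtype.ext (pfWedge_leftGl N A x.1)⟩

end ParkingWedges

/-! ## The operators of `gl_r ⊗ ℂ⟨X, Y⟩` on wedges -/

section Operators

variable {r n : ℕ} (N : ℤ)

theorem IsParking.mono {ρ : List ℕ} {f f' : Fin n → Fin n} (h : IsParking ρ f)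
    (h' : ∀ k, f' k ≤ f k) : IsParking ρ f' := fun s h1 h2 =>
  (h s h1 h2).trans (Finset.card_le_card fun k hk => by
    have := (Finset.mem_filter.1 hk).2
    have := Fin.le_def.1 (h' k)
    exact Finset.mem_filter.2 ⟨Finset.mem_univ k, by omega⟩)

/-- The span of the parking wedges is invariant under `gl_r ⊗ ℂ⟨X, Y⟩`. -/
theorem extVrnRep_range_pfWedge (ρ : List ℕ) (A : GXY r) :
    ∀ v ∈ LinearMap.range (pfWedge N r n ρ), extVrnRep r N A v ∈
      LinearMap.range (pfWedge N r n ρ) := by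
  intro v hv
  rw [range_pfWedge] at hv
  induction hv using Submodule.span_induction with
  | mem v hv =>
    obtain ⟨⟨f, c⟩, rfl⟩ := hv
    change extDer (vrnRep r N A)
      (ExteriorAlgebra.ιMulti ℂ n fun k => uBasis N ((f.fn k : ℕ), c k)) ∈ _
    rw [extDer_ιMulti]
    refine Submodule.sum_mem _ fun k _ => ?_
    refine Submodule.span_induction (p := fun x _ => ExteriorAlgebra.ιMulti ℂ n
      (Function.update (fun k => uBasis N ((f.fn k : ℕ), c k)) k x) ∈
        LinearMap.range (pfWedge N r n ρ)) ?_ ?_ ?_ ?_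
        (vrnRep_uBasis_mem N A ((f.fn k : ℕ), c k))
    · rintro _ ⟨⟨m, j⟩, hm, rfl⟩
      have hm' : m ≤ f.fn k := hm
      rw [range_pfWedge]
      -- Lowering one value of a parking function leaves it a parking function; the index `j` in
      -- `V_r` is unrestricted.
      refine Submodule.subset_span ⟨(⟨Function.update f.fn k ⟨m, hm'.trans_lt (f.fn k).2⟩,
        IsParking.mono f.2 fun l => ?_⟩, Function.update c k j), ?_⟩
      · rcases eq_or_ne l k with rfl | hl
        · rw [Function.update_self]; exact hm'
        · rw [Function.update_of_ne hl]; exact le_rfl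
      · change ExteriorAlgebra.ιMulti ℂ n _ = _
        congr 1
        funext l
        rcases eq_or_ne l k with rfl | hl
        · simp [PF.fn]
        · simp [PF.fn, hl]
    · rw [AlternatingMap.map_update_zero]; exact Submodule.zero_mem _
    · intro x y _ _ hx hy
      rw [AlternatingMap.map_update_add]; exact Submodule.add_mem _ hx hy
    · intro a x _ hx
      rw [AlternatingMap.map_update_smul]; exact Submodule.smul_mem _ a hx
  | zero => rw [map_zero]; exact Submodule.zero_mem _
  | add v w _ _ hv hw => rw [map_add]; exact Submodule.add_mem _ hv hw
  | smul a v _ hv => rw [map_smul]; exact Submodule.smul_mem _ a hv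

theorem X_pow_mul_aeval_Y_mem_filt (k : ℕ) (p : Polynomial ℂ) :
    XYAlg.X ^ k * Polynomial.aeval XYAlg.Y p ∈ XYAlg.filt p.natDegree := by
  rw [Polynomial.aeval_eq_sum_range, Finset.mul_sum]
  refine Submodule.sum_mem _ fun i hi => ?_
  rw [mul_smul_comm]
  exact Submodule.smul_mem _ _
    (Submodule.subset_span ⟨k, i, Nat.lt_succ_iff.1 (Finset.mem_range.1 hi), rfl⟩)

/-- An element of `ℂ⟨X, Y⟩` that moves level `l'` to level `l` and kills the other levels
below `M`. -/
theorem exists_moveOp (M : ℕ) {l l' : ℕ} (h : l ≤ l') (hl' : l' < M) :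
    ∃ (d : ℕ) (q : XYAlg), q ∈ XYAlg.filt d ∧ ∀ m < M,
      xyAct N q (lvec N m) = if m = l' then lvec N l else 0 := by
  set v : ℕ → ℂ := fun m => ((N - 1 - m : ℤ) : ℂ)
  have hv : Function.Injective v := fun a b hab => by
    have : N - 1 - (a : ℤ) = N - 1 - b := Int.cast_injective hab
    omega
  -- The operator is `X^(l' - l) p(Y)`, where `p` is the Lagrange polynomial equal to 1 at the
  -- eigenvalue of `Y` on level `l'` and to 0 at the eigenvalues on the other levels below `M`.
  refine ⟨_, _, X_pow_mul_aeval_Y_mem_filt (l' - l)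
    (Lagrange.basis (Finset.range M) v l'), fun m hm => ?_⟩
  rw [map_mul, Module.End.mul_apply, xyAct_aeval_Y_lvec, map_smul]
  change (Lagrange.basis (Finset.range M) v l').eval (v m) • _ = _
  split_ifs with hml
  · subst hml
    rw [Lagrange.eval_basis_self hv.injOn (Finset.mem_range.2 hm), one_smul]
    nth_rewrite 2 [show m = l + (m - l) by omega]
    exact xyAct_X_pow_lvec N _ _
  · rw [Lagrange.eval_basis_of_ne (Ne.symm hml) (Finset.mem_range.2 hm), zero_smul]

/-- A matrix unit selects the index in `V_r` and the operator of `exists_moveOp` selects the level.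
By injectivity of `g` only the `k`-th factor survives both, so one term of the derivation remains.
-/
theorem exists_extVrnRep_wedge (M : ℕ) (g : Fin n → ℕ × Fin r) (hg : Function.Injective g)
    (hM : ∀ k, (g k).1 < M) (k : Fin n) (p : ℕ × Fin r) (hp : p.1 ≤ (g k).1) :
    ∃ (d : ℕ) (A : GXY r), GXY.InFilt d A ∧
      extVrnRep r N A (wedge N g) = wedge N (Function.update g k p) := by
  obtain ⟨d, q, hq, hact⟩ := exists_moveOp N M hp (hM k)
  refine ⟨d, Matrix.single p.2 (g k).2 q, fun i j => ?_, ?_⟩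
  · rw [Matrix.single_apply]
    split_ifs
    · exact hq
    · exact Submodule.zero_mem _
  have hu : ∀ l, vrnRep r N (Matrix.single p.2 (g k).2 q) (uBasis N (g l)) =
      if l = k then uBasis N p else 0 := by
    intro l
    rw [uBasis, vrnRep_single]
    funext i
    rw [Matrix.single_apply]
    split_ifs with h1 h2 h2
    · subst h2
      rw [hact _ (hM l), if_pos rfl, uBasis, h1.1, Pi.single_eq_same]
    · rw [hact _ (hM l), if_neg fun h3 => h2 (hg (Prod.ext h3 h1.2.symm))]
      rfl
    · subst h2
      rw [map_zero, LinearMap.zero_apply, uBasis, Pi.single_eq_of_ne]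
      exact fun h3 => h1 ⟨h3.symm, rfl⟩
    · rw [map_zero]; rfl
  change extDer (vrnRep r N _) _ = _
  rw [wedge, extDer_ιMulti, Finset.sum_eq_single k]
  · rw [hu, if_pos rfl, wedge]
    congr 1
    funext l
    rcases eq_or_ne l k with rfl | hl
    · simp
    · simp [hl]
  · intro l _ hl
    rw [hu, if_neg hl, AlternatingMap.map_update_zero]
  · intro h; exact absurd (Finset.mem_univ k) h

theorem ι_mul_envFilt {m d : ℕ} {A : GXY r} (hA : GXY.InFilt d A) :
    ∀ u ∈ envFilt r m, UniversalEnvelopingAlgebra.ι ℂ A * u ∈ envFilt r (m + d) := by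
  intro u hu
  induction hu using Submodule.span_induction with
  | mem u hu =>
    obtain ⟨l, h1, h2, rfl⟩ := hu
    refine Submodule.subset_span ⟨(d, A) :: l, ?_, by simp; omega, by simp⟩
    intro p hp
    rcases List.mem_cons.1 hp with rfl | hp
    · exact hA
    · exact h1 p hp
  | zero => simp
  | add x y _ _ hx hy => rw [mul_add]; exact Submodule.add_mem _ hx hy
  | smul c x _ hx => rw [mul_smul_comm]; exact Submodule.smul_mem _ _ hx

theorem envFilt_mono : Monotone (envFilt r) := fun _ _ h =>
  Submodule.span_mono fun _ ⟨l, h1, h2, h3⟩ => ⟨l, h1, h2.trans h, h3⟩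

theorem weylFilt_mono (ξ : Fin r → ℕ) : Monotone (weylFilt ξ N) := fun _ _ h =>
  Submodule.map_mono (envFilt_mono h)

theorem vXi_mem_weylFilt (ξ : Fin r → ℕ) : vXi ξ N ∈ weylFilt ξ N 0 :=
  ⟨1, Submodule.subset_span ⟨[], by simp, by simp, by simp⟩, by simp⟩

theorem extVrnRep_mem_iSup_weylFilt (ξ : Fin r → ℕ) {d : ℕ} {A : GXY r} (hA : GXY.InFilt d A) :
    ∀ v ∈ ⨆ i, weylFilt ξ N i, extVrnRep r N A v ∈ ⨆ i, weylFilt ξ N i := by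
  intro v hv
  rw [Submodule.mem_iSup_of_directed _ (weylFilt_mono N ξ).directed_le] at hv ⊢
  obtain ⟨i, u, hu, rfl⟩ := hv
  exact ⟨i + d, _, ι_mul_envFilt hA u hu, by simp⟩

end Operators

/-! ## Exchanging basis vectors -/

section Exchange

/-- Take `p` and `q` of maximal level in the two differences. Replacing `p` by `q` brings `G` closer
to `H` and raises one level, yet keeps the inequalities. -/
theorem exists_exchange {α : Type*} [DecidableEq α] (lev : α → ℕ) (G H : Finset α)
    (hcard : G.card = H.card)
    (hle : ∀ L, (H.filter fun x => lev x < L).card ≤ (G.filter fun x => lev x < L).card)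
    (hne : G ≠ H) : ∃ p ∈ G \ H, ∃ q ∈ H \ G, lev p ≤ lev q ∧
      ∀ L, (H.filter fun x => lev x < L).card ≤
        ((insert q (G.erase p)).filter fun x => lev x < L).card := by
  have h1 : (G \ H).Nonempty := Finset.sdiff_nonempty.2 fun h =>
    hne (Finset.eq_of_subset_of_card_le h hcard.ge)
  have h2 : (H \ G).Nonempty := Finset.sdiff_nonempty.2 fun h =>
    hne (Finset.eq_of_subset_of_card_le h hcard.le).symm
  obtain ⟨p, hp, hpmax⟩ := Finset.exists_max_image _ lev h1
  obtain ⟨q, hq, hqmax⟩ := Finset.exists_max_image _ lev h2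
  have hp' := Finset.mem_sdiff.1 hp
  have hq' := Finset.mem_sdiff.1 hq
  have hsplit : ∀ (S : Finset α) L, (S.filter fun x => lev x < L).card +
      (S.filter fun x => ¬ lev x < L).card = S.card :=
    fun S L => Finset.card_filter_add_card_filter_not _
  have hG' : (insert q (G.erase p)).card = G.card := by
    rw [Finset.card_insert_of_notMem fun h => hq'.2 (Finset.mem_of_mem_erase h),
      Finset.card_erase_add_one hp'.1]
  refine ⟨p, hp, q, hq, ?_, fun L => ?_⟩
  · by_contra hlt
    -- If `q` were lower than `p`, all elements of `H` at levels from `lev p` up would lie in `G`,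
    -- which has `p` in addition; then `G` would have too few low elements.
    have hss : (H.filter fun x => ¬ lev x < lev p) ⊂ G.filter fun x => ¬ lev x < lev p := by
      refine Finset.ssubset_iff_of_subset (fun x hx => ?_) |>.2 ⟨p, ?_, ?_⟩
      · obtain ⟨hxH, hx⟩ := Finset.mem_filter.1 hx
        refine Finset.mem_filter.2 ⟨?_, hx⟩
        by_contra hxG
        have := hqmax x (Finset.mem_sdiff.2 ⟨hxH, hxG⟩)
        omega
      · exact Finset.mem_filter.2 ⟨hp'.1, lt_irrefl _⟩
      · exact fun h => hp'.2 (Finset.mem_filter.1 h).1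
    have h3 := Finset.card_lt_card hss
    have h4 := hle (lev p)
    have h5 := hsplit G (lev p)
    have h6 := hsplit H (lev p)
    omega
  · rcases le_or_gt L (lev p) with hL | hL
    · refine (hle L).trans (Finset.card_le_card fun x hx => ?_)
      obtain ⟨hxG, hx⟩ := Finset.mem_filter.1 hx
      refine Finset.mem_filter.2 ⟨Finset.mem_insert_of_mem (Finset.mem_erase.2 ⟨?_, hxG⟩), hx⟩
      rintro rfl
      omega
    · have hss : ((insert q (G.erase p)).filter fun x => ¬ lev x < L).card ≤
          (if lev q < L then G.filter fun x => ¬ lev x < L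
            else H.filter fun x => ¬ lev x < L).card := by
        refine Finset.card_le_card fun x hx => ?_
        obtain ⟨hx, hxL⟩ := Finset.mem_filter.1 hx
        split_ifs with hqL
        · rcases Finset.mem_insert.1 hx with rfl | hx
          · exact absurd hqL hxL
          · exact Finset.mem_filter.2 ⟨Finset.mem_of_mem_erase hx, hxL⟩
        · refine Finset.mem_filter.2 ⟨?_, hxL⟩
          rcases Finset.mem_insert.1 hx with rfl | hx
          · exact hq'.1
          · by_contra hxH
            have := hpmax x (Finset.mem_sdiff.2 ⟨Finset.mem_of_mem_erase hx, hxH⟩)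
            omega
      have h3 := hle L
      have h4 := hsplit G L
      have h5 := hsplit H L
      have h6 := hsplit (insert q (G.erase p)) L
      split_ifs at hss <;> omega

theorem exists_perm_comp_eq {α : Type*} {n : ℕ} {g g' : Fin n → α} (hg : Function.Injective g)
    (hg' : Function.Injective g') (h : Set.range g = Set.range g') :
    ∃ σ : Equiv.Perm (Fin n), (fun k => g' (σ k)) = g := by
  refine ⟨(Equiv.ofInjective g hg).trans ((Equiv.setCongr h).trans (Equiv.ofInjective g' hg').symm),
    funext fun k => ?_⟩
  exact Equiv.apply_ofInjective_symm hg' _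

variable {r n : ℕ} (N : ℤ)

/-- A subspace that is closed under lowering one factor of a wedge contains all the wedges with
enough factors of low level. -/
theorem wedge_mem_of_closed (Q : Submodule ℂ (ExteriorAlgebra ℂ (VrN r N))) (M : ℕ)
    (hQ : ∀ g : Fin n → ℕ × Fin r, Function.Injective g → (∀ k, (g k).1 < M) → wedge N g ∈ Q →
      ∀ k (p : ℕ × Fin r), p.1 ≤ (g k).1 → wedge N (Function.update g k p) ∈ Q)
    (g₀ : Fin n → ℕ × Fin r) (hg₀ : Function.Injective g₀) (hM : ∀ k, (g₀ k).1 < M)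
    (h₀ : wedge N g₀ ∈ Q) (g : Fin n → ℕ × Fin r)
    (hg : ∀ L, (Finset.univ.filter fun k => (g₀ k).1 < L).card ≤
      (Finset.univ.filter fun k => (g k).1 < L).card) : wedge N g ∈ Q := by
  by_cases hinj : Function.Injective g
  swap
  · rw [wedge_eq_zero N g hinj]
    exact Q.zero_mem
  have himg : ∀ (g : Fin n → ℕ × Fin r) (_ : Function.Injective g) (L : ℕ),
      ((Finset.univ.image g).filter fun x => x.1 < L).card =
        (Finset.univ.filter fun k => (g k).1 < L).card := by
    intro g hg L
    rw [Finset.filter_image, Finset.card_image_of_injective _ hg]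
  induction hs : (Finset.univ.image g \ Finset.univ.image g₀).card using Nat.strong_induction_on
    generalizing g with
  | _ s ih =>
  by_cases heq : Finset.univ.image g = Finset.univ.image g₀
  · have hr : Set.range g = Set.range g₀ := by
      have := congrArg (fun S : Finset (ℕ × Fin r) => (S : Set (ℕ × Fin r))) heq
      simpa using this
    obtain ⟨σ, rfl⟩ := exists_perm_comp_eq hinj hg₀ hr
    rw [wedge_perm N g₀ σ]
    exact Q.smul_mem _ h₀
  · obtain ⟨p, hp, q, hq, hpq, hL⟩ := exists_exchange (fun x : ℕ × Fin r => x.1)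
      (Finset.univ.image g) (Finset.univ.image g₀)
      (by rw [Finset.card_image_of_injective _ hinj, Finset.card_image_of_injective _ hg₀])
      (fun L => by rw [himg g hinj, himg g₀ hg₀]; exact hg L) heq
    obtain ⟨hpg, hp0⟩ := Finset.mem_sdiff.1 hp
    obtain ⟨hq0, hqg⟩ := Finset.mem_sdiff.1 hq
    obtain ⟨k, -, rfl⟩ := Finset.mem_image.1 hpg
    have hqg' : ∀ l, g l ≠ q := fun l h => hqg (Finset.mem_image.2 ⟨l, Finset.mem_univ l, h⟩)
    set g' := Function.update g k q with hg'
    have hinj' : Function.Injective g' := by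
      intro a b hab
      rcases eq_or_ne a k with ha | ha <;> rcases eq_or_ne b k with hb | hb
      · rw [ha, hb]
      · rw [hg', ha, Function.update_self, Function.update_of_ne hb] at hab
        exact absurd hab.symm (hqg' b)
      · rw [hg', hb, Function.update_self, Function.update_of_ne ha] at hab
        exact absurd hab (hqg' a)
      · rw [hg', Function.update_of_ne ha, Function.update_of_ne hb] at hab
        exact hinj hab
    have himg' : Finset.univ.image g' = insert q ((Finset.univ.image g).erase (g k)) := by
      ext x
      simp only [Finset.mem_image, Finset.mem_univ, true_and, Finset.mem_insert, Finset.mem_erase]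
      constructor
      · rintro ⟨l, rfl⟩
        rcases eq_or_ne l k with rfl | hl
        · left; simp [hg']
        · right
          rw [hg', Function.update_of_ne hl]
          exact ⟨hinj.ne hl, l, rfl⟩
      · rintro (rfl | ⟨hx, l, rfl⟩)
        · exact ⟨k, by simp [hg']⟩
        · exact ⟨l, by rw [hg', Function.update_of_ne fun h => hx (by rw [h])]⟩
    have hcount : ∀ L, (Finset.univ.filter fun k => (g₀ k).1 < L).card ≤
        (Finset.univ.filter fun k => (g' k).1 < L).card := fun L => by
      rw [← himg g' hinj', himg', ← himg g₀ hg₀]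
      exact hL L
    have hlt : (Finset.univ.image g' \ Finset.univ.image g₀).card < s := by
      rw [← hs]
      refine Finset.card_lt_card (Finset.ssubset_iff_of_subset (fun x hx => ?_) |>.2
        ⟨g k, hp, fun h => ?_⟩)
      · obtain ⟨hx, hx0⟩ := Finset.mem_sdiff.1 hx
        rw [himg'] at hx
        rcases Finset.mem_insert.1 hx with rfl | hx
        · exact absurd hq0 hx0
        · exact Finset.mem_sdiff.2 ⟨Finset.mem_of_mem_erase hx, hx0⟩
      · have := (Finset.mem_sdiff.1 h).1
        rw [himg'] at this
        rcases Finset.mem_insert.1 this with h | h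
        · exact hqg' k h
        · exact (Finset.mem_erase.1 h).1 rfl
    -- The count at `L = M` equals `n` for `g₀`, so it equals `n` for `g'` as well.
    have hM' : ∀ l, (g' l).1 < M := by
      have h1 := hcount M
      rw [Finset.filter_true_of_mem fun k _ => hM k, Finset.card_univ, Fintype.card_fin] at h1
      have h2 := Finset.eq_univ_of_card (Finset.univ.filter fun k => (g' k).1 < M)
        (le_antisymm (Finset.card_le_univ _) (by rwa [Fintype.card_fin]))
      intro l
      exact (Finset.mem_filter.1 (h2 ▸ Finset.mem_univ l : l ∈ _)).2
    -- The wedge of `g'` is in `Q` by induction, and lowering its `k`-th factor from `q` back to `g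
    -- k` gives the wedge of `g`.
    have h3 := hQ g' hinj' hM' (ih _ hlt g' hcount hinj' rfl) k (g k) (by simpa [hg'] using hpq)
    rwa [hg', Function.update_idem, Function.update_eq_self] at h3

end Exchange

/-! ## Parking functions and the vector `v_ξ` -/

section Parking

/-- Since `ρ` is nonincreasing, its `s`-th smallest part is at most `L` exactly when at least `s`
parts are. One direction takes `s` to be the number of parts up to `L`, the other takes `L` to be
the `s`-th smallest part. -/
theorem isParking_iff {n : ℕ} {ρ : List ℕ} (hρ : ρ.Pairwise (· ≥ ·)) (f : Fin n → Fin n) :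
    IsParking ρ f ↔ ∀ L, ρ.countP (· ≤ L) ≤
      (Finset.univ.filter fun i => (f i : ℕ) + 1 ≤ L).card := by
  constructor
  · intro h L
    rcases Nat.eq_zero_or_pos (ρ.countP (· ≤ L)) with h0 | hpos
    · rw [h0]; exact Nat.zero_le _
    have hle : ρ.countP (· ≤ L) ≤ ρ.length := List.countP_le_length
    set s := ρ.countP (· ≤ L) with hs
    have hi : ρ.length - s < ρ.length := by omega
    refine (h s hpos hle).trans (Finset.card_le_card fun i hi' => ?_)
    obtain ⟨-, hi'⟩ := Finset.mem_filter.1 hi'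
    refine Finset.mem_filter.2 ⟨Finset.mem_univ i, hi'.trans ?_⟩
    by_contra hgt
    -- If the `s`-th smallest part exceeded `L`, so would all parts before it in the list, and only
    -- `s - 1` parts would remain.
    have htake : (ρ.take (ρ.length - s + 1)).countP (· ≤ L) = 0 := by
      rw [List.countP_eq_zero]
      intro x hx
      obtain ⟨j, hj, rfl⟩ := List.mem_take_iff_getElem.1 hx
      have hj' : j ≤ ρ.length - s := by omega
      have : ρ[j] ≥ ρ[ρ.length - s] := by
        rcases hj'.eq_or_lt with rfl | hlt
        · exact le_rfl
        · exact List.pairwise_iff_getElem.1 hρ _ _ _ hi hlt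
      simp only [decide_eq_true_eq]
      omega
    have h1 := List.take_append_drop (ρ.length - s + 1) ρ
    have h2 : s = (ρ.drop (ρ.length - s + 1)).countP (· ≤ L) := by
      rw [hs]
      conv_lhs => rw [← h1]
      rw [List.countP_append, htake, zero_add]
    have h3 : (ρ.drop (ρ.length - s + 1)).countP (· ≤ L) ≤
        (ρ.drop (ρ.length - s + 1)).length := List.countP_le_length
    rw [List.length_drop] at h3
    omega
  · intro h s h1 h2
    have hi : ρ.length - s < ρ.length := by omega
    refine le_trans ?_ (h ρ[ρ.length - s])
    have h3 : (ρ.drop (ρ.length - s)).countP (· ≤ ρ[ρ.length - s]) =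
        (ρ.drop (ρ.length - s)).length := by
      rw [List.countP_eq_length]
      intro x hx
      obtain ⟨j, hj, rfl⟩ := List.mem_drop_iff_getElem.1 hx
      simp only [decide_eq_true_eq]
      rcases Nat.eq_zero_or_pos j with rfl | hpos
      · exact le_rfl
      · exact List.pairwise_iff_getElem.1 hρ _ _ hi (by omega) (Nat.lt_add_of_pos_right hpos)
    rw [List.length_drop] at h3
    have h4 := (List.drop_sublist (ρ.length - s) ρ).countP_le (p := (· ≤ ρ[ρ.length - s]))
    omega

variable {r : ℕ} (ξ : Fin r → ℕ)

theorem rhoList_pairwise : (rhoList ξ).Pairwise (· ≥ ·) := by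
  rw [rhoList, List.pairwise_flatMap]
  refine ⟨fun j _ => List.pairwise_replicate.2 (Or.inr le_rfl), ?_⟩
  rw [List.pairwise_reverse]
  refine List.pairwise_lt_range.imp fun {a b} hab x hx y hy => ?_
  rw [List.eq_of_mem_replicate hx, List.eq_of_mem_replicate hy]
  omega

theorem le_sum_parts (j : Fin r) : ξ j ≤ ∑ j, ξ j :=
  Finset.single_le_sum (fun _ _ => Nat.zero_le _) (Finset.mem_univ j)

theorem conj_eq_zero {l : ℕ} (h : ∑ j, ξ j ≤ l) : conj ξ (l + 1) = 0 := by
  rw [conj, Finset.card_eq_zero, Finset.filter_eq_empty_iff]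
  intro j _ hj
  have := le_sum_parts ξ j
  omega

/-- Cutting the list at `|ξ|` loses nothing, because `ξ^t` vanishes beyond it. -/
theorem countP_rhoList (L : ℕ) :
    (rhoList ξ).countP (· ≤ L) = ∑ l ∈ Finset.range L, conj ξ (l + 1) := by
  rw [rhoList, List.countP_flatMap, List.map_reverse, List.sum_reverse]
  have h1 : ∀ l, (List.replicate (conj ξ (l + 1)) (l + 1)).countP (· ≤ L) =
      if l < L then conj ξ (l + 1) else 0 := by
    intro l
    rw [List.countP_replicate]
    exact if_congr (by simp) rfl rfl
  have h2 : ((List.range (∑ j, ξ j)).map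
      (List.countP (· ≤ L) ∘ fun l => List.replicate (conj ξ (l + 1)) (l + 1))).sum =
      ∑ l ∈ Finset.range (∑ j, ξ j), if l < L then conj ξ (l + 1) else 0 := by
    rw [Finset.sum_range, Fin.sum_univ_def, ← List.map_coe_finRange_eq_range, List.map_map]
    congr 1
    exact List.map_congr_left fun l _ => h1 l
  rw [h2, ← Finset.sum_filter]
  refine Finset.sum_subset (fun l hl => Finset.mem_range.2 (Finset.mem_filter.1 hl).2) ?_
  intro l hl hl'
  refine conj_eq_zero ξ ?_
  by_contra h
  exact hl' (Finset.mem_filter.2 ⟨Finset.mem_range.2 (not_le.1 h), Finset.mem_range.1 hl⟩)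

/-- The vector `v_ξ` is the wedge of the `u_j ⊗ x^(N - 1 - l)` with `l < ξ_j`. -/
theorem exists_wedge_eq_vXi (N : ℤ) {n : ℕ} (hn : n = ∑ j, ξ j) :
    ∃ g : Fin n → ℕ × Fin r, Function.Injective g ∧
      (∀ p, p ∈ Set.range g ↔ p.1 < ξ p.2) ∧ wedge N g = vXi ξ N := by
  set l : List (ℕ × Fin r) := (List.finRange r).flatMap fun j =>
    (List.range (ξ j)).map fun t => (ξ j - 1 - t, j) with hl
  have hlen : l.length = n := by
    rw [hn, hl, List.length_flatMap, Fin.sum_univ_def]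
    simp
  have hmem : ∀ p, p ∈ l ↔ p.1 < ξ p.2 := by
    rintro ⟨a, j⟩
    simp only [hl, List.mem_flatMap, List.mem_finRange, true_and, List.mem_map, List.mem_range,
      Prod.mk.injEq]
    constructor
    · rintro ⟨j, t, ht, rfl, rfl⟩
      omega
    · intro h
      exact ⟨j, ξ j - 1 - a, by omega, by omega, rfl⟩
  have hnodup : l.Nodup := by
    rw [hl, List.nodup_flatMap]
    refine ⟨fun j _ => ?_, ?_⟩
    · refine List.Nodup.map_on (fun a ha b hb hab => ?_) List.nodup_range
      have h1 := List.mem_range.1 ha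
      have h2 := List.mem_range.1 hb
      have h3 := congrArg Prod.fst hab
      simp only at h3
      omega
    · refine (List.nodup_finRange r).imp fun {a b} hab => ?_
      rw [Function.onFun, List.disjoint_left]
      intro x hx hx'
      obtain ⟨t, -, rfl⟩ := List.mem_map.1 hx
      obtain ⟨t', -, h⟩ := List.mem_map.1 hx'
      exact hab (congrArg Prod.snd h).symm
  have hvec : vXi ξ N = (l.map fun p => ExteriorAlgebra.ι ℂ (uBasis N p)).prod := by
    rw [vXi, hl, List.map_flatMap]
    congr 1
    refine List.flatMap_congr fun j _ => ?_
    -- In `vXi` the list of exponents is coerced to a list of integers, and the coercion takes this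
    -- monadic form. The exponent `N - ξ_j + t` has level `ξ_j - 1 - t`.
    have hcast : (do let t ← List.range (ξ j); pure (t : ℤ)) = (List.range (ξ j)).map Nat.cast :=
      List.map_eq_flatMap.symm
    rw [hcast, List.map_map, List.map_map]
    refine List.map_congr_left fun t ht => ?_
    have ht := List.mem_range.1 ht
    have hexp : N - (ξ j : ℤ) + (t : ℤ) = N - 1 - ((ξ j - 1 - t : ℕ) : ℤ) := by omega
    change ExteriorAlgebra.ι ℂ (uVec N j (N - (ξ j : ℤ) + (t : ℤ))) = _
    rw [hexp]
    rfl
  subst hlen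
  refine ⟨l.get, List.nodup_iff_injective_get.1 hnodup, fun p => ?_, ?_⟩
  · rw [← hmem, List.mem_iff_get]
    rfl
  · rw [hvec, wedge, ExteriorAlgebra.ιMulti_apply]
    conv_rhs => rw [← List.ofFn_get l, List.map_ofFn]
    rfl

/-- `v_ξ` has a factor `u_j` at level `l` exactly when `l + 1 ≤ ξ_j`. The result agrees with
`countP_rhoList`, so the parking condition compares level counts with those of `v_ξ`. -/
theorem card_filter_level {n : ℕ} {g : Fin n → ℕ × Fin r} (hg : Function.Injective g)
    (hrange : ∀ p, p ∈ Set.range g ↔ p.1 < ξ p.2) (L : ℕ) :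
    (Finset.univ.filter fun k => (g k).1 < L).card = ∑ l ∈ Finset.range L, conj ξ (l + 1) := by
  rw [← Finset.card_image_of_injective _ hg]
  have h1 : (Finset.univ.filter fun k => (g k).1 < L).image g =
      (Finset.range L ×ˢ Finset.univ).filter fun p => p.1 + 1 ≤ ξ p.2 := by
    ext p
    simp only [Finset.mem_image, Finset.mem_filter, Finset.mem_univ, true_and,
      Finset.mem_product, Finset.mem_range, and_true, Nat.succ_le_iff]
    rw [← hrange]
    constructor
    · rintro ⟨k, hk, rfl⟩
      exact ⟨hk, k, rfl⟩
    · rintro ⟨hp, k, rfl⟩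
      exact ⟨k, hp, rfl⟩
  rw [h1, Finset.card_filter, Finset.sum_product]
  exact Finset.sum_congr rfl fun l _ => (Finset.card_filter _ _).symm

/-- The deformed Weyl module is the span of the parking wedges. -/
theorem iSup_weylFilt (N : ℤ) {n : ℕ} (hn : n = ∑ j, ξ j) :
    ⨆ i, weylFilt ξ N i = LinearMap.range (pfWedge N r n (rhoList ξ)) := by
  obtain ⟨g₀, hg₀, hrange, hvec⟩ := exists_wedge_eq_vXi ξ N hn
  have hcard := card_filter_level ξ hg₀ hrange
  have hlt : ∀ k, (g₀ k).1 < n := fun k =>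
    ((hrange _).1 ⟨k, rfl⟩).trans_le (hn ▸ le_sum_parts ξ _)
  have hpark : ∀ f : Fin n → Fin n, IsParking (rhoList ξ) f ↔ ∀ L,
      (Finset.univ.filter fun k => (g₀ k).1 < L).card ≤
        (Finset.univ.filter fun k => (f k : ℕ) < L).card := fun f => by
    rw [isParking_iff (rhoList_pairwise ξ)]
    refine forall_congr' fun L => ?_
    rw [countP_rhoList, hcard]
    rfl
  refine le_antisymm (iSup_le fun i => ?_) ?_
  · refine LieRep.orbit_le _ _ (extVrnRep_range_pfWedge N (rhoList ξ)) ?_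
    rw [← hvec, range_pfWedge]
    -- `v_ξ` is itself a parking wedge, the extreme case in which all the inequalities are
    -- equalities.
    exact Submodule.subset_span ⟨(⟨fun k => ⟨(g₀ k).1, hlt k⟩, (hpark _).2 fun L => le_rfl⟩,
      fun k => (g₀ k).2), rfl⟩
  · rw [range_pfWedge, Submodule.span_le]
    rintro _ ⟨⟨f, c⟩, rfl⟩
    refine wedge_mem_of_closed N _ n (fun g hg hM hmem k p hp => ?_) g₀ hg₀ hlt ?_ _
      ((hpark f.fn).1 f.2)
    · obtain ⟨d, A, hA, hact⟩ := exists_extVrnRep_wedge N n g hg hM k p hp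
      rw [← hact]
      exact extVrnRep_mem_iSup_weylFilt N ξ hA _ hmem
    · rw [hvec]
      exact le_iSup (weylFilt ξ N) 0 (vXi_mem_weylFilt N ξ)

instance (n : ℕ) (ρ : List ℕ) : Finite (PF n ρ) :=
  inferInstanceAs (Finite {f : Fin n → Fin n // IsParking ρ f})

instance (n : ℕ) (ρ : List ℕ) : FiniteDimensional ℂ (MonoidAlgebra ℂ (PF n ρ)) :=
  Module.Finite.equiv (MonoidAlgebra.coeffLinearEquiv ℂ).symm

/-- `V(ξ) ≅ (V_r^{⊗ n} ⊗ ℂPF_n(ρ) ⊗ Sign)^{Σ_n}`. -/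
theorem weylGrRep_iso (N : ℤ) {n : ℕ} (hn : n = ∑ j, ξ j) :
    (weylGrRep ξ N).Iso (swInvRep r (pfSignRep n (rhoList ξ))) := by
  refine LieRep.Iso.trans ?_ (swInvRep_iso_range_pfWedge N n (rhoList ξ)).symm
  -- Complete reducibility is inherited from the tensor product, of which the span of the parking
  -- wedges is an equivariant image.
  exact LieRep.gr_iso (extGlRep r N) _ (range_pfWedge_stable N n (rhoList ξ))
    ((hasComplements_leftGlRep r n _).range _ (pfWedge_leftGl N)) (weylFiltPrev ξ N)
    (weylFilt ξ N) (weylFiltPrev_stable ξ N) (weylFilt_stable ξ N) rfl (fun _ => rfl)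
    (weylFilt_mono N ξ) (iSup_weylFilt ξ N hn)

end Parking

end DeformedWeyl

end

/-! ### The main theorem. -/

open DeformedWeyl in
theorem mainTheorem7 (r : ℕ) (ξ : Fin r → ℕ) (hξ : Antitone ξ) (N : ℤ) (n : ℕ)
    (hn : n = ∑ j, ξ j) :
    (weylGrRep ξ N).Iso (swInvRep r (pfSignRep n (rhoList ξ))) ∧
    IsFrobeniusImage r (pfSignRep n (rhoList ξ)) (weylGrRep ξ N) ∧
    ∀ η : Fin r → ℤ,
      ((∀ i, 0 ≤ η i) ∧ ∑ i, η i = n →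
        Module.finrank ℂ (weightSpace (weylGrRep ξ N) η) =
          Module.finrank ℂ (Representation.invariants
            ((pfSignRep n (rhoList ξ)).comp
              (youngSubgroup n fun i => (η i).toNat).subtype))) ∧
      (¬ ((∀ i, 0 ≤ η i) ∧ ∑ i, η i = n) →
        Module.finrank ℂ (weightSpace (weylGrRep ξ N) η) = 0) := by
  have h := weylGrRep_iso ξ N hn
  refine ⟨h, isFrobeniusImage_of_iso _ _ h, fun η => ⟨fun hη => ?_, fun hη => ?_⟩⟩
  · have hcast : (fun i => ((η i).toNat : ℤ)) = η := funext fun i => Int.toNat_of_nonneg (hη.1 i)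
    have hsum : ∑ i, (η i).toNat = n := by
      have := hη.2
      rw [← hcast, ← Nat.cast_sum] at this
      exact Nat.cast_injective this
    have h1 := finrank_weightSpace_swInv (μ := pfSignRep n (rhoList ξ)) _ hsum
    rw [hcast] at h1
    exact (finrank_weightSpace_of_iso h η).trans h1
  · exact (finrank_weightSpace_of_iso h η).trans (finrank_weightSpace_eq_zero η hη)
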